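/- **Setting.** Let $d\in\mathbb N$, let $1<p<\infty$ with conjugate exponent $q$, and let $a<b$ be real. Let $\mathcal M_{\mathrm{loc}}(\mathbb R^d)$ be the set of signed Radon measures on $\mathbb R^d$ (the positive and negative parts are finite on bounded sets, but may both have infinite total mass), $\mathcal M_{\mathrm{loc}}(\mathbb R^d;\mathbb R^d)$ the set of $\mathbb R^d$-valued ones, and $\gamma$ a nonnegative Radon measure on $\mathbb R^d$. Let $\phi\in\mathcal A_p(a,b)$, i.e. $\phi:\mathbb R\times\mathbb R^d\to[0,+\infty]$ is convex and lower semicontinuous, the interior of $\mathrm{dom}(\phi)=\{\phi<+\infty\}$ is $(a,b)\times\mathbb R^d$, and: - for every $\rho$ such that $\phi(\rho,\cdot)\not\equiv+\infty$, one has $\phi(\rho,0)=0$ and $\phi(\rho,\lambda w)=|\lambda|^p\phi(\rho,w)$ for all $\lambda\ne0$ and $w\in\mathbb R^d$; - there is $\rho_0$ such that $\phi(\rho_0,w)<+\infty$ for all $w$ and $\phi(\rho_0,w)>0$ for all $w\neq0$. Let $\phi^\infty(y)=\sup\{\phi(x+y)-\phi(x):x\in\mathrm{dom}(\phi)\}$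 be its recession functional. With the Lebesgue decompositions $\mu=\rho\gamma+\mu^\perp$, $\nu=w\gamma+\nu^\perp$, and $\theta:=|\mu^\perp|+|\nu^\perp|$, $\mu^\perp=\rho^\perp\theta$, $\nu^\perp=w^\perp\theta$, put $$\Phi(\mu,\nu|\gamma)=\int\phi(\rho,w)\,d\gamma+\int\phi^\infty(\rho^\perp,w^\perp)\,d\theta .$$ For $\mu^0,\mu^1\in\mathcal M_{\mathrm{loc}}(\mathbb R^d)$ let $$\mathcal W_{\phi,\gamma}(\mu^0,\mu^1)=\inf\Big(\int_0^1\Phi(\mu_t,\nu_t|\gamma)\,dt\Big)^{1/p}\in[0,+\infty],$$ where the infimum ($+\infty$ if there is no such curve) runs over all $(\mu_t,\nu_t)_{t\in[0,1]}$ of finite energy $\int_0^1\Phi(\mu_t,\nu_t|\gamma)\,dt<+\infty$ such that $t\mapsto\mu_t\in\mathcal M_{\mathrm{loc}}(\mathbb R^d)$ is weakly* continuous on $[0,1]$ with $\mu_{t=0}=\mu^0$ and $\mu_{t=1}=\mu^1$, $(\nu_t)$ is a Borel family in $\mathcal M_{\mathrm{loc}}(\mathbb R^d;\mathbb R^d)$,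 $\int_0^1(|\mu_t|+|\nu_t|)(B(0,R))\,dt<+\infty$ for every $R>0$, and $\partial_t\mu_t+\mathrm{div}\,\nu_t=0$ in the sense of distributions in $\mathbb R^d\times(0,1)$, with test functions in $C^1_c(\mathbb R^d\times(0,1))$. For $\sigma\in\mathcal M_{\mathrm{loc}}(\mathbb R^d)$ let $\mathcal M[\sigma]=\{\mu\in\mathcal M_{\mathrm{loc}}(\mathbb R^d):\mathcal W_{\phi,\gamma}(\mu,\sigma)<+\infty\}$. Finally let $$\tilde{\mathrm m}_{-q}(\gamma)=\gamma(B(0,1))+\int_{\mathbb R^d\setminus B(0,1)}|x|^{-q}\,d\gamma(x).$$ **Proposition (completeness and equality of the mass).** 1. $\mathcal M_{\mathrm{loc}}(\mathbb R^d)$ endowed with $\mathcal W_{\phi,\gamma}$ is complete: if $\mathcal W_{\phi,\gamma}(\mu_m,\mu_n)\to0$ as $m,n\to\infty$, then there is $\mu\in\mathcal M_{\mathrm{loc}}(\mathbb R^d)$ such that $\mathcal W_{\phi,\gamma}(\mu_n,\mu)\to0$. 2. For every $\sigma\in\mathcal M_{\mathrm{loc}}(\mathbb R^d)$, the restriction of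 $\mathcal W_{\phi,\gamma}$ to $\mathcal M[\sigma]$ is a (finite) metric, and $\mathcal M[\sigma]$ is a complete metric space. (It may be empty: $\mathcal W_{\phi,\gamma}(\sigma,\sigma)=+\infty$ if $\sigma$ is not of the form $\rho\gamma$ with $a\le\rho\le b$.) 3. Suppose $\tilde{\mathrm m}_{-q}(\gamma)<+\infty$. Then every $\mu\in\mathcal M[\sigma]$ has the same total mass as $\sigma$, in the following sense. For every nonnegative $\zeta\in C^1_c(\mathbb R^d)$ equal to $1$ near the origin, $$\lim_{R\to+\infty}\Big(\int\zeta(x/R)\,d\mu(x)-\int\zeta(x/R)\,d\sigma(x)\Big)=0.$$ If $\sigma(\mathbb R^d)$ is well defined in $[-\infty,+\infty]$ (that is, the positive or the negative part of $\sigma$ is finite), then $\lim_{R\to+\infty}\int\zeta(x/R)\,d\mu(x)=\sigma(\mathbb R^d)$ for every such $\zeta$. If $\mu(\mathbb R^d)$ is also well defined in $[-\infty,+\infty]$, then $\mu(\mathbb R^d)=\sigma(\mathbb R^d)$. -/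

import Mathlib

open MeasureTheory Filter Topology
open scoped ENNReal

/-- The Euclidean space `ℝ^d`. -/
abbrev Eucl (d : ℕ) : Type := EuclideanSpace ℝ (Fin d)

/-- A signed Radon measure on `ℝ^d` (an element of `M_loc(ℝ^d)`), given by its Jordan decomposition:
two mutually singular nonnegative Borel measures that are finite on bounded sets. Both parts may
have infinite total mass. -/
@[ext]
structure SignedRadon (d : ℕ) where
  pos : Measure (Eucl d)
  neg : Measure (Eucl d)
  pos_locallyFinite : IsLocallyFiniteMeasure pos
  neg_locallyFinite : IsLocallyFiniteMeasure neg
  mutuallySingular : pos ⟂ₘ neg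

/-- An `ℝ^d`-valued Radon measure on `ℝ^d`, given by its components. -/
abbrev VectorRadon (d : ℕ) : Type := Fin d → SignedRadon d

noncomputable section

namespace SignedRadon

variable {d : ℕ}

/-- The value `μ(B)`, for a bounded Borel set `B`. -/
def eval (μ : SignedRadon d) (B : Set (Eucl d)) : ℝ :=
  (μ.pos B).toReal - (μ.neg B).toReal

/-- The total variation measure `|μ|`. -/
def tv (μ : SignedRadon d) : Measure (Eucl d) := μ.pos + μ.neg

/-- The integral `∫ f dμ`, for a continuous function `f` with compact support. -/
def integral (μ : SignedRadon d) (f : Eucl d → ℝ) : ℝ :=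
  (∫ x, f x ∂μ.pos) - ∫ x, f x ∂μ.neg

/-- The density `ρ` in the Lebesgue decomposition `μ = ρ γ + μ^⊥`. -/
def density (μ : SignedRadon d) (γ : Measure (Eucl d)) (x : Eucl d) : ℝ :=
  (μ.pos.rnDeriv γ x).toReal - (μ.neg.rnDeriv γ x).toReal

/-- The singular part `μ^⊥` in the Lebesgue decomposition `μ = ρ γ + μ^⊥`. -/
def singular (μ : SignedRadon d) (γ : Measure (Eucl d)) : SignedRadon d where
  pos := μ.pos.singularPart γ
  neg := μ.neg.singularPart γ
  pos_locallyFinite :=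
    have := μ.pos_locallyFinite
    inferInstance
  neg_locallyFinite :=
    have := μ.neg_locallyFinite
    inferInstance
  mutuallySingular :=
    (μ.mutuallySingular.mono_ac (Measure.absolutelyContinuous_of_le
      (Measure.singularPart_le _ _)) (Measure.absolutelyContinuous_of_le
      (Measure.singularPart_le _ _)))

/-- The total mass `μ(ℝ^d)` is meaningful as an element of `[-∞, +∞]`: it is not of the
form `∞ - ∞`. -/
def MassDefined (μ : SignedRadon d) : Prop :=
  μ.pos Set.univ < ∞ ∨ μ.neg Set.univ < ∞

/-- The total mass `μ(ℝ^d)` in `[-∞, +∞]` (meaningful under `MassDefined`). -/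
def totalMass (μ : SignedRadon d) : EReal :=
  (μ.pos Set.univ : EReal) - (μ.neg Set.univ : EReal)

/-- The mass of `μ` seen through the cutoff `ζ(x / R)`, that is `∫ ζ(x / R) dμ(x)`. -/
def cutoffMass (μ : SignedRadon d) (ζ : Eucl d → ℝ) (R : ℝ) : ℝ :=
  μ.integral (fun x => ζ (R⁻¹ • x))

end SignedRadon

namespace VectorRadon

variable {d : ℕ}

/-- The sum of the total variations of the components. It lies between the total variation `|ν|`
and `√d |ν|`; it is used only for local finiteness and as a measure that dominates `ν`, for which
it is interchangeable with `|ν|`. -/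
def tv (ν : VectorRadon d) : Measure (Eucl d) := ∑ i, (ν i).tv

/-- The density `w` in the Lebesgue decomposition `ν = w γ + ν^⊥`. -/
def density (ν : VectorRadon d) (γ : Measure (Eucl d)) (x : Eucl d) : Eucl d :=
  WithLp.toLp 2 (fun i => (ν i).density γ x)

/-- The singular part `ν^⊥` in the Lebesgue decomposition `ν = w γ + ν^⊥`. -/
def singular (ν : VectorRadon d) (γ : Measure (Eucl d)) : VectorRadon d :=
  fun i => (ν i).singular γ

end VectorRadon

section ActionDensity

variable {d : ℕ}

/-- The effective domain of a function `φ : ℝ × ℝ^d → [0, +∞]`. -/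
def effDom (φ : ℝ → Eucl d → ℝ≥0∞) : Set (ℝ × Eucl d) := {x | φ x.1 x.2 ≠ ∞}

/-- Admissible action densities of order `p` (the class `A_p`). Properness is part of
`nondegenerate`. -/
structure IsActionDensity (p : ℝ) (φ : ℝ → Eucl d → ℝ≥0∞) : Prop where
  lowerSemicontinuous : LowerSemicontinuous (fun x : ℝ × Eucl d => φ x.1 x.2)
  convex : ∀ (ρ₀ ρ₁ : ℝ) (w₀ w₁ : Eucl d) (s t : ℝ), 0 ≤ s → 0 ≤ t → s + t = 1 →
    φ (s * ρ₀ + t * ρ₁) (s • w₀ + t • w₁) ≤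
      ENNReal.ofReal s * φ ρ₀ w₀ + ENNReal.ofReal t * φ ρ₁ w₁
  homogeneous : ∀ ρ : ℝ, (∃ w, (ρ, w) ∈ effDom φ) → φ ρ 0 = 0 ∧
    ∀ (c : ℝ) (w : Eucl d), c ≠ 0 → φ ρ (c • w) = ENNReal.ofReal (|c| ^ p) * φ ρ w
  nondegenerate : ∃ ρ₀ : ℝ, (∀ w, (ρ₀, w) ∈ effDom φ) ∧ ∀ w, w ≠ 0 → 0 < φ ρ₀ w

/-- The class `A_p(a, b)`: action densities in `A_p` such that the interior of the effective domain
is `(a, b) × ℝ^d`. -/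
structure IsActionDensityOn (p a b : ℝ) (φ : ℝ → Eucl d → ℝ≥0∞) : Prop
    extends IsActionDensity p φ where
  interior_effDom : interior (effDom φ) = Set.Ioo a b ×ˢ (Set.univ : Set (Eucl d))

/-- The recession functional `φ^∞(y) = sup {φ(x + y) - φ(x) : x ∈ dom φ}`. For a nonnegative convex
`φ` this supremum is nonnegative, so that the truncated subtraction of `[0, +∞]` is harmless. -/
def recession (φ : ℝ → Eucl d → ℝ≥0∞) (r : ℝ) (v : Eucl d) : ℝ≥0∞ :=
  ⨆ x ∈ effDom φ, (φ (x.1 + r) (x.2 + v) - φ x.1 x.2)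

/-- The action functional `Φ(μ, ν | γ)`: with the Lebesgue decompositions `μ = ρ γ + μ^⊥`,
`ν = w γ + ν^⊥` and the dominating measure `σ` (the variation of `μ^⊥` plus that of `ν^⊥`) for the
singular parts, it is `∫ φ(ρ, w) dγ + ∫ φ^∞(dμ^⊥/dσ, dν^⊥/dσ) dσ`. -/
def action (φ : ℝ → Eucl d → ℝ≥0∞) (γ : Measure (Eucl d)) (μ : SignedRadon d)
    (ν : VectorRadon d) : ℝ≥0∞ :=
  let σ : Measure (Eucl d) := (μ.singular γ).tv + (VectorRadon.singular ν γ).tv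
  (∫⁻ x, φ (μ.density γ x) (VectorRadon.density ν γ x) ∂γ) +
    ∫⁻ x, recession φ ((μ.singular γ).density σ x)
      (VectorRadon.density (VectorRadon.singular ν γ) σ x) ∂σ

end ActionDensity

section ContinuityEquation

variable {d : ℕ}

/-- The class `CE(0, T)` of solutions `(μ_t, ν_t)` of the continuity equation `∂_t μ + div ν = 0` on
`ℝ^d × (0, T)`. Only the restriction of `t ↦ μ_t` to `[0, T]` and of `t ↦ ν_t` to `(0, T)`
matter. -/
structure IsCE (T : ℝ) (μ : ℝ → SignedRadon d) (ν : ℝ → VectorRadon d) : Prop where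
  /-- `t ↦ μ_t` is weakly* continuous on `[0, T]`. -/
  weakStar_continuous : ∀ f : Eucl d → ℝ, Continuous f → HasCompactSupport f →
    ContinuousOn (fun t => (μ t).integral f) (Set.Icc 0 T)
  /-- `(ν_t)` is a Borel family. -/
  borel : ∀ (i : Fin d) (B : Set (Eucl d)), MeasurableSet B → Bornology.IsBounded B →
    Measurable (fun t : Set.Ioo (0 : ℝ) T => (ν t i).eval B)
  finite_mu : ∀ R : ℝ, 0 < R → ∫⁻ t in Set.Ioo 0 T, (μ t).tv (Metric.ball 0 R) < ∞
  finite_nu : ∀ R : ℝ, 0 < R → ∫⁻ t in Set.Ioo 0 T, (VectorRadon.tv (ν t)) (Metric.ball 0 R) < ∞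
  /-- The continuity equation holds in the sense of distributions. -/
  continuity_eq : ∀ ζ : Eucl d × ℝ → ℝ, ContDiff ℝ 1 ζ → HasCompactSupport ζ →
    tsupport ζ ⊆ Set.univ ×ˢ Set.Ioo 0 T →
    (∫ t in Set.Ioo 0 T, (μ t).integral (fun x => deriv (fun s => ζ (x, s)) t)) +
      (∫ t in Set.Ioo 0 T, ∑ i, (ν t i).integral
        (fun x => fderiv ℝ (fun y => ζ (y, t)) x (EuclideanSpace.single i 1))) = 0

/-- The class `CE_{φ,γ}(0, T; μ₀ → μ₁)` of solutions of the continuity equation that connect `μ₀` to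
`μ₁` with finite energy. -/
def finiteEnergyCE (φ : ℝ → Eucl d → ℝ≥0∞) (γ : Measure (Eucl d)) (T : ℝ)
    (μ₀ μ₁ : SignedRadon d) : Set ((ℝ → SignedRadon d) × (ℝ → VectorRadon d)) :=
  {c | IsCE T c.1 c.2 ∧ c.1 0 = μ₀ ∧ c.1 T = μ₁ ∧
    ∫⁻ t in Set.Ioo 0 T, action φ γ (c.1 t) (c.2 t) < ∞}

/-- The modified Wasserstein distance `W_{φ,γ}(μ₀, μ₁) ∈ [0, +∞]` of order `p`. -/
def modifiedW (p : ℝ) (φ : ℝ → Eucl d → ℝ≥0∞) (γ : Measure (Eucl d))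
    (μ₀ μ₁ : SignedRadon d) : ℝ≥0∞ :=
  ⨅ c ∈ finiteEnergyCE φ γ 1 μ₀ μ₁,
    (∫⁻ t in Set.Ioo (0 : ℝ) 1, action φ γ (c.1 t) (c.2 t)) ^ (1 / p)

/-- The component `M[σ]` of the measures at finite distance from `σ`. -/
def finiteComponent (p : ℝ) (φ : ℝ → Eucl d → ℝ≥0∞) (γ : Measure (Eucl d))
    (σ : SignedRadon d) : Set (SignedRadon d) :=
  {μ | modifiedW p φ γ μ σ < ∞}

/-- The generalized `r`-th momentum of `γ`. -/
def genMomentum (r : ℝ) (γ : Measure (Eucl d)) : ℝ≥0∞ :=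
  γ (Metric.ball 0 1) + ∫⁻ x in (Metric.ball 0 1)ᶜ, ENNReal.ofReal (‖x‖ ^ r) ∂γ

/-- `C¹` cutoff functions: nonnegative, compactly supported, equal to `1` near the origin. -/
structure IsCutoff (ζ : Eucl d → ℝ) : Prop where
  contDiff : ContDiff ℝ 1 ζ
  nonneg : ∀ x, 0 ≤ ζ x
  hasCompactSupport : HasCompactSupport ζ
  eq_one : ∀ᶠ x in 𝓝 (0 : Eucl d), ζ x = 1

end ContinuityEquation

end

/-! ### Locally finite measures: comparison by test functions, differences -/

section MeasureAux

variable {d : ℕ}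

/-! Everything rests on two properties of `φ`. Coercivity (`exists_lower_bound`): `φ ρ w ≥ c ‖w‖ ^
p` for all `ρ`, because the midpoint of `(a, b)` is also the midpoint of `ρ` and `a + b - ρ`, and
`φ` vanishes at `(a + b - ρ, 0)`. Rigidity (`recession_eq_top`): the recession functional is
infinite off the origin, since `p > 1` and since `ρ` is confined to `[a, b]`. Hence finite action
excludes singular parts, forces `a γ ≤ μ ≤ b γ`, and bounds the `L^p(γ)` norm of the density of the
flux.

Hölder's inequality in space and in time then gives `|∫ f dμ₁ - ∫ f dμ₀| ≤ C (∑ i, ‖∂ᵢ f‖_{L^q(γ)})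
W(μ₀, μ₁)` for `C¹` compactly supported `f`, with `C` independent of `f`
(`exists_modifiedW_estimate`). Two consequences are immediate: distance zero implies equality, and a
sequence with summable consecutive distances has convergent integrals. As its terms lie between `a
γ` and `b γ`, the Riesz representation theorem yields a weak* limit that also lies there
(`Between.exists_limit`).

The other pillar is the concatenation of infinitely many curves (`modifiedW_le_of_chain`). If the
distance from `v k` to `v (k + 1)` is less than `A k` with `S = ∑ A k` finite, almost optimal curves
are run successively on time intervals of length `A k / S`. The total energy is at most `S ^ p`, and
the glued curve is closed up at time `1` by the weak* limit; the continuity equation survives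
because it is used in integrated form (`IsCEFlow`), which is additive over intervals and passes to
the limit. So the weak* limit is at distance at most `S` from `v 0`. Applied to tails of a fast
subsequence this is completeness; applied to `μ₀, μ₁, μ₂, μ₂, …` it is the triangle inequality. No
minimising curve, compactness of curves or lower semicontinuity of the action functional is needed.

For the mass, the estimate is applied to `f = ζ(x / R)`. Its gradient is `O(1 / ‖x‖)` uniformly in
`R` and vanishes for `‖x‖ < ε R`, so finiteness of the momentum of order `-q` sends its `L^q(γ)`
norm to zero by dominated convergence. -/

instance isLocallyFiniteMeasure_add (μ ν : Measure (Eucl d)) [IsLocallyFiniteMeasure μ]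
    [IsLocallyFiniteMeasure ν] : IsLocallyFiniteMeasure (μ + ν) := by
  refine ⟨fun x => ?_⟩
  obtain ⟨s, hs, hs'⟩ := μ.finiteAt_nhds x
  obtain ⟨t, ht, ht'⟩ := ν.finiteAt_nhds x
  refine ⟨s ∩ t, inter_mem hs ht, ?_⟩
  rw [Measure.add_apply]
  exact ENNReal.add_lt_top.2 ⟨(measure_mono Set.inter_subset_left).trans_lt hs',
    (measure_mono Set.inter_subset_right).trans_lt ht'⟩

instance isLocallyFiniteMeasure_ofReal_smul (c : ℝ) (μ : Measure (Eucl d))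
    [IsLocallyFiniteMeasure μ] : IsLocallyFiniteMeasure (ENNReal.ofReal c • μ) := by
  refine ⟨fun x => ?_⟩
  obtain ⟨s, hs, hs'⟩ := μ.finiteAt_nhds x
  refine ⟨s, hs, ?_⟩
  rw [Measure.smul_apply, smul_eq_mul]
  exact ENNReal.mul_lt_top ENNReal.ofReal_lt_top hs'

theorem measure_lt_top_of_isBounded (μ : Measure (Eucl d)) [IsLocallyFiniteMeasure μ]
    {B : Set (Eucl d)} (hB : Bornology.IsBounded B) : μ B < ∞ :=
  (measure_mono subset_closure).trans_lt (hB.isCompact_closure.measure_lt_top)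

/-- On a compact set `K`, a Urysohn function that is `1` on `K` and supported in a slightly larger
open set compares the measures up to `ε`; inner regularity extends this to Borel sets. -/
theorem measure_le_of_integral_le {μ ν : Measure (Eucl d)} [IsLocallyFiniteMeasure μ]
    [IsLocallyFiniteMeasure ν]
    (h : ∀ f : Eucl d → ℝ, Continuous f → HasCompactSupport f → (∀ x, 0 ≤ f x) →
      ∫ x, f x ∂μ ≤ ∫ x, f x ∂ν) : μ ≤ ν := by
  have hK : ∀ K : Set (Eucl d), IsCompact K → μ K ≤ ν K := by
    intro K hK
    refine ENNReal.le_of_forall_pos_le_add fun ε hε _ => ?_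
    obtain ⟨V, hKV, hV, hVK⟩ : ∃ V ⊇ K, IsOpen V ∧ ν V ≤ ν K + ε :=
      K.exists_isOpen_le_add ν (ne_of_gt (ENNReal.coe_lt_coe.mpr hε))
    obtain ⟨f, hf1, hf2, hf3, hf4⟩ : ∃ f : C(Eucl d, ℝ), Set.EqOn f 1 K ∧ HasCompactSupport f ∧
        tsupport f ⊆ V ∧ ∀ x, f x ∈ Set.Icc (0 : ℝ) 1 := by
      obtain ⟨f, hf1, hf2, hf3⟩ := exists_continuousMap_one_of_isCompact_subset_isOpen hK hV hKV
      exact ⟨f, hf1, hasCompactSupport_def.mpr hf2, hf3⟩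
    have hle := h f f.continuous hf2 (fun x => (hf4 x).1)
    have hi : Integrable f μ := f.continuous.integrable_of_hasCompactSupport hf2
    have hi' : Integrable f ν := f.continuous.integrable_of_hasCompactSupport hf2
    have h1 : μ K ≤ ∫⁻ x, ENNReal.ofReal (f x) ∂μ := by
      rw [← lintegral_indicator_one hK.measurableSet]
      refine lintegral_mono fun x => ?_
      by_cases hx : x ∈ K
      · simp [hx, hf1 hx]
      · simp [hx]
    have h2 : ∫⁻ x, ENNReal.ofReal (f x) ∂ν ≤ ν V := by
      rw [← lintegral_indicator_one hV.measurableSet]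
      refine lintegral_mono fun x => ?_
      by_cases hx : x ∈ tsupport f
      · simpa [hf3 hx] using (hf4 x).2
      · simp [image_eq_zero_of_notMem_tsupport hx]
    refine (h1.trans ?_).trans (h2.trans hVK)
    rw [← ofReal_integral_eq_lintegral_ofReal hi (ae_of_all _ fun x => (hf4 x).1),
      ← ofReal_integral_eq_lintegral_ofReal hi' (ae_of_all _ fun x => (hf4 x).1)]
    exact ENNReal.ofReal_le_ofReal hle
  refine Measure.le_iff.2 fun s hs => ?_
  rw [hs.measure_eq_iSup_isCompact]
  exact iSup₂_le fun K hKs => iSup_le fun hc => (hK K hc).trans (measure_mono hKs)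

/-- The difference of two locally finite measures is a signed Radon measure. -/
theorem exists_signedRadon_sub (α β : Measure (Eucl d)) [IsLocallyFiniteMeasure α]
    [IsLocallyFiniteMeasure β] : ∃ v : SignedRadon d, v.pos + β = v.neg + α := by
  -- Both measures have densities with respect to `α + β`. The truncated differences of these
  -- densities live on disjoint sets and give the Jordan parts, with no subtraction of infinite
  -- masses.
  set m := α + β
  set f := α.rnDeriv m
  set g := β.rnDeriv m
  have hf : Measurable f := Measure.measurable_rnDeriv _ _
  have hg : Measurable g := Measure.measurable_rnDeriv _ _
  have hα : m.withDensity f = α := Measure.withDensity_rnDeriv_eq _ _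
    (Measure.absolutelyContinuous_of_le (Measure.le_add_right le_rfl))
  have hβ : m.withDensity g = β := Measure.withDensity_rnDeriv_eq _ _
    (Measure.absolutelyContinuous_of_le (Measure.le_add_left le_rfl))
  have h1 : m.withDensity (f - g) ≤ α := by
    conv_rhs => rw [← hα]
    exact withDensity_mono (ae_of_all _ fun x => tsub_le_self)
  have h2 : m.withDensity (g - f) ≤ β := by
    conv_rhs => rw [← hβ]
    exact withDensity_mono (ae_of_all _ fun x => tsub_le_self)
  refine ⟨⟨m.withDensity (f - g), m.withDensity (g - f), ?_, ?_, ?_⟩, ?_⟩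
  · exact Measure.isLocallyFiniteMeasure_of_le h1
  · exact Measure.isLocallyFiniteMeasure_of_le h2
  · refine ⟨{x | f x ≤ g x}, measurableSet_le hf hg, ?_, ?_⟩
    · rw [withDensity_apply _ (measurableSet_le hf hg)]
      refine (setLIntegral_congr_fun (measurableSet_le hf hg) (g := 0) fun x hx => ?_).trans (by simp)
      exact tsub_eq_zero_of_le hx
    · rw [withDensity_apply _ (measurableSet_le hf hg).compl]
      refine (setLIntegral_congr_fun (measurableSet_le hf hg).compl (g := 0)
        fun x hx => ?_).trans (by simp)
      have : g x < f x := by simpa using hx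
      exact tsub_eq_zero_of_le this.le
  · change m.withDensity (f - g) + β = m.withDensity (g - f) + α
    conv_lhs => rw [← hβ]
    conv_rhs => rw [← hα]
    rw [← withDensity_add_left (hf.sub hg), ← withDensity_add_left (hg.sub hf)]
    congr 1
    funext x
    change f x - g x + g x = g x - f x + f x
    rcases le_total (f x) (g x) with h | h
    · rw [tsub_eq_zero_of_le h, zero_add, tsub_add_cancel_of_le h]
    · rw [tsub_eq_zero_of_le h, zero_add, tsub_add_cancel_of_le h]

end MeasureAux

/-! ### Signed Radon measures: Jordan decomposition, integrals, scalar multiples -/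

namespace SignedRadon

variable {d : ℕ}

instance instIsLocallyFiniteMeasurePos (μ : SignedRadon d) : IsLocallyFiniteMeasure μ.pos :=
  μ.pos_locallyFinite

instance instIsLocallyFiniteMeasureNeg (μ : SignedRadon d) : IsLocallyFiniteMeasure μ.neg :=
  μ.neg_locallyFinite

instance instIsLocallyFiniteMeasureTv (μ : SignedRadon d) : IsLocallyFiniteMeasure μ.tv :=
  isLocallyFiniteMeasure_add _ _

theorem pos_le_tv (μ : SignedRadon d) : μ.pos ≤ μ.tv := Measure.le_add_right le_rfl

theorem neg_le_tv (μ : SignedRadon d) : μ.neg ≤ μ.tv := Measure.le_add_left le_rfl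

/-- A set carrying the negative part and negligible for the positive part. -/
theorem exists_hahn (μ : SignedRadon d) : ∃ S, MeasurableSet S ∧ μ.pos S = 0 ∧ μ.neg Sᶜ = 0 :=
  μ.mutuallySingular

theorem measure_eq_inter {m : Measure (Eucl d)} {S : Set (Eucl d)} (hS : m Sᶜ = 0)
    (A : Set (Eucl d)) : m A = m (A ∩ S) := by
  refine le_antisymm ?_ (measure_mono Set.inter_subset_left)
  calc m A ≤ m (A ∩ S ∪ Sᶜ) := measure_mono fun x hx => by
        by_cases h : x ∈ S
        · exact Or.inl ⟨hx, h⟩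
        · exact Or.inr h
    _ ≤ m (A ∩ S) + m Sᶜ := measure_union_le _ _
    _ = m (A ∩ S) := by rw [hS, add_zero]

/-- Uniqueness of the Jordan decomposition. -/
theorem eq_of_add_eq_add {μ ν : SignedRadon d} (h : μ.pos + ν.neg = ν.pos + μ.neg) : μ = ν := by
  obtain ⟨S, hS, hS1, hS2⟩ := μ.exists_hahn
  obtain ⟨T, hT, hT1, hT2⟩ := ν.exists_hahn
  have hz : ∀ {m : Measure (Eucl d)} {A B : Set (Eucl d)}, m B = 0 → A ⊆ B → m A = 0 :=
    fun h h' => measure_mono_null h' h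
  have key : ∀ A, μ.pos A + ν.neg A = ν.pos A + μ.neg A := fun A => by
    rw [← Measure.add_apply, h, Measure.add_apply]
  -- On the two mixed pieces one side of the identity vanishes, hence so do both terms of the other.
  -- On the pieces `Sᶜ ∩ Tᶜ` and `S ∩ T` the identity reduces to equality of the positive,
  -- respectively negative, parts.
  have hA : ∀ A, μ.pos (A ∩ Sᶜ ∩ T) = 0 ∧ ν.neg (A ∩ Sᶜ ∩ T) = 0 := fun A => by
    have := key (A ∩ Sᶜ ∩ T)
    rw [hz hT1 (fun x hx => hx.2), hz hS2 (fun x hx => hx.1.2), add_zero] at this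
    exact add_eq_zero.1 this
  have hB : ∀ A, ν.pos (A ∩ S ∩ Tᶜ) = 0 ∧ μ.neg (A ∩ S ∩ Tᶜ) = 0 := fun A => by
    have := key (A ∩ S ∩ Tᶜ)
    rw [hz hS1 (fun x hx => hx.1.2), hz hT2 (fun x hx => hx.2), add_zero] at this
    exact add_eq_zero.1 this.symm
  have hsplit : ∀ (m : Measure (Eucl d)) (A : Set (Eucl d)),
      m A = m (A ∩ S ∩ T) + m (A ∩ S ∩ Tᶜ) + (m (A ∩ Sᶜ ∩ T) + m (A ∩ Sᶜ ∩ Tᶜ)) := by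
    intro m A
    have h1 := measure_inter_add_sdiff (μ := m) A hS
    have h2 := measure_inter_add_sdiff (μ := m) (A ∩ S) hT
    have h3 := measure_inter_add_sdiff (μ := m) (A ∩ Sᶜ) hT
    rw [Set.sdiff_eq] at h1 h2 h3
    rw [h2, h3, h1]
  ext A hA'
  · rw [hsplit μ.pos, hsplit ν.pos, (hA A).1, (hB A).1, hz hS1 (fun x hx => hx.1.2),
      hz hS1 (fun x hx => hx.1.2), hz hT1 (fun x hx => hx.2), hz hT1 (fun x hx => hx.2)]
    have := key (A ∩ Sᶜ ∩ Tᶜ)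
    rw [hz hS2 (fun x hx => hx.1.2), hz hT2 (fun x hx => hx.2), add_zero, add_zero] at this
    rw [this]
  · rw [hsplit μ.neg, hsplit ν.neg, (hA A).2, (hB A).2,
      hz (A := A ∩ Sᶜ ∩ T) hS2 (fun x hx => hx.1.2),
      hz (A := A ∩ Sᶜ ∩ Tᶜ) hS2 (fun x hx => hx.1.2),
      hz (A := A ∩ S ∩ Tᶜ) hT2 (fun x hx => hx.2), hz (A := A ∩ Sᶜ ∩ Tᶜ) hT2 (fun x hx => hx.2)]
    have := key (A ∩ S ∩ T)
    rw [hz hS1 (fun x hx => hx.1.2), hz hT1 (fun x hx => hx.2), zero_add, zero_add] at this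
    rw [this]

theorem enorm_integral_le (μ : SignedRadon d) (f : Eucl d → ℝ) :
    ‖μ.integral f‖ₑ ≤ ∫⁻ x, ‖f x‖ₑ ∂μ.tv := by
  rw [tv, lintegral_add_measure]
  refine (enorm_sub_le).trans ?_
  exact add_le_add (enorm_integral_le_lintegral_enorm _) (enorm_integral_le_lintegral_enorm _)

theorem integral_sub {f g : Eucl d → ℝ} (μ : SignedRadon d) (hf : Continuous f)
    (hf' : HasCompactSupport f) (hg : Continuous g) (hg' : HasCompactSupport g) :
    μ.integral (fun x => f x - g x) = μ.integral f - μ.integral g := by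
  have := MeasureTheory.integral_sub (μ := μ.pos) (hf.integrable_of_hasCompactSupport hf')
    (hg.integrable_of_hasCompactSupport hg')
  have := MeasureTheory.integral_sub (μ := μ.neg) (hf.integrable_of_hasCompactSupport hf')
    (hg.integrable_of_hasCompactSupport hg')
  simp only [integral, *]
  ring

theorem integral_add {f g : Eucl d → ℝ} (μ : SignedRadon d) (hf : Continuous f)
    (hf' : HasCompactSupport f) (hg : Continuous g) (hg' : HasCompactSupport g) :
    μ.integral (fun x => f x + g x) = μ.integral f + μ.integral g := by
  have := MeasureTheory.integral_add (μ := μ.pos) (hf.integrable_of_hasCompactSupport hf')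
    (hg.integrable_of_hasCompactSupport hg')
  have := MeasureTheory.integral_add (μ := μ.neg) (hf.integrable_of_hasCompactSupport hf')
    (hg.integrable_of_hasCompactSupport hg')
  simp only [integral, *]
  ring

theorem integral_const_mul (μ : SignedRadon d) (c : ℝ) (f : Eucl d → ℝ) :
    μ.integral (fun x => c * f x) = c * μ.integral f := by
  simp only [integral, MeasureTheory.integral_const_mul]
  ring

@[simp]
theorem integral_zero_fun (μ : SignedRadon d) : μ.integral (fun _ => 0) = 0 := by
  simp [integral]

theorem hasCompactSupport_of_norm {f : Eucl d → ℝ} {R : ℝ} (h : ∀ x, R ≤ ‖x‖ → f x = 0) :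
    HasCompactSupport f := by
  refine HasCompactSupport.intro (isCompact_closedBall (0 : Eucl d) R) fun x hx => h x ?_
  simpa using (not_le.1 (by simpa using hx)).le

theorem exists_radius {f : Eucl d → ℝ} (h : HasCompactSupport f) :
    ∃ R, 0 < R ∧ ∀ x, R ≤ ‖x‖ → f x = 0 := by
  obtain ⟨R, hR, hR'⟩ := h.isCompact.isBounded.subset_ball_lt 0 0
  refine ⟨R, hR, fun x hx => image_eq_zero_of_notMem_tsupport fun hx' => ?_⟩
  have := hR' hx'
  simp at this
  linarith

theorem abs_integral_le (μ : SignedRadon d) {f : Eucl d → ℝ} {R ε : ℝ}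
    (h : ∀ x, R ≤ ‖x‖ → f x = 0) (hε : ∀ x, |f x| ≤ ε) :
    |μ.integral f| ≤ ε * (μ.tv (Metric.ball 0 R)).toReal := by
  have hfin : μ.tv (Metric.ball 0 R) < ∞ := measure_lt_top_of_isBounded _ Metric.isBounded_ball
  have hε0 : 0 ≤ ε := (abs_nonneg _).trans (hε 0)
  have : ‖μ.integral f‖ₑ ≤ ENNReal.ofReal ε * μ.tv (Metric.ball 0 R) := by
    refine (μ.enorm_integral_le f).trans ?_
    rw [← lintegral_indicator_const Metric.isOpen_ball.measurableSet]
    refine lintegral_mono fun x => ?_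
    by_cases hx : x ∈ Metric.ball (0 : Eucl d) R
    · rw [Set.indicator_of_mem hx, ← ofReal_norm]
      exact ENNReal.ofReal_le_ofReal (hε x)
    · rw [h x (by simpa using hx)]; simp
  rw [← ofReal_norm, Real.norm_eq_abs] at this
  have h2 := ENNReal.toReal_mono (ENNReal.mul_ne_top ENNReal.ofReal_ne_top hfin.ne) this
  rwa [ENNReal.toReal_ofReal (abs_nonneg _), ENNReal.toReal_mul, ENNReal.toReal_ofReal hε0] at h2

theorem eq_of_integral_eq {μ ν : SignedRadon d}
    (h : ∀ f : Eucl d → ℝ, Continuous f → HasCompactSupport f → μ.integral f = ν.integral f) :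
    μ = ν := by
  refine eq_of_add_eq_add ?_
  have key : ∀ f : Eucl d → ℝ, Continuous f → HasCompactSupport f →
      ∫ x, f x ∂(μ.pos + ν.neg) = ∫ x, f x ∂(ν.pos + μ.neg) := fun f hf hf' => by
    have := h f hf hf'
    rw [integral_add_measure (hf.integrable_of_hasCompactSupport hf')
      (hf.integrable_of_hasCompactSupport hf'),
      integral_add_measure (hf.integrable_of_hasCompactSupport hf')
      (hf.integrable_of_hasCompactSupport hf')]
    simp only [integral] at this
    linarith
  exact le_antisymm (measure_le_of_integral_le fun f hf hf' _ => (key f hf hf').le)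
    (measure_le_of_integral_le fun f hf hf' _ => (key f hf hf').ge)

/-- Approximation of a compactly supported continuous function by a `C¹` one. -/
theorem exists_contDiff_near {f : Eucl d → ℝ} (hf : Continuous f) {R : ℝ}
    (hR : ∀ x, R ≤ ‖x‖ → f x = 0) {ε : ℝ} (hε : 0 < ε) :
    ∃ g : Eucl d → ℝ, ContDiff ℝ 1 g ∧ (∀ x, R ≤ ‖x‖ → g x = 0) ∧ ∀ x, |g x - f x| ≤ ε := by
  obtain ⟨g, hg, hgf, hs⟩ := hf.exists_contDiff_approx 1 (ε := fun _ => ε) continuous_const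
    (fun _ => hε)
  refine ⟨g, by exact_mod_cast hg, fun x hx => ?_, fun x => (hgf x).le⟩
  by_contra hne
  exact hs hne (hR x hx)

theorem eq_of_integral_eq_contDiff {μ ν : SignedRadon d}
    (h : ∀ f : Eucl d → ℝ, ContDiff ℝ 1 f → HasCompactSupport f → μ.integral f = ν.integral f) :
    μ = ν := by
  refine eq_of_integral_eq fun f hf hf' => ?_
  obtain ⟨R, hR, hfR⟩ := exists_radius hf'
  set M := (μ.tv (Metric.ball 0 R)).toReal + (ν.tv (Metric.ball 0 R)).toReal with hM
  have hM0 : 0 ≤ M := by positivity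
  refine eq_of_forall_dist_le fun ε hε => ?_
  obtain ⟨g, hg, hgR, hgf⟩ := exists_contDiff_near hf hfR (ε := ε / (M + 1)) (by positivity)
  have hgs := hasCompactSupport_of_norm hgR
  have hs : ∀ x, R ≤ ‖x‖ → g x - f x = 0 := fun x hx => by rw [hgR x hx, hfR x hx, sub_zero]
  have h1 := μ.abs_integral_le hs hgf
  have h2 := ν.abs_integral_le hs hgf
  rw [integral_sub _ hg.continuous hgs hf hf'] at h1 h2
  rw [h g hg hgs] at h1
  rw [Real.dist_eq]
  have h3 : ε / (M + 1) * M ≤ ε := by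
    rw [div_mul_eq_mul_div, div_le_iff₀ (by positivity)]
    nlinarith
  rw [hM, mul_add] at h3
  rw [abs_le] at h1 h2 ⊢
  constructor <;> linarith [h1.1, h1.2, h2.1, h2.2]

/-- Scalar multiples of signed Radon measures. -/
noncomputable def scale (c : ℝ) (μ : SignedRadon d) : SignedRadon d where
  -- At most one of the two coefficients is nonzero: the parts are exchanged when `c < 0`, and
  -- mutual singularity persists.
  pos := ENNReal.ofReal c • μ.pos + ENNReal.ofReal (-c) • μ.neg
  neg := ENNReal.ofReal c • μ.neg + ENNReal.ofReal (-c) • μ.pos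
  pos_locallyFinite := inferInstance
  neg_locallyFinite := inferInstance
  mutuallySingular := by
    rcases le_total 0 c with h | h
    · rw [ENNReal.ofReal_of_nonpos (by linarith : -c ≤ 0)]
      simpa using (μ.mutuallySingular.smul _).symm.smul _ |>.symm
    · rw [ENNReal.ofReal_of_nonpos h]
      simpa using (μ.mutuallySingular.symm.smul _).symm.smul _ |>.symm

theorem eval_scale (c : ℝ) (μ : SignedRadon d) {B : Set (Eucl d)} (hB : Bornology.IsBounded B) :
    (μ.scale c).eval B = c * μ.eval B := by
  have h1 := (measure_lt_top_of_isBounded μ.pos hB).ne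
  have h2 := (measure_lt_top_of_isBounded μ.neg hB).ne
  rcases le_total 0 c with h | h
  · simp only [eval, scale, ENNReal.ofReal_of_nonpos (by linarith : -c ≤ 0), zero_smul, add_zero,
      Measure.smul_apply, smul_eq_mul, ENNReal.toReal_mul, ENNReal.toReal_ofReal h]
    ring
  · simp only [eval, scale, ENNReal.ofReal_of_nonpos h, zero_smul, zero_add,
      Measure.smul_apply, smul_eq_mul, ENNReal.toReal_mul,
      ENNReal.toReal_ofReal (by linarith : 0 ≤ -c)]
    ring

theorem integral_scale (c : ℝ) (μ : SignedRadon d) (f : Eucl d → ℝ) :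
    (μ.scale c).integral f = c * μ.integral f := by
  rcases le_total 0 c with h | h
  · simp only [integral, scale, ENNReal.ofReal_of_nonpos (by linarith : -c ≤ 0), zero_smul,
      add_zero, integral_smul_measure, ENNReal.toReal_ofReal h, smul_eq_mul]
    ring
  · simp only [integral, scale, ENNReal.ofReal_of_nonpos h, zero_smul, zero_add,
      integral_smul_measure, ENNReal.toReal_ofReal (by linarith : 0 ≤ -c), smul_eq_mul]
    ring

theorem density_scale (c : ℝ) (μ : SignedRadon d) (γ : Measure (Eucl d)) [SigmaFinite γ] :
    (μ.scale c).density γ =ᵐ[γ] fun x => c * μ.density γ x := by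
  rcases le_total 0 c with h | h
  · simp only [density, scale, ENNReal.ofReal_of_nonpos (by linarith : -c ≤ 0), zero_smul, add_zero]
    filter_upwards [Measure.rnDeriv_smul_left_of_ne_top' μ.pos γ (r := .ofReal c) (by simp),
      Measure.rnDeriv_smul_left_of_ne_top' μ.neg γ (r := .ofReal c) (by simp)] with x h1 h2
    change ((ENNReal.ofReal c • μ.pos).rnDeriv γ x).toReal -
      ((ENNReal.ofReal c • μ.neg).rnDeriv γ x).toReal = _
    rw [h1, h2]
    simp [ENNReal.toReal_mul, ENNReal.toReal_ofReal h]
    ring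
  · simp only [density, scale, ENNReal.ofReal_of_nonpos h, zero_smul, zero_add]
    filter_upwards [Measure.rnDeriv_smul_left_of_ne_top' μ.pos γ (r := .ofReal (-c)) (by simp),
      Measure.rnDeriv_smul_left_of_ne_top' μ.neg γ (r := .ofReal (-c)) (by simp)] with x h1 h2
    change ((ENNReal.ofReal (-c) • μ.neg).rnDeriv γ x).toReal -
      ((ENNReal.ofReal (-c) • μ.pos).rnDeriv γ x).toReal = _
    rw [h1, h2]
    simp [ENNReal.toReal_mul, ENNReal.toReal_ofReal (by linarith : 0 ≤ -c)]
    ring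

theorem scale_tv_ac (c : ℝ) {μ : SignedRadon d} {γ : Measure (Eucl d)} (h : μ.tv ≪ γ) :
    (μ.scale c).tv ≪ γ := by
  refine Measure.AbsolutelyContinuous.mk fun s hs hγ => ?_
  have := h hγ
  simp only [tv, Measure.add_apply, add_eq_zero] at this
  simp [tv, scale, this.1, this.2]

end SignedRadon

/-! ### Measures between `a γ` and `b γ`: weak* completeness; measurability in time -/

namespace SignedRadon

variable {d : ℕ} {a b : ℝ} {γ : Measure (Eucl d)}

/-- The condition `a γ ≤ μ ≤ b γ`, stated with nonnegative measures. -/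
def Between (a b : ℝ) (γ : Measure (Eucl d)) (μ : SignedRadon d) : Prop :=
  -- Each constant is split into positive and negative parts, and negative terms are moved across
  -- the inequality.
  μ.neg + ENNReal.ofReal a • γ ≤ μ.pos + ENNReal.ofReal (-a) • γ ∧
    μ.pos + ENNReal.ofReal (-b) • γ ≤ μ.neg + ENNReal.ofReal b • γ

theorem toReal_ofReal_sub (c : ℝ) :
    (ENNReal.ofReal c).toReal - (ENNReal.ofReal (-c)).toReal = c := by
  rcases le_total 0 c with h | h
  · rw [ENNReal.ofReal_of_nonpos (by linarith : -c ≤ 0), ENNReal.toReal_ofReal h]; simp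
  · rw [ENNReal.ofReal_of_nonpos h, ENNReal.toReal_ofReal (by linarith)]; simp

theorem integral_add_smul (m : Measure (Eucl d)) [IsLocallyFiniteMeasure m]
    [IsLocallyFiniteMeasure γ] (c : ℝ) {f : Eucl d → ℝ} (hf : Continuous f)
    (hf' : HasCompactSupport f) :
    ∫ x, f x ∂(m + ENNReal.ofReal c • γ) =
      ∫ x, f x ∂m + (ENNReal.ofReal c).toReal * ∫ x, f x ∂γ := by
  rw [integral_add_measure (hf.integrable_of_hasCompactSupport hf')
      (hf.integrable_of_hasCompactSupport hf'), integral_smul_measure, smul_eq_mul]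

/-- The tested form is closed under weak* convergence, which is how the bounds pass to limits in
time and along sequences. -/
theorem between_iff [IsLocallyFiniteMeasure γ] {μ : SignedRadon d} : Between a b γ μ ↔
    ∀ f : Eucl d → ℝ, Continuous f → HasCompactSupport f → (∀ x, 0 ≤ f x) →
      a * ∫ x, f x ∂γ ≤ μ.integral f ∧ μ.integral f ≤ b * ∫ x, f x ∂γ := by
  have ha := toReal_ofReal_sub a
  have hb := toReal_ofReal_sub b
  constructor
  · rintro ⟨h1, h2⟩ f hf hf' h0
    have i1 := integral_mono_measure h1 (ae_of_all _ h0) (hf.integrable_of_hasCompactSupport hf')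
    have i2 := integral_mono_measure h2 (ae_of_all _ h0) (hf.integrable_of_hasCompactSupport hf')
    rw [integral_add_smul _ _ hf hf', integral_add_smul _ _ hf hf'] at i1 i2
    rw [integral]
    constructor
    · conv_lhs => rw [← ha]
      linarith
    · conv_rhs => rw [← hb]
      linarith
  · intro h
    constructor
    · refine measure_le_of_integral_le fun f hf hf' h0 => ?_
      rw [integral_add_smul _ _ hf hf', integral_add_smul _ _ hf hf']
      have := (h f hf hf' h0).1
      rw [integral, ← ha] at this
      linarith
    · refine measure_le_of_integral_le fun f hf hf' h0 => ?_
      rw [integral_add_smul _ _ hf hf', integral_add_smul _ _ hf hf']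
      have := (h f hf hf' h0).2
      rw [integral, ← hb] at this
      linarith

/-- On a set that carries `μ.pos` and is negligible for `μ.neg`, only `μ.pos` is left in the upper
bound. -/
theorem Between.pos_le {μ : SignedRadon d} (h : Between a b γ μ) :
    μ.pos ≤ ENNReal.ofReal |b| • γ := by
  obtain ⟨S, hS, hS1, hS2⟩ := μ.exists_hahn
  refine Measure.le_iff.2 fun A _ => ?_
  rw [measure_eq_inter (m := μ.pos) (S := Sᶜ) (by simpa using hS1) A]
  have h2 := h.2 (A ∩ Sᶜ)
  have h0 : μ.neg (A ∩ Sᶜ) = 0 := measure_mono_null Set.inter_subset_right hS2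
  simp only [Measure.add_apply, h0, zero_add, Measure.smul_apply, smul_eq_mul] at h2 ⊢
  calc μ.pos (A ∩ Sᶜ) ≤ _ := le_self_add
    _ ≤ _ := h2
    _ ≤ _ := mul_le_mul' (ENNReal.ofReal_le_ofReal (le_abs_self b))
      (measure_mono Set.inter_subset_left)

theorem Between.neg_le {μ : SignedRadon d} (h : Between a b γ μ) :
    μ.neg ≤ ENNReal.ofReal |a| • γ := by
  obtain ⟨S, hS, hS1, hS2⟩ := μ.exists_hahn
  refine Measure.le_iff.2 fun A _ => ?_
  rw [measure_eq_inter hS2 A]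
  have h2 := h.1 (A ∩ S)
  have h0 : μ.pos (A ∩ S) = 0 := measure_mono_null Set.inter_subset_right hS1
  simp only [Measure.add_apply, h0, zero_add, Measure.smul_apply, smul_eq_mul] at h2 ⊢
  calc μ.neg (A ∩ S) ≤ _ := le_self_add
    _ ≤ _ := h2
    _ ≤ _ := mul_le_mul' (ENNReal.ofReal_le_ofReal (neg_le_abs a))
      (measure_mono Set.inter_subset_left)

theorem Between.tv_le {μ : SignedRadon d} (h : Between a b γ μ) :
    μ.tv ≤ ENNReal.ofReal (|a| + |b|) • γ := by
  rw [ENNReal.ofReal_add (abs_nonneg _) (abs_nonneg _), add_smul, add_comm]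
  exact add_le_add h.pos_le h.neg_le |>.trans (by rw [add_comm])

theorem Between.tv_ac {μ : SignedRadon d} (h : Between a b γ μ) : μ.tv ≪ γ :=
  (Measure.absolutelyContinuous_of_le h.tv_le).trans Measure.smul_absolutelyContinuous

theorem Between.abs_integral_le [IsLocallyFiniteMeasure γ] {μ : SignedRadon d}
    (h : Between a b γ μ) {f : Eucl d → ℝ} {R ε : ℝ}
    (hR : ∀ x, R ≤ ‖x‖ → f x = 0) (hε : ∀ x, |f x| ≤ ε) :
    |μ.integral f| ≤ ε * ((|a| + |b|) * (γ (Metric.ball 0 R)).toReal) := by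
  have hε0 : 0 ≤ ε := (abs_nonneg _).trans (hε 0)
  refine (μ.abs_integral_le hR hε).trans (mul_le_mul_of_nonneg_left ?_ hε0)
  have h1 := h.tv_le (Metric.ball 0 R)
  rw [Measure.smul_apply, smul_eq_mul] at h1
  have hfin : γ (Metric.ball 0 R) < ∞ := measure_lt_top_of_isBounded _ Metric.isBounded_ball
  have h2 := ENNReal.toReal_mono (ENNReal.mul_ne_top ENNReal.ofReal_ne_top hfin.ne) h1
  rwa [ENNReal.toReal_mul, ENNReal.toReal_ofReal (by positivity)] at h2

theorem pos_ac_of_tv_ac {μ : SignedRadon d} (h : μ.tv ≪ γ) : μ.pos ≪ γ :=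
  (Measure.absolutelyContinuous_of_le μ.pos_le_tv).trans h

theorem neg_ac_of_tv_ac {μ : SignedRadon d} (h : μ.tv ≪ γ) : μ.neg ≪ γ :=
  (Measure.absolutelyContinuous_of_le μ.neg_le_tv).trans h

theorem withDensity_add_const (μ : Measure (Eucl d)) [IsLocallyFiniteMeasure μ]
    [IsLocallyFiniteMeasure γ] (h : μ ≪ γ) (c : ℝ≥0∞) :
    μ + c • γ = γ.withDensity (fun x => μ.rnDeriv γ x + c) := by
  have := withDensity_add_left (μ := γ) (Measure.measurable_rnDeriv μ γ) (fun _ => c)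
  rw [withDensity_const, Measure.withDensity_rnDeriv_eq _ _ h] at this
  exact this.symm

theorem ae_le_of_withDensity_le [SigmaFinite γ] {f g : Eucl d → ℝ≥0∞} (hf : Measurable f)
    (h : γ.withDensity f ≤ γ.withDensity g) : f ≤ᵐ[γ] g := by
  refine ae_le_of_forall_setLIntegral_le_of_sigmaFinite hf fun s hs _ => ?_
  rw [← withDensity_apply _ hs, ← withDensity_apply _ hs]
  exact h s

theorem add_ofReal_le_add_ofReal_iff {u v : ℝ≥0∞} (hu : u ≠ ∞) (hv : v ≠ ∞) (c : ℝ) :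
    u + ENNReal.ofReal (-c) ≤ v + ENNReal.ofReal c ↔ u.toReal - v.toReal ≤ c := by
  have hc := toReal_ofReal_sub c
  rw [← ENNReal.toReal_le_toReal (by finiteness) (by finiteness), ENNReal.toReal_add hu (by simp),
    ENNReal.toReal_add hv (by simp)]
  constructor <;> intro h <;> linarith

/-- This pointwise form is the one that matches the integrand of the action: the effective domain of
`φ` lies over `[a, b]`. -/
theorem between_iff_density [IsLocallyFiniteMeasure γ] {μ : SignedRadon d} :
    Between a b γ μ ↔ μ.tv ≪ γ ∧ ∀ᵐ x ∂γ, a ≤ μ.density γ x ∧ μ.density γ x ≤ b := by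
  have key : ∀ {m n : Measure (Eucl d)} [IsLocallyFiniteMeasure m] [IsLocallyFiniteMeasure n],
      m ≪ γ → n ≪ γ → ∀ c : ℝ, (m + ENNReal.ofReal (-c) • γ ≤ n + ENNReal.ofReal c • γ ↔
      ∀ᵐ x ∂γ, (m.rnDeriv γ x).toReal - (n.rnDeriv γ x).toReal ≤ c) := by
    intro m n _ _ hm hn c
    rw [withDensity_add_const m hm, withDensity_add_const n hn]
    constructor
    · intro h
      filter_upwards [ae_le_of_withDensity_le ((Measure.measurable_rnDeriv _ _).add_const _) h,
        m.rnDeriv_ne_top γ, n.rnDeriv_ne_top γ] with x h1 h2 h3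
      exact (add_ofReal_le_add_ofReal_iff h2 h3 c).1 h1
    · intro h
      refine withDensity_mono ?_
      filter_upwards [h, m.rnDeriv_ne_top γ, n.rnDeriv_ne_top γ] with x h1 h2 h3
      exact (add_ofReal_le_add_ofReal_iff h2 h3 c).2 h1
  have main : μ.tv ≪ γ →
      (Between a b γ μ ↔ ∀ᵐ x ∂γ, a ≤ μ.density γ x ∧ μ.density γ x ≤ b) := by
    intro h
    -- The lower bound by `a` is the upper bound by `-a` with the two Jordan parts exchanged.
    have h1 := key (neg_ac_of_tv_ac h) (pos_ac_of_tv_ac h) (-a)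
    have h2 := key (pos_ac_of_tv_ac h) (neg_ac_of_tv_ac h) b
    rw [neg_neg] at h1
    rw [Between, h1, h2, ← eventually_and]
    refine eventually_congr (ae_of_all _ fun x => ?_)
    rw [density]
    constructor <;> rintro ⟨h3, h4⟩ <;> constructor <;> linarith
  exact ⟨fun h => ⟨h.tv_ac, (main h.tv_ac).1 h⟩, fun h => (main h.1).2 h.2⟩

theorem uniformly_near {g : Eucl d × ℝ → ℝ} (hg : Continuous g) {R : ℝ}
    (hR : ∀ x t, R ≤ ‖x‖ → g (x, t) = 0) (t : ℝ) {ε : ℝ} (hε : 0 < ε) :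
    ∀ᶠ s in 𝓝 t, ∀ x, |g (x, s) - g (x, t)| ≤ ε := by
  have h := (isCompact_closedBall (0 : Eucl d) R).eventually_forall_of_forall_eventually
    (x₀ := t) (P := fun s x => |g (x, s) - g (x, t)| ≤ ε) fun x _ => ?_
  · filter_upwards [h] with s hs x
    by_cases hx : x ∈ Metric.closedBall (0 : Eucl d) R
    · exact hs x hx
    · have : R ≤ ‖x‖ := (not_le.1 (by simpa using hx)).le
      rw [hR x s this, hR x t this]
      simpa using hε.le
  · have hc : Continuous fun z : ℝ × Eucl d => |g (z.2, z.1) - g (z.2, t)| := by fun_prop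
    have := hc.tendsto (t, x)
    simp only [sub_self, abs_zero] at this
    filter_upwards [this (Iio_mem_nhds hε)] with z hz
    exact le_of_lt hz

theorem continuous_integral_param {g : Eucl d × ℝ → ℝ} (hg : Continuous g) {R : ℝ}
    (hR : ∀ x t, R ≤ ‖x‖ → g (x, t) = 0) (μ : SignedRadon d) :
    Continuous fun t => μ.integral fun x => g (x, t) := by
  have hc : ∀ t, Continuous fun x => g (x, t) := fun t => by fun_prop
  have hs : ∀ t, HasCompactSupport fun x => g (x, t) := fun t =>
    hasCompactSupport_of_norm fun x => hR x t
  refine continuous_iff_continuousAt.2 fun t => Metric.tendsto_nhds.2 fun ε hε => ?_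
  set M := (μ.tv (Metric.ball 0 R)).toReal with hM
  have hM0 : 0 ≤ M := ENNReal.toReal_nonneg
  filter_upwards [uniformly_near hg hR t (ε := ε / (M + 1)) (by positivity)] with s h
  have h1 := μ.abs_integral_le (R := R) (fun x hx => by rw [hR x s hx, hR x t hx, sub_zero]) h
  rw [integral_sub _ (hc s) (hs s) (hc t) (hs t)] at h1
  rw [Real.dist_eq]
  refine h1.trans_lt ?_
  rw [← hM, div_mul_eq_mul_div, div_lt_iff₀ (by positivity)]
  nlinarith

/-- The Borel condition on a family concerns bounded sets. Integrals of simple functions over a ball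
containing the support are finite combinations of such values, and bounded simple approximations
converge by domination. -/
theorem measurable_integral_of_eval {κ : ℝ → SignedRadon d}
    (hκ : ∀ B, MeasurableSet B → Bornology.IsBounded B → Measurable fun t => (κ t).eval B)
    {f : Eucl d → ℝ} (hf : Continuous f) (hf' : HasCompactSupport f) :
    Measurable fun t => (κ t).integral f := by
  obtain ⟨R, -, hR⟩ := exists_radius hf'
  obtain ⟨c, hc⟩ := hf'.exists_bound_of_continuous hf
  have hc0 : 0 ≤ c := (norm_nonneg _).trans (hc 0)
  set B := Metric.ball (0 : Eucl d) R
  have hB : MeasurableSet B := Metric.isOpen_ball.measurableSet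
  have hBb : Bornology.IsBounded B := Metric.isBounded_ball
  have hsm := hf.stronglyMeasurable
  set F := hsm.approxBounded c
  have hset : ∀ (m : Measure (Eucl d)), ∫ x, f x ∂m = ∫ x in B, f x ∂m := fun m => by
    rw [setIntegral_eq_integral_of_forall_compl_eq_zero]
    intro x hx
    exact hR x (by simpa [B] using hx)
  have hlim : ∀ (m : Measure (Eucl d)) [IsLocallyFiniteMeasure m],
      Tendsto (fun n => ∫ x in B, F n x ∂m) atTop (𝓝 (∫ x, f x ∂m)) := by
    intro m _
    rw [hset]
    have : IsFiniteMeasure (m.restrict B) := ⟨by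
      simpa using measure_lt_top_of_isBounded m hBb⟩
    refine tendsto_integral_of_dominated_convergence (fun _ => c)
      (fun n => (F n).aestronglyMeasurable) (integrable_const _)
      (fun n => ae_of_all _ fun x => hsm.norm_approxBounded_le hc0 n x)
      (ae_of_all _ fun x => hsm.tendsto_approxBounded_of_norm_le (hc x))
  refine measurable_of_tendsto_metrizable
    (f := fun n t => (∫ x in B, F n x ∂(κ t).pos) - ∫ x in B, F n x ∂(κ t).neg) (fun n => ?_)
    (tendsto_pi_nhds.2 fun t => (hlim _).sub (hlim _))
  have hsum : ∀ (m : Measure (Eucl d)) [IsLocallyFiniteMeasure m], ∫ x in B, F n x ∂m =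
      ∑ y ∈ (F n).range, (m (F n ⁻¹' {y} ∩ B)).toReal * y := by
    intro m _
    have : IsFiniteMeasure (m.restrict B) := ⟨by
      simpa using measure_lt_top_of_isBounded m hBb⟩
    rw [SimpleFunc.integral_eq_sum _ ((F n).integrable_of_isFiniteMeasure)]
    refine Finset.sum_congr rfl fun y _ => ?_
    rw [measureReal_def, Measure.restrict_apply ((F n).measurableSet_fiber y), smul_eq_mul]
  have : (fun t => (∫ x in B, F n x ∂(κ t).pos) - ∫ x in B, F n x ∂(κ t).neg) =
      fun t => ∑ y ∈ (F n).range, (κ t).eval (F n ⁻¹' {y} ∩ B) * y := by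
    funext t
    rw [hsum, hsum, ← Finset.sum_sub_distrib]
    refine Finset.sum_congr rfl fun y _ => ?_
    rw [eval]
    ring
  change Measurable (fun t => (∫ x in B, F n x ∂(κ t).pos) - ∫ x in B, F n x ∂(κ t).neg)
  rw [this]
  refine Finset.measurable_sum _ fun y _ => (hκ _ ?_ ?_).mul_const _
  · exact ((F n).measurableSet_fiber y).inter hB
  · exact hBb.subset Set.inter_subset_right

/-- Here time enters through both the measure and the test function. Rounding the time in the test
function down to the grid of step `1 / (n + 1)` leaves countably many fixed test functions;
continuity in the parameter removes the rounding. -/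
theorem measurable_integral_param {κ : ℝ → SignedRadon d}
    (hκ : ∀ f : Eucl d → ℝ, Continuous f → HasCompactSupport f →
      Measurable fun t => (κ t).integral f)
    {g : Eucl d × ℝ → ℝ} (hg : Continuous g) {R : ℝ} (hR : ∀ x t, R ≤ ‖x‖ → g (x, t) = 0) :
    Measurable fun t => (κ t).integral fun x => g (x, t) := by
  have hlim : ∀ t : ℝ, Tendsto (fun n : ℕ => (⌊((n : ℝ) + 1) * t⌋ : ℝ) / ((n : ℝ) + 1)) atTop
      (𝓝 t) := by
    intro t
    have h1 : Tendsto (fun n : ℕ => ((n : ℝ) + 1)) atTop atTop :=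
      tendsto_natCast_atTop_atTop.atTop_add tendsto_const_nhds
    refine Metric.tendsto_atTop'.2 fun ε hε => ?_
    obtain ⟨N, hN⟩ := (h1.eventually_gt_atTop (ε⁻¹)).exists_forall_of_atTop
    refine ⟨N, fun n hn => ?_⟩
    have hpos : (0 : ℝ) < n + 1 := by positivity
    have h3 := hN n hn.le
    rw [Real.dist_eq, abs_lt]
    have h4 := Int.floor_le (((n : ℝ) + 1) * t)
    have h5 := Int.lt_floor_add_one (((n : ℝ) + 1) * t)
    have h6 : 1 < ε * (n + 1) := by
      rw [inv_lt_iff_one_lt_mul₀ hε] at h3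
      linarith
    constructor
    · rw [lt_sub_iff_add_lt, lt_div_iff₀ hpos]
      nlinarith
    · rw [sub_lt_iff_lt_add, div_lt_iff₀ hpos]
      nlinarith
  refine measurable_of_tendsto_metrizable
    (f := fun (n : ℕ) t =>
      (κ t).integral fun x => g (x, (⌊((n : ℝ) + 1) * t⌋ : ℝ) / ((n : ℝ) + 1))) (fun n => ?_)
    (tendsto_pi_nhds.2 fun t =>
      ((continuous_integral_param hg hR (κ t)).tendsto t).comp (hlim t))
  have hm : Measurable fun z : ℤ × ℝ =>
      (κ z.2).integral fun x => g (x, (z.1 : ℝ) / ((n : ℝ) + 1)) := by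
    refine measurable_from_prod_countable_right fun k => ?_
    exact hκ (fun x => g (x, (k : ℝ) / ((n : ℝ) + 1))) (by fun_prop)
      (hasCompactSupport_of_norm fun x hx => hR x _ hx)
  exact hm.comp ((Int.measurable_floor.comp (measurable_const.mul measurable_id)).prodMk
    measurable_id)

/-- The masses on a ball are bounded by that of `γ`, uniformly in `n`, so uniform approximation by
`C¹` functions transfers the Cauchy property. -/
theorem Between.cauchySeq_integral [IsLocallyFiniteMeasure γ] {v : ℕ → SignedRadon d}
    (hv : ∀ n, Between a b γ (v n))
    (h : ∀ f : Eucl d → ℝ, ContDiff ℝ 1 f → HasCompactSupport f →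
      CauchySeq fun n => (v n).integral f)
    {f : Eucl d → ℝ} (hf : Continuous f) (hf' : HasCompactSupport f) :
    CauchySeq fun n => (v n).integral f := by
  obtain ⟨R, -, hR⟩ := exists_radius hf'
  set M := (|a| + |b|) * (γ (Metric.ball 0 R)).toReal
  have hM0 : 0 ≤ M := by positivity
  refine Metric.cauchySeq_iff.2 fun ε hε => ?_
  obtain ⟨g, hg, hgR, hgf⟩ := exists_contDiff_near hf hR (ε := ε / 4 / (M + 1)) (by positivity)
  have hgs := hasCompactSupport_of_norm hgR
  obtain ⟨N, hN⟩ := Metric.cauchySeq_iff.1 (h g hg hgs) (ε / 2) (by positivity)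
  have hb : ∀ n, |(v n).integral g - (v n).integral f| ≤ ε / 4 := fun n => by
    have := (hv n).abs_integral_le (R := R)
      (fun x hx => by rw [hgR x hx, hR x hx, sub_zero]) hgf
    rw [integral_sub _ hg.continuous hgs hf hf'] at this
    refine this.trans ?_
    rw [div_mul_eq_mul_div, div_le_iff₀ (by positivity)]
    nlinarith
  refine ⟨N, fun m hm n hn => ?_⟩
  have h1 := hN m hm n hn
  have h2 := hb m
  have h3 := hb n
  rw [Real.dist_eq, abs_lt] at *
  rw [abs_le] at *
  constructor <;> linarith [h1.1, h1.2, h2.1, h2.2, h3.1, h3.2]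

/-- Weak* completeness of the set of measures between `a γ` and `b γ`. -/
theorem Between.exists_limit [IsLocallyFiniteMeasure γ] {v : ℕ → SignedRadon d}
    (hv : ∀ n, Between a b γ (v n))
    (h : ∀ f : Eucl d → ℝ, ContDiff ℝ 1 f → HasCompactSupport f →
      CauchySeq fun n => (v n).integral f) :
    ∃ μ : SignedRadon d, Between a b γ μ ∧ ∀ f : Eucl d → ℝ, Continuous f → HasCompactSupport f →
      Tendsto (fun n => (v n).integral f) atTop (𝓝 (μ.integral f)) := by
  have hlim : ∀ f : CompactlySupportedContinuousMap (Eucl d) ℝ,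
      ∃ l, Tendsto (fun n => (v n).integral f) atTop (𝓝 l) := fun f =>
    cauchySeq_tendsto_of_complete (cauchySeq_integral hv h f.continuous f.hasCompactSupport)
  choose L hL using hlim
  -- The limit functional `L` need not be positive, but `L - a γ` is, and the Riesz theorem for
  -- positive functionals applies to it.
  let Λ₀ : CompactlySupportedContinuousMap (Eucl d) ℝ →ₗ[ℝ] ℝ :=
    { toFun := fun f => L f - a * ∫ x, f x ∂γ
      map_add' := fun f g => by
        have h1 : L (f + g) = L f + L g := by
          refine tendsto_nhds_unique (hL (f + g)) (((hL f).add (hL g)).congr fun n => ?_)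
          exact ((v n).integral_add f.continuous f.hasCompactSupport g.continuous
            g.hasCompactSupport).symm
        have h2 : ∫ x, (f + g) x ∂γ = ∫ x, f x ∂γ + ∫ x, g x ∂γ :=
          MeasureTheory.integral_add
            (f.continuous.integrable_of_hasCompactSupport f.hasCompactSupport)
            (g.continuous.integrable_of_hasCompactSupport g.hasCompactSupport)
        rw [h1, h2]
        ring
      map_smul' := fun c f => by
        have h1 : L (c • f) = c * L f := by
          refine tendsto_nhds_unique (hL (c • f)) (((hL f).const_mul c).congr fun n => ?_)
          exact ((v n).integral_const_mul c f).symm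
        have h2 : ∫ x, (c • f) x ∂γ = c * ∫ x, f x ∂γ := MeasureTheory.integral_const_mul c f
        rw [h1, h2, RingHom.id_apply, smul_eq_mul]
        ring }
  let Λ := PositiveLinearMap.mk₀ Λ₀ fun f hf => by
    have := ge_of_tendsto' (hL f) fun n =>
      ((between_iff.1 (hv n)) f f.continuous f.hasCompactSupport hf).1
    exact sub_nonneg.2 this
  -- The measure `a γ` is added back, its negative part being subtracted.
  obtain ⟨μ, hμ⟩ := exists_signedRadon_sub (RealRMK.rieszMeasure Λ + ENNReal.ofReal a • γ)
    (ENNReal.ofReal (-a) • γ)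
  have key : ∀ f : Eucl d → ℝ, Continuous f → HasCompactSupport f →
      Tendsto (fun n => (v n).integral f) atTop (𝓝 (μ.integral f)) := by
    intro f hf hf'
    let F : CompactlySupportedContinuousMap (Eucl d) ℝ := ⟨⟨f, hf⟩, hf'⟩
    have h1 := RealRMK.integral_rieszMeasure Λ F
    have h2 : Λ F = L F - a * ∫ x, f x ∂γ := rfl
    have h3 : μ.integral f = L F := by
      have h4 := congrArg (fun m => ∫ x, f x ∂m) hμ
      simp only at h4
      rw [integral_add_smul _ _ hf hf', ← add_assoc, integral_add_smul _ _ hf hf',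
        integral_add_measure (hf.integrable_of_hasCompactSupport hf')
        (hf.integrable_of_hasCompactSupport hf')] at h4
      have h5 : ∫ x, f x ∂(RealRMK.rieszMeasure Λ) = L F - a * ∫ x, f x ∂γ := by
        rw [← h2, ← h1]; rfl
      have ha := toReal_ofReal_sub a
      rw [h5] at h4
      rw [integral]
      have h6 : a * ∫ x, f x ∂γ = (ENNReal.ofReal a).toReal * (∫ x, f x ∂γ) -
          (ENNReal.ofReal (-a)).toReal * ∫ x, f x ∂γ := by rw [← sub_mul, ha]
      linarith
    rw [h3]
    exact hL F
  refine ⟨μ, between_iff.2 fun f hf hf' h0 => ?_, key⟩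
  exact ⟨ge_of_tendsto' (key f hf hf') fun n => (between_iff.1 (hv n) f hf hf' h0).1,
    le_of_tendsto' (key f hf hf') fun n => (between_iff.1 (hv n) f hf hf' h0).2⟩

end SignedRadon

/-! ### Action densities: coercivity and the recession functional -/

section Density

variable {d : ℕ} {p a b : ℝ} {φ : ℝ → Eucl d → ℝ≥0∞}

namespace IsActionDensityOn

theorem convex_effDom (hφ : IsActionDensityOn p a b φ) : Convex ℝ (effDom φ) := by
  rintro ⟨ρ₀, w₀⟩ h₀ ⟨ρ₁, w₁⟩ h₁ s t hs ht hst
  have := hφ.convex ρ₀ ρ₁ w₀ w₁ s t hs ht hst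
  refine ne_top_of_le_ne_top ?_ this
  simp only [effDom, Set.mem_ofPred_eq] at h₀ h₁
  finiteness

theorem mem_effDom_of_mem_Ioo (hφ : IsActionDensityOn p a b φ) {ρ : ℝ} (hρ : ρ ∈ Set.Ioo a b)
    (w : Eucl d) : φ ρ w ≠ ∞ := by
  have : (ρ, w) ∈ interior (effDom φ) := by
    rw [hφ.interior_effDom]
    exact ⟨hρ, Set.mem_univ _⟩
  exact interior_subset this

theorem mem_Icc (hφ : IsActionDensityOn p a b φ) (hab : a < b) {ρ : ℝ} {w : Eucl d}
    (h : φ ρ w ≠ ∞) : ρ ∈ Set.Icc a b := by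
  have hne : (interior (effDom φ)).Nonempty := by
    rw [hφ.interior_effDom]
    exact (Set.nonempty_Ioo.2 hab).prod Set.univ_nonempty
  have h1 : (ρ, w) ∈ closure (interior (effDom φ)) := by
    rw [hφ.convex_effDom.closure_interior_eq_closure_of_nonempty_interior hne]
    exact subset_closure h
  rw [hφ.interior_effDom, closure_prod_eq, closure_Ioo hab.ne] at h1
  exact h1.1

theorem map_zero_of_ne_top (hφ : IsActionDensityOn p a b φ) {ρ : ℝ} {w : Eucl d}
    (h : φ ρ w ≠ ∞) : φ ρ 0 = 0 := (hφ.homogeneous ρ ⟨w, h⟩).1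

/-- By lower semicontinuity the zero set of `φ · w` is closed. -/
theorem eq_zero_of_frequently (hφ : IsActionDensityOn p a b φ) {ρ : ℝ} {w : Eucl d}
    (h : ∃ᶠ r in 𝓝 ρ, φ r w = 0) : φ ρ w = 0 := by
  by_contra hne
  have h1 := hφ.lowerSemicontinuous (ρ, w) 0 (pos_iff_ne_zero.2 hne)
  have h2 : Tendsto (fun r : ℝ => (r, w)) (𝓝 ρ) (𝓝 (ρ, w)) :=
    (Continuous.prodMk_left w).tendsto ρ
  obtain ⟨r, hr, hr'⟩ := (h.and_eventually (h2.eventually h1)).exists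
  simp only [hr, lt_self_iff_false] at hr'

/-- Homogeneity says nothing at an endpoint where `φ ρ` might be identically infinite; the zero
value is inherited from the interior. The endpoints matter, since a density may equal `a` or `b` on
a set of positive measure. -/
theorem map_zero (hφ : IsActionDensityOn p a b φ) (hab : a < b) {ρ : ℝ} (hρ : ρ ∈ Set.Icc a b) :
    φ ρ 0 = 0 := by
  refine hφ.eq_zero_of_frequently ?_
  rw [← closure_Ioo hab.ne, mem_closure_iff_frequently] at hρ
  exact hρ.mono fun r hr => hφ.map_zero_of_ne_top (hφ.mem_effDom_of_mem_Ioo hr 0)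

theorem map_smul (hφ : IsActionDensityOn p a b φ) (ρ : ℝ) (w : Eucl d) {c : ℝ} (hc : c ≠ 0) :
    φ ρ (c • w) = ENNReal.ofReal (|c| ^ p) * φ ρ w := by
  by_cases h : ∃ w, (ρ, w) ∈ effDom φ
  · exact (hφ.homogeneous ρ h).2 c w hc
  · have h' : ∀ w, φ ρ w = ∞ := fun w => by
      by_contra hne
      exact h ⟨w, hne⟩
    rw [h', h', ENNReal.mul_top]
    have : 0 < |c| ^ p := Real.rpow_pos_of_pos (abs_pos.2 hc) _
    simpa using this

theorem midpoint_mem (hab : a < b) : (a + b) / 2 ∈ Set.Ioo a b := ⟨by linarith, by linarith⟩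

/-- This moves nondegeneracy from the unspecified `ρ₀` to the midpoint. A zero at the midpoint would
spread, by homogeneity and convexity, along the segment towards `ρ₀`, and reach `ρ₀` by lower
semicontinuity. -/
theorem midpoint_pos (hφ : IsActionDensityOn p a b φ) {w : Eucl d} (hw : w ≠ 0) :
    0 < φ ((a + b) / 2) w := by
  obtain ⟨ρ₀, h₀, hpos⟩ := hφ.nondegenerate
  refine pos_iff_ne_zero.2 fun h => (hpos w hw).ne' (hφ.eq_zero_of_frequently ?_)
  set m := (a + b) / 2
  have hz : ∀ s ∈ Set.Ioo (0 : ℝ) 1, φ ((1 - s) * ρ₀ + s * m) w = 0 := by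
    intro s hs
    -- The vector `s⁻¹ • w` at the midpoint and `0` at `ρ₀` average to `w`; both endpoint values
    -- vanish.
    have h1 := hφ.convex ρ₀ m 0 (s⁻¹ • w) (1 - s) s (by linarith [hs.2]) hs.1.le (by ring)
    rw [smul_zero, zero_add, smul_smul, mul_inv_cancel₀ hs.1.ne', one_smul,
      hφ.map_zero_of_ne_top (h₀ 0), hφ.map_smul _ _ (inv_ne_zero hs.1.ne'), h] at h1
    simpa using h1
  have ht : Tendsto (fun s : ℝ => (1 - s) * ρ₀ + s * m) (𝓝[>] 0) (𝓝 ρ₀) := by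
    have : Continuous fun s : ℝ => (1 - s) * ρ₀ + s * m := by fun_prop
    have := (this.tendsto 0).mono_left (nhdsWithin_le_nhds (s := Set.Ioi 0))
    simpa using this
  refine ht.frequently (Eventually.frequently ?_)
  filter_upwards [Ioo_mem_nhdsGT (zero_lt_one' ℝ)] with s hs using hz s hs

/-- At the midpoint `m`, a positive minimum over the unit sphere and homogeneity give the bound. For
general `ρ`, averaging `(ρ, 2w)` with the reflected point `(a + b - ρ, 0)`, where `φ` vanishes,
gives `φ m w ≤ (1 / 2) * 2 ^ p * φ ρ w`. -/
theorem exists_lower_bound (hφ : IsActionDensityOn p a b φ) (hab : a < b) (hp : 1 < p) :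
    ∃ c : ℝ, 0 < c ∧ ∀ ρ w, ENNReal.ofReal (c * ‖w‖ ^ p) ≤ φ ρ w := by
  set m := (a + b) / 2 with hm
  have hmI := midpoint_mem hab
  obtain ⟨c₀, hc₀, hsph⟩ : ∃ c₀ : ℝ, 0 < c₀ ∧
      ∀ w ∈ Metric.sphere (0 : Eucl d) 1, ENNReal.ofReal c₀ ≤ φ m w := by
    -- The sphere is empty when `d = 0`.
    rcases (Metric.sphere (0 : Eucl d) 1).eq_empty_or_nonempty with he | hne
    · exact ⟨1, one_pos, by simp [he]⟩
    · have hlsc : LowerSemicontinuous (φ m) :=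
        hφ.lowerSemicontinuous.comp (Continuous.prodMk_right m)
      obtain ⟨w₀, hw₀, hmin⟩ := (hlsc.lowerSemicontinuousOn _).exists_isMinOn hne
        (isCompact_sphere (0 : Eucl d) 1)
      have hw0 : w₀ ≠ 0 := by
        rintro rfl
        simp at hw₀
      refine ⟨(φ m w₀).toReal, ENNReal.toReal_pos (hφ.midpoint_pos hw0).ne'
        (hφ.mem_effDom_of_mem_Ioo hmI _), fun w hw => ?_⟩
      rw [ENNReal.ofReal_toReal (hφ.mem_effDom_of_mem_Ioo hmI _)]
      exact hmin hw
  have hmid : ∀ w, ENNReal.ofReal (c₀ * ‖w‖ ^ p) ≤ φ m w := by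
    intro w
    by_cases hw : w = 0
    · rw [hw, norm_zero, Real.zero_rpow (by linarith), mul_zero]
      simp
    · have hw' : ‖w‖ ≠ 0 := norm_ne_zero_iff.2 hw
      have h1 := hφ.map_smul m (‖w‖⁻¹ • w) hw'
      rw [smul_smul, mul_inv_cancel₀ hw', one_smul, abs_norm] at h1
      rw [h1, mul_comm c₀, ENNReal.ofReal_mul (by positivity)]
      refine mul_le_mul' le_rfl (hsph _ ?_)
      simp [norm_smul, hw']
  have h2p : (0 : ℝ) < 2 ^ p := by positivity
  refine ⟨2 / 2 ^ p * c₀, by positivity, fun ρ w => ?_⟩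
  by_cases hdom : φ ρ w = ∞
  · simp [hdom]
  have hρ := hφ.mem_Icc hab hdom
  have h1 := hφ.convex ρ (a + b - ρ) ((2 : ℝ) • w) 0 (1 / 2) (1 / 2) (by norm_num) (by norm_num)
    (by norm_num)
  have h3 : φ (a + b - ρ) 0 = 0 :=
    hφ.map_zero hab ⟨by linarith [hρ.2], by linarith [hρ.1]⟩
  rw [smul_zero, add_zero, smul_smul, h3, mul_zero, add_zero, hφ.map_smul _ _ two_ne_zero,
    abs_two, ← mul_assoc, ← ENNReal.ofReal_mul (by norm_num),
    show (1 / 2 : ℝ) * ρ + 1 / 2 * (a + b - ρ) = m by rw [hm]; ring,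
    show (1 / 2 : ℝ) * 2 = 1 by norm_num, one_smul] at h1
  have h4 := (hmid w).trans h1
  calc ENNReal.ofReal (2 / 2 ^ p * c₀ * ‖w‖ ^ p)
      = ENNReal.ofReal (2 / 2 ^ p) * ENNReal.ofReal (c₀ * ‖w‖ ^ p) := by
        rw [← ENNReal.ofReal_mul (by positivity), mul_assoc]
    _ ≤ ENNReal.ofReal (2 / 2 ^ p) * (ENNReal.ofReal (1 / 2 * 2 ^ p) * φ ρ w) :=
        mul_le_mul' le_rfl h4
    _ = φ ρ w := by
        rw [← mul_assoc, ← ENNReal.ofReal_mul (by positivity),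
          show 2 / (2 : ℝ) ^ p * (1 / 2 * 2 ^ p) = 1 by field_simp, ENNReal.ofReal_one, one_mul]

theorem le_recession {ρ r : ℝ} {w v : Eucl d} (h : φ ρ w ≠ ∞) :
    φ (ρ + r) (w + v) - φ ρ w ≤ recession φ r v :=
  le_iSup₂_of_le (f := fun (x : ℝ × Eucl d) (_ : x ∈ effDom φ) =>
    φ (x.1 + r) (x.2 + v) - φ x.1 x.2) (ρ, w) h le_rfl

/-- For `r = 0`, growth of order `p > 1` makes the increments from `t v` to `(t + 1) v` unbounded.
For `r ≠ 0`, some `ρ` in `(a, b)` is translated out of `[a, b]`, where `φ` is infinite. -/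
theorem recession_eq_top (hφ : IsActionDensityOn p a b φ) (hab : a < b) (hp : 1 < p) {r : ℝ}
    {v : Eucl d} (h : ¬ (r = 0 ∧ v = 0)) : recession φ r v = ∞ := by
  by_cases hr : r = 0
  · have hv : v ≠ 0 := fun hv => h ⟨hr, hv⟩
    subst hr
    set m := (a + b) / 2 with hm
    have hmI := midpoint_mem hab
    set K := (φ m v).toReal
    have hfin : φ m v ≠ ∞ := hφ.mem_effDom_of_mem_Ioo hmI v
    have hK : 0 < K := ENNReal.toReal_pos (hφ.midpoint_pos hv).ne' hfin
    refine ENNReal.eq_top_of_forall_nnreal_le fun s => ?_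
    -- The increment `(t + 1) ^ p - t ^ p` is at least `t ^ (p - 1)`, and this `t` makes the latter
    -- `s / K + 1`, enough to exceed `s` after multiplication by `K`.
    set t : ℝ := (s / K + 1) ^ (1 / (p - 1)) with ht
    have hs0 : 0 < (s : ℝ) / K + 1 := by positivity
    have ht0 : 0 < t := Real.rpow_pos_of_pos hs0 _
    have htp : t ^ (p - 1) = s / K + 1 := by
      rw [ht, ← Real.rpow_mul hs0.le, one_div_mul_cancel (by linarith), Real.rpow_one]
    refine le_trans ?_ (le_recession (φ := φ) (ρ := m) (w := t • v)
      (hφ.mem_effDom_of_mem_Ioo hmI _))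
    rw [add_zero, show t • v + v = (t + 1) • v by rw [add_smul, one_smul],
      hφ.map_smul _ _ ht0.ne', hφ.map_smul _ _ (by positivity), abs_of_pos ht0,
      abs_of_pos (by positivity), ← ENNReal.ofReal_toReal hfin,
      ← ENNReal.ofReal_mul (by positivity), ← ENNReal.ofReal_mul (by positivity),
      ← ENNReal.ofReal_sub _ (by positivity), ← ENNReal.ofReal_coe_nnreal]
    refine ENNReal.ofReal_le_ofReal ?_
    change (s : ℝ) ≤ (t + 1) ^ p * K - t ^ p * K
    have h1 : ∀ x : ℝ, 0 < x → x ^ p = x * x ^ (p - 1) := fun x hx => by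
      rw [← Real.rpow_one_add' hx.le (by linarith)]; congr 1; ring
    have h2 : t ^ (p - 1) ≤ (t + 1) ^ (p - 1) :=
      Real.rpow_le_rpow ht0.le (by linarith) (by linarith)
    rw [h1 t ht0, h1 (t + 1) (by positivity)]
    have h3 : (s : ℝ) ≤ t ^ (p - 1) * K := by
      rw [htp, add_mul, div_mul_cancel₀ _ hK.ne']
      linarith
    nlinarith [mul_le_mul_of_nonneg_left h2 (by positivity : 0 ≤ (t + 1) * K)]
  · obtain ⟨ρ, hρ, hρ'⟩ : ∃ ρ ∈ Set.Ioo a b, ρ + r ∉ Set.Icc a b := by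
      rcases lt_or_gt_of_ne hr with hr | hr
      · obtain ⟨ρ, h1, h2⟩ := exists_between (show a < min b (a - r) from
          lt_min hab (by linarith))
        exact ⟨ρ, ⟨h1, h2.trans_le (min_le_left _ _)⟩, fun h => by
          linarith [h.1, h2.trans_le (min_le_right _ _)]⟩
      · obtain ⟨ρ, h1, h2⟩ := exists_between (show max a (b - r) < b from
          max_lt hab (by linarith))
        exact ⟨ρ, ⟨(le_max_left _ _).trans_lt h1, h2⟩, fun h => by
          linarith [h.2, (le_max_right _ _).trans_lt h1]⟩
    have h1 := le_recession (φ := φ) (r := r) (v := v) (hφ.mem_effDom_of_mem_Ioo hρ 0)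
    have h2 : φ (ρ + r) (0 + v) = ∞ := by
      by_contra hne
      exact hρ' (hφ.mem_Icc hab hne)
    rw [h2, ENNReal.top_sub (hφ.mem_effDom_of_mem_Ioo hρ 0)] at h1
    exact top_le_iff.1 h1

end IsActionDensityOn

end Density

/-! ### Densities, total variations and vanishing singular parts -/

namespace SignedRadon

variable {d : ℕ} {γ : Measure (Eucl d)}

theorem measurable_density (μ : SignedRadon d) (γ : Measure (Eucl d)) :
    Measurable (μ.density γ) :=
  (Measure.measurable_rnDeriv _ _).ennreal_toReal.sub
    (Measure.measurable_rnDeriv _ _).ennreal_toReal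

/-- A vanishing density makes the Jordan parts equal, and a measure singular to itself is zero. -/
theorem tv_eq_zero_of_density_eq_zero [SigmaFinite γ] {τ : SignedRadon d} (h : τ.tv ≪ γ)
    (h0 : ∀ᵐ x ∂γ, τ.density γ x = 0) : τ.tv = 0 := by
  have heq : τ.pos = τ.neg := by
    rw [← Measure.withDensity_rnDeriv_eq _ _ (pos_ac_of_tv_ac h),
      ← Measure.withDensity_rnDeriv_eq _ _ (neg_ac_of_tv_ac h)]
    refine withDensity_congr_ae ?_
    filter_upwards [h0, τ.pos.rnDeriv_ne_top γ, τ.neg.rnDeriv_ne_top γ] with x h1 h2 h3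
    exact (ENNReal.toReal_eq_toReal_iff' h2 h3).1 (sub_eq_zero.1 h1)
  have hself := τ.mutuallySingular
  rw [heq, Measure.MutuallySingular.self_iff] at hself
  rw [tv, heq, hself, add_zero]

/-- Off a null set at most one of the two derivatives is nonzero, so the absolute value of their
difference is their sum. -/
theorem tv_eq_withDensity [SigmaFinite γ] {τ : SignedRadon d} (h : τ.tv ≪ γ) :
    τ.tv = γ.withDensity fun x => ‖τ.density γ x‖ₑ := by
  obtain ⟨S, hS, hS1, hS2⟩ := τ.exists_hahn
  have hp := Measure.withDensity_rnDeriv_eq _ _ (pos_ac_of_tv_ac h)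
  have hn := Measure.withDensity_rnDeriv_eq _ _ (neg_ac_of_tv_ac h)
  have h1 : ∀ᵐ x ∂γ, x ∈ S → τ.pos.rnDeriv γ x = 0 := by
    rw [← hp, withDensity_apply _ hS, lintegral_eq_zero_iff (Measure.measurable_rnDeriv _ _)] at hS1
    exact (ae_restrict_iff' hS).1 hS1
  have h2 : ∀ᵐ x ∂γ, x ∈ Sᶜ → τ.neg.rnDeriv γ x = 0 := by
    rw [← hn, withDensity_apply _ hS.compl,
      lintegral_eq_zero_iff (Measure.measurable_rnDeriv _ _)] at hS2
    exact (ae_restrict_iff' hS.compl).1 hS2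
  calc τ.tv = γ.withDensity (τ.pos.rnDeriv γ) + γ.withDensity (τ.neg.rnDeriv γ) := by
        rw [hp, hn, tv]
    _ = γ.withDensity (τ.pos.rnDeriv γ + τ.neg.rnDeriv γ) :=
        (withDensity_add_left (Measure.measurable_rnDeriv _ _) _).symm
    _ = _ := by
        refine withDensity_congr_ae ?_
        filter_upwards [h1, h2, τ.pos.rnDeriv_ne_top γ, τ.neg.rnDeriv_ne_top γ] with x h1 h2 h3 h4
        simp only [Pi.add_apply, density]
        by_cases hx : x ∈ S
        · rw [h1 hx, ENNReal.toReal_zero, zero_sub, enorm_neg, zero_add, ← ofReal_norm,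
            Real.norm_of_nonneg ENNReal.toReal_nonneg, ENNReal.ofReal_toReal h4]
        · rw [h2 hx, ENNReal.toReal_zero, sub_zero, add_zero, ← ofReal_norm,
            Real.norm_of_nonneg ENNReal.toReal_nonneg, ENNReal.ofReal_toReal h3]

theorem tv_ac_of_singular_tv_eq_zero [SigmaFinite γ] {τ : SignedRadon d}
    (h : (τ.singular γ).tv = 0) : τ.tv ≪ γ := by
  have h1 : τ.pos.singularPart γ = 0 ∧ τ.neg.singularPart γ = 0 := by
    have h2 := (τ.singular γ).pos_le_tv
    have h3 := (τ.singular γ).neg_le_tv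
    rw [h] at h2 h3
    exact ⟨le_antisymm h2 (Measure.zero_le _), le_antisymm h3 (Measure.zero_le _)⟩
  exact Measure.AbsolutelyContinuous.add_left ((Measure.singularPart_eq_zero _ _).1 h1.1)
    ((Measure.singularPart_eq_zero _ _).1 h1.2)

theorem singular_tv_eq_zero {τ : SignedRadon d} (h : τ.tv ≪ γ) : (τ.singular γ).tv = 0 := by
  change τ.pos.singularPart γ + τ.neg.singularPart γ = 0
  rw [Measure.singularPart_eq_zero_of_ac (pos_ac_of_tv_ac h),
    Measure.singularPart_eq_zero_of_ac (neg_ac_of_tv_ac h), add_zero]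

/-- The zero measure. -/
def null (d : ℕ) : SignedRadon d := ⟨0, 0, inferInstance, inferInstance, .zero_left⟩

theorem null_tv : (null d).tv = 0 := add_zero 0

theorem null_eval (B : Set (Eucl d)) : (null d).eval B = 0 := by
  simp [eval, null]

theorem null_density [SigmaFinite γ] : (null d).density γ =ᵐ[γ] fun _ => 0 := by
  filter_upwards [Measure.rnDeriv_zero γ] with x hx
  simp [density, null, hx]

end SignedRadon

namespace VectorRadon

variable {d : ℕ} {γ : Measure (Eucl d)}

instance instIsLocallyFiniteMeasureTv (ν : VectorRadon d) :
    IsLocallyFiniteMeasure (VectorRadon.tv ν) := by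
  rw [tv]
  refine Finset.sum_induction (fun i => (ν i).tv) (fun m => IsLocallyFiniteMeasure m)
    (fun m n hm hn => inferInstance) inferInstance fun i _ => inferInstance

theorem tv_le_tv (ν : VectorRadon d) (i : Fin d) : (ν i).tv ≤ VectorRadon.tv ν :=
  Finset.single_le_sum (f := fun i => (ν i).tv) (fun _ _ => Measure.zero_le _) (Finset.mem_univ i)

theorem measurable_density (ν : VectorRadon d) (γ : Measure (Eucl d)) :
    Measurable (VectorRadon.density ν γ) :=
  (WithLp.measurable_toLp 2 _).comp
    (measurable_pi_lambda _ fun i => (ν i).measurable_density γ)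

/-- Scalar multiples of vector-valued Radon measures. -/
noncomputable def scale (c : ℝ) (ν : VectorRadon d) : VectorRadon d := fun i => (ν i).scale c

theorem density_scale (c : ℝ) (ν : VectorRadon d) (γ : Measure (Eucl d)) [SigmaFinite γ] :
    VectorRadon.density (scale c ν) γ =ᵐ[γ] fun x => c • VectorRadon.density ν γ x := by
  have := ae_all_iff.2 fun i => (ν i).density_scale c γ
  filter_upwards [this] with x hx
  ext i
  exact hx i

end VectorRadon

/-! ### Consequences of finite action; the flux bound -/

section Action

variable {d : ℕ} {p q a b : ℝ} {φ : ℝ → Eucl d → ℝ≥0∞} {γ : Measure (Eucl d)}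

theorem action_eq_of_ac {μ : SignedRadon d} {ν : VectorRadon d} (hμ : μ.tv ≪ γ)
    (hν : ∀ i, (ν i).tv ≪ γ) : action φ γ μ ν =
      ∫⁻ x, φ (μ.density γ x) (VectorRadon.density ν γ x) ∂γ := by
  have h2 : VectorRadon.tv (VectorRadon.singular ν γ) = 0 :=
    Finset.sum_eq_zero fun i _ => SignedRadon.singular_tv_eq_zero (hν i)
  simp only [action, SignedRadon.singular_tv_eq_zero hμ, h2, add_zero, lintegral_zero_measure]

namespace IsActionDensityOn

theorem measurable_integrand (hφ : IsActionDensityOn p a b φ) (μ : SignedRadon d)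
    (ν : VectorRadon d) :
    Measurable fun x => φ (μ.density γ x) (VectorRadon.density ν γ x) :=
  hφ.lowerSemicontinuous.measurable.comp
    ((μ.measurable_density γ).prodMk (VectorRadon.measurable_density ν γ))

variable [IsLocallyFiniteMeasure γ]

/-- The recession functional is infinite off the origin, so a finite singular term forces the
densities of both singular parts to vanish almost everywhere for the measure that dominates them. -/
theorem ac_of_action_ne_top (hφ : IsActionDensityOn p a b φ) (hab : a < b) (hp : 1 < p)
    {μ : SignedRadon d} {ν : VectorRadon d} (h : action φ γ μ ν ≠ ∞) :
    μ.tv ≪ γ ∧ ∀ i, (ν i).tv ≪ γ := by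
  set σ : Measure (Eucl d) := (μ.singular γ).tv + VectorRadon.tv (VectorRadon.singular ν γ) with hσ
  have h2 : ∫⁻ x, recession φ ((μ.singular γ).density σ x)
      (VectorRadon.density (VectorRadon.singular ν γ) σ x) ∂σ ≠ ∞ :=
    ne_top_of_le_ne_top h le_add_self
  set N := {x | (μ.singular γ).density σ x = 0 ∧
    VectorRadon.density (VectorRadon.singular ν γ) σ x = 0}
  have hN : MeasurableSet N :=
    ((μ.singular γ).measurable_density σ (measurableSet_singleton 0)).inter
      (VectorRadon.measurable_density _ σ (measurableSet_singleton 0))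
  have hNc : σ Nᶜ = 0 := by
    by_contra hne
    refine h2 (top_le_iff.1 ?_)
    calc (∞ : ℝ≥0∞) = ∞ * σ Nᶜ := (ENNReal.top_mul hne).symm
      _ = ∫⁻ _ in Nᶜ, ∞ ∂σ := by rw [setLIntegral_const]
      _ ≤ ∫⁻ x in Nᶜ, recession φ ((μ.singular γ).density σ x)
            (VectorRadon.density (VectorRadon.singular ν γ) σ x) ∂σ :=
          setLIntegral_mono' hN.compl fun x hx => (hφ.recession_eq_top hab hp hx).ge
      _ ≤ _ := setLIntegral_le_lintegral _ _
  have hae : ∀ᵐ x ∂σ, x ∈ N := mem_ae_iff.2 hNc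
  refine ⟨SignedRadon.tv_ac_of_singular_tv_eq_zero ?_,
    fun i => SignedRadon.tv_ac_of_singular_tv_eq_zero ?_⟩
  · exact SignedRadon.tv_eq_zero_of_density_eq_zero (γ := σ)
      (Measure.absolutelyContinuous_of_le (Measure.le_add_right le_rfl))
      (hae.mono fun x hx => hx.1)
  · refine SignedRadon.tv_eq_zero_of_density_eq_zero (γ := σ)
      (Measure.absolutelyContinuous_of_le
        ((VectorRadon.tv_le_tv (VectorRadon.singular ν γ) i).trans (Measure.le_add_left le_rfl)))
      (hae.mono fun x hx => ?_)
    exact congrArg (fun w : Eucl d => w i) hx.2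

theorem between_of_action_ne_top (hφ : IsActionDensityOn p a b φ) (hab : a < b) (hp : 1 < p)
    {μ : SignedRadon d} {ν : VectorRadon d} (h : action φ γ μ ν ≠ ∞) :
    SignedRadon.Between a b γ μ := by
  obtain ⟨hμ, hν⟩ := hφ.ac_of_action_ne_top hab hp h
  rw [action_eq_of_ac hμ hν] at h
  refine SignedRadon.between_iff_density.2 ⟨hμ, ?_⟩
  filter_upwards [ae_lt_top (hφ.measurable_integrand μ ν) h] with x hx
  exact hφ.mem_Icc hab hx.ne

theorem action_scale_le (hφ : IsActionDensityOn p a b φ) (hab : a < b) (hp : 1 < p)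
    (μ : SignedRadon d) (ν : VectorRadon d) {c : ℝ} (hc : c ≠ 0) :
    action φ γ μ (VectorRadon.scale c ν) ≤ ENNReal.ofReal (|c| ^ p) * action φ γ μ ν := by
  have hc' : 0 < |c| ^ p := Real.rpow_pos_of_pos (abs_pos.2 hc) _
  by_cases h : action φ γ μ ν = ∞
  · rw [h, ENNReal.mul_top (by simpa using hc')]
    exact le_top
  · obtain ⟨hμ, hν⟩ := hφ.ac_of_action_ne_top hab hp h
    have hcν : ∀ i, (VectorRadon.scale c ν i).tv ≪ γ := fun i => SignedRadon.scale_tv_ac c (hν i)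
    rw [action_eq_of_ac hμ hν, action_eq_of_ac hμ hcν,
      ← lintegral_const_mul _ (hφ.measurable_integrand μ ν)]
    refine lintegral_mono_ae ?_
    filter_upwards [VectorRadon.density_scale c ν γ] with x hx
    rw [hx, hφ.map_smul _ _ hc]

theorem action_null (hφ : IsActionDensityOn p a b φ) (hab : a < b) {μ : SignedRadon d}
    (h : SignedRadon.Between a b γ μ) : action φ γ μ (fun _ => SignedRadon.null d) = 0 := by
  have hν : ∀ _ : Fin d, (SignedRadon.null d).tv ≪ γ := fun i => by
    rw [SignedRadon.null_tv]; exact Measure.AbsolutelyContinuous.zero γ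
  rw [action_eq_of_ac h.tv_ac hν]
  refine (lintegral_congr_ae ?_).trans lintegral_zero
  filter_upwards [(SignedRadon.between_iff_density.1 h).2,
    ae_all_iff.2 fun _ : Fin d => SignedRadon.null_density (γ := γ)] with x hx h0
  have : VectorRadon.density (fun _ => SignedRadon.null d) γ x = 0 := by
    ext i
    exact h0 i
  rw [this, hφ.map_zero hab hx]

/-- The flux is controlled by the action through Hölder's inequality. -/
theorem exists_flux_bound (hφ : IsActionDensityOn p a b φ) (hab : a < b)
    (hpq : p.HolderConjugate q) : ∃ C : ℝ, 0 < C ∧ ∀ (μ : SignedRadon d) (ν : VectorRadon d)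
      (i : Fin d) (G : Eucl d → ℝ≥0∞) (K : ℝ≥0∞), Measurable G → K ≠ 0 →
      (∫⁻ x, G x ^ q ∂γ) ^ (1 / q) ≤ K →
      ∫⁻ x, G x ∂(ν i).tv ≤ K * (ENNReal.ofReal C * action φ γ μ ν) ^ (1 / p) := by
  obtain ⟨c, hc, hlow⟩ := hφ.exists_lower_bound hab hpq.lt
  have hp0 : 0 < p := hpq.pos
  refine ⟨c⁻¹, inv_pos.2 hc, fun μ ν i G K hG hK hGK => ?_⟩
  -- Infinite action makes the right-hand side infinite only because `K ≠ 0`: in `ℝ≥0∞`, `0 * ∞ =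
  -- 0`.
  by_cases h : action φ γ μ ν = ∞
  · rw [h, ENNReal.mul_top (by simpa using hc), ENNReal.top_rpow_of_pos (by positivity),
      ENNReal.mul_top hK]
    exact le_top
  obtain ⟨hμ, hν⟩ := hφ.ac_of_action_ne_top hab hpq.lt h
  have hw : Measurable fun x => ‖VectorRadon.density ν γ x‖ₑ :=
    (VectorRadon.measurable_density ν γ).enorm
  have hwi : Measurable fun x => ‖(ν i).density γ x‖ₑ := ((ν i).measurable_density γ).enorm
  have hle : ∫⁻ x, ‖VectorRadon.density ν γ x‖ₑ ^ p ∂γ ≤ ENNReal.ofReal c⁻¹ * action φ γ μ ν := by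
    rw [action_eq_of_ac hμ hν, ← lintegral_const_mul _ (hφ.measurable_integrand μ ν)]
    refine lintegral_mono fun x => ?_
    calc ‖VectorRadon.density ν γ x‖ₑ ^ p
        = ENNReal.ofReal c⁻¹ * ENNReal.ofReal (c * ‖VectorRadon.density ν γ x‖ ^ p) := by
          rw [← ENNReal.ofReal_mul (by positivity), ← mul_assoc, inv_mul_cancel₀ hc.ne', one_mul,
            ← ENNReal.ofReal_rpow_of_nonneg (norm_nonneg _) hp0.le, ofReal_norm]
      _ ≤ _ := mul_le_mul' le_rfl (hlow _ _)
  calc ∫⁻ x, G x ∂(ν i).tv = ∫⁻ x, (fun x => ‖(ν i).density γ x‖ₑ) x * G x ∂γ := by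
        rw [SignedRadon.tv_eq_withDensity (hν i)]
        exact lintegral_withDensity_eq_lintegral_mul _ hwi hG
    _ ≤ ∫⁻ x, ((fun x => G x) * fun x => ‖VectorRadon.density ν γ x‖ₑ) x ∂γ := by
        refine lintegral_mono fun x => ?_
        simp only [Pi.mul_apply]
        rw [mul_comm]
        refine mul_le_mul' le_rfl (enorm_le_iff_norm_le.2 ?_)
        exact PiLp.norm_apply_le (VectorRadon.density ν γ x) i
    _ ≤ (∫⁻ x, G x ^ q ∂γ) ^ (1 / q) * (∫⁻ x, ‖VectorRadon.density ν γ x‖ₑ ^ p ∂γ) ^ (1 / p) :=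
        ENNReal.lintegral_mul_le_Lp_mul_Lq γ hpq.symm hG.aemeasurable hw.aemeasurable
    _ ≤ _ := mul_le_mul' hGK (ENNReal.rpow_le_rpow hle (by positivity))

end IsActionDensityOn

end Action

/-! ### Weak derivatives on the unit interval -/

section OneDim

theorem deriv_smoothTransition_eq_zero {u : ℝ} (hu : u ∉ Set.Icc (0 : ℝ) 1) :
    deriv Real.smoothTransition u = 0 := by
  rcases lt_or_ge u 0 with h | h
  · have : Real.smoothTransition =ᶠ[𝓝 u] fun _ => 0 := by
      filter_upwards [Iio_mem_nhds h] with v hv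
      exact Real.smoothTransition.zero_of_nonpos (le_of_lt hv)
    rw [this.deriv_eq, deriv_const]
  · have h1 : 1 < u := by
      by_contra hne
      exact hu ⟨h, not_lt.1 hne⟩
    have : Real.smoothTransition =ᶠ[𝓝 u] fun _ => 1 := by
      filter_upwards [Ioi_mem_nhds h1] with v hv
      exact Real.smoothTransition.one_of_one_le (le_of_lt hv)
    rw [this.deriv_eq, deriv_const]

theorem contDiff_smoothTransition : ContDiff ℝ 1 Real.smoothTransition := by
  exact_mod_cast Real.smoothTransition.contDiff (n := 1)

theorem continuous_deriv_smoothTransition : Continuous (deriv Real.smoothTransition) :=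
  contDiff_smoothTransition.continuous_deriv le_rfl

/-- Concentration of the rescaled derivatives of the smooth transition. -/
theorem tendsto_integral_deriv_smoothTransition {F : ℝ → ℝ} (hF : Continuous F) {s : ℝ}
    (hs : s ∈ Set.Ioo (0 : ℝ) 1) :
    Tendsto (fun n : ℕ => ∫ r in Set.Ioo (0 : ℝ) 1,
      ((n : ℝ) + 1) * deriv Real.smoothTransition (((n : ℝ) + 1) * (r - s)) * F r) atTop
      (𝓝 (F s)) := by
  set D := deriv Real.smoothTransition with hD
  have hDc : Continuous D := continuous_deriv_smoothTransition
  -- The substitution `r = s + u τ` with `τ = 1 / (n + 1)` turns the limit into continuity at `τ =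
  -- 0`, where the integral is `F s` because `D` has integral `1`.
  have hcont : Continuous fun τ : ℝ => ∫ u in (0 : ℝ)..1, D u * F (s + u * τ) :=
    intervalIntegral.continuous_parametric_intervalIntegral_of_continuous' (by fun_prop) 0 1
  have h0 : ∫ u in (0 : ℝ)..1, D u * F (s + u * 0) = F s := by
    simp only [mul_zero, add_zero]
    rw [intervalIntegral.integral_mul_const, hD, intervalIntegral.integral_deriv_eq_sub
      (fun x _ => contDiff_smoothTransition.differentiable one_ne_zero x)
      (hDc.intervalIntegrable _ _)]
    simp
  have hinv : Tendsto (fun n : ℕ => ((n : ℝ) + 1)⁻¹) atTop (𝓝 0) := by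
    simpa [one_div] using tendsto_one_div_add_atTop_nhds_zero_nat (𝕜 := ℝ)
  have hlim := (hcont.tendsto 0).comp hinv
  rw [h0] at hlim
  refine hlim.congr' ?_
  -- From here on the rescaled kernel, carried by `[s, s + 1 / (n + 1)]`, fits inside `(0, 1)`.
  filter_upwards [hinv.eventually (Iio_mem_nhds (sub_pos.2 hs.2))] with n hn
  have hn0 : (0 : ℝ) < (n : ℝ) + 1 := by positivity
  set N : ℝ := (n : ℝ) + 1
  have h1 : ∫ r in Set.Ioo (0 : ℝ) 1, N * D (N * (r - s)) * F r =
      ∫ r, N * D (N * (r - s)) * F r := by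
    refine setIntegral_eq_integral_of_forall_compl_eq_zero fun r hr => ?_
    rw [hD, deriv_smoothTransition_eq_zero, mul_zero, zero_mul]
    rintro ⟨h2, h3⟩
    refine hr ⟨?_, ?_⟩
    · have : 0 ≤ r - s := nonneg_of_mul_nonneg_right h2 hn0
      linarith [hs.1]
    · have h4 : r - s ≤ N⁻¹ := by
        rw [inv_eq_one_div, le_div_iff₀ hn0]
        linarith
      have : N⁻¹ < 1 - s := hn
      linarith
  have h2 : ∫ r, N * D (N * (r - s)) * F r = ∫ u, D u * F (s + u * N⁻¹) := by
    have e1 : ∀ r, N * D (N * (r - s)) * F r =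
        (fun r => (fun u => N * (D u * F (s + u * N⁻¹))) (N * r)) (r - s) := fun r => by
      simp only
      rw [mul_comm N (r - s), mul_assoc (r - s), mul_inv_cancel₀ hn0.ne', mul_one]
      rw [add_sub_cancel]
      ring
    simp_rw [e1]
    rw [integral_sub_right_eq_self (fun r => (fun u => N * (D u * F (s + u * N⁻¹))) (N * r)) s,
      Measure.integral_comp_mul_left (fun u => N * (D u * F (s + u * N⁻¹))) N, integral_const_mul, smul_eq_mul, ← mul_assoc,
      abs_of_pos (inv_pos.2 hn0), inv_mul_cancel₀ hn0.ne', one_mul]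
  have h3 : ∫ u, D u * F (s + u * N⁻¹) = ∫ u in (0 : ℝ)..1, D u * F (s + u * N⁻¹) := by
    rw [intervalIntegral.integral_of_le zero_le_one, ← integral_Icc_eq_integral_Ioc]
    refine (setIntegral_eq_integral_of_forall_compl_eq_zero fun u hu => ?_).symm
    rw [hD, deriv_smoothTransition_eq_zero hu, zero_mul]
  rw [h1, h2, h3]
  rfl

/-- A continuous function whose weak derivative on `(0, 1)` is integrable is a primitive of it. -/
theorem eq_integral_of_weak_deriv {F H : ℝ → ℝ} (hF : Continuous F)
    (hH : IntegrableOn H (Set.Ioo 0 1))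
    (h : ∀ η : ℝ → ℝ, ContDiff ℝ 1 η → HasCompactSupport η → tsupport η ⊆ Set.Ioo 0 1 →
      ∫ t in Set.Ioo (0 : ℝ) 1, (deriv η t * F t + η t * H t) = 0) :
    ∀ t ∈ Set.Icc (0 : ℝ) 1, F t - F 0 = ∫ s in (0 : ℝ)..t, H s := by
  set S := Real.smoothTransition
  have hSd : Differentiable ℝ S := contDiff_smoothTransition.differentiable one_ne_zero
  have hSn : ∀ x, |S x| ≤ 1 := fun x => by
    rw [abs_of_nonneg (Real.smoothTransition.nonneg x)]
    exact Real.smoothTransition.le_one x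
  have hS0 : ∀ x ≤ 0, S x = 0 := fun x hx => Real.smoothTransition.zero_of_nonpos hx
  have hS1 : ∀ x, 1 ≤ x → S x = 1 := fun x hx => Real.smoothTransition.one_of_one_le hx
  have hIoc : IntegrableOn H (Set.Ioc 0 1) := by
    rwa [integrableOn_Ioc_iff_integrableOn_Ioo]
  have hII : IntervalIntegrable H volume 0 1 :=
    (intervalIntegrable_iff_integrableOn_Ioc_of_le zero_le_one).2 hIoc
  have main : ∀ s ∈ Set.Ioo (0 : ℝ) 1, ∀ t ∈ Set.Ioo (0 : ℝ) 1, s < t →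
      F t - F s = ∫ r in s..t, H r := by
    intro s hs t ht hst
    -- A plateau that rises just after `s` and falls just after `t`: it tends to the indicator of
    -- `(s, t]`, and its derivative tends to `δ_s - δ_t`.
    set η : ℕ → ℝ → ℝ := fun n r => S (((n : ℝ) + 1) * (r - s)) - S (((n : ℝ) + 1) * (r - t))
      with hη
    have hηc : ∀ n, ContDiff ℝ 1 (η n) := fun n =>
      (contDiff_smoothTransition.comp (contDiff_const.mul (contDiff_id.sub contDiff_const))).sub
        (contDiff_smoothTransition.comp (contDiff_const.mul (contDiff_id.sub contDiff_const)))
    have hder : ∀ n r, deriv (η n) r =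
        ((n : ℝ) + 1) * deriv S (((n : ℝ) + 1) * (r - s)) -
          ((n : ℝ) + 1) * deriv S (((n : ℝ) + 1) * (r - t)) := by
      intro n r
      have hd : ∀ c : ℝ, HasDerivAt (fun r => S (((n : ℝ) + 1) * (r - c)))
          (((n : ℝ) + 1) * deriv S (((n : ℝ) + 1) * (r - c))) r := fun c => by
        have h1 : HasDerivAt (fun r : ℝ => ((n : ℝ) + 1) * (r - c)) ((n : ℝ) + 1) r := by
          simpa using ((hasDerivAt_id r).sub_const c).const_mul ((n : ℝ) + 1)
        have h2 := (hSd (((n : ℝ) + 1) * (r - c))).hasDerivAt.comp r h1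
        rw [mul_comm]
        exact h2
      exact ((hd s).sub (hd t)).deriv
    have hinv : Tendsto (fun n : ℕ => ((n : ℝ) + 1)⁻¹) atTop (𝓝 0) := by
      simpa [one_div] using tendsto_one_div_add_atTop_nhds_zero_nat (𝕜 := ℝ)
    have hsupp : ∀ᶠ n in atTop, tsupport (η n) ⊆ Set.Icc s (t + ((n : ℝ) + 1)⁻¹) := by
      refine Eventually.of_forall fun n => closure_minimal (fun r hr => ?_) isClosed_Icc
      have hn0 : (0 : ℝ) < (n : ℝ) + 1 := by positivity
      by_contra hne
      refine hr ?_
      simp only [hη]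
      rw [Set.mem_Icc, not_and_or, not_le, not_le] at hne
      rcases hne with hlt | hgt
      · rw [hS0, hS0, sub_zero]
        · exact mul_nonpos_of_nonneg_of_nonpos hn0.le (by linarith)
        · exact mul_nonpos_of_nonneg_of_nonpos hn0.le (by linarith)
      · have h3 : ((n : ℝ) + 1)⁻¹ ≤ r - t := by linarith
        rw [inv_le_iff_one_le_mul₀ hn0] at h3
        rw [hS1, hS1, sub_self]
        · linarith
        · nlinarith
    have hsupp' : ∀ᶠ n in atTop, tsupport (η n) ⊆ Set.Ioo 0 1 ∧ HasCompactSupport (η n) := by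
      filter_upwards [hsupp, hinv.eventually (Iio_mem_nhds (sub_pos.2 ht.2))] with n hn hn'
      refine ⟨fun r hr => ⟨hs.1.trans_le (hn hr).1, (hn hr).2.trans_lt ?_⟩,
        isCompact_Icc.of_isClosed_subset (isClosed_tsupport _) hn⟩
      have : ((n : ℝ) + 1)⁻¹ < 1 - t := hn'
      linarith
    have hlim1 := (tendsto_integral_deriv_smoothTransition hF hs).sub
      (tendsto_integral_deriv_smoothTransition hF ht)
    have hlim2 : Tendsto (fun n => ∫ r in Set.Ioo (0 : ℝ) 1, η n r * H r) atTop
        (𝓝 (∫ r in Set.Ioo (0 : ℝ) 1, (Set.Ioc s t).indicator H r)) := by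
      refine tendsto_integral_of_dominated_convergence (fun r => 2 * ‖H r‖)
        (fun n => ((hηc n).continuous.aestronglyMeasurable).mul hH.aestronglyMeasurable)
        (hH.norm.const_mul 2) (fun n => ae_of_all _ fun r => ?_) (ae_of_all _ fun r => ?_)
      · rw [norm_mul]
        refine mul_le_mul_of_nonneg_right ?_ (norm_nonneg _)
        refine (abs_sub _ _).trans ?_
        linarith [hSn (((n : ℝ) + 1) * (r - s)), hSn (((n : ℝ) + 1) * (r - t))]
      · have hone : ∀ c : ℝ, c < r → ∀ᶠ n : ℕ in atTop, S (((n : ℝ) + 1) * (r - c)) = 1 := by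
          intro c hc
          filter_upwards [hinv.eventually (Iio_mem_nhds (sub_pos.2 hc))] with n hn
          have hn0 : (0 : ℝ) < (n : ℝ) + 1 := by positivity
          have hn' : ((n : ℝ) + 1)⁻¹ < r - c := hn
          rw [inv_lt_iff_one_lt_mul₀ hn0] at hn'
          exact Real.smoothTransition.one_of_one_le (by linarith)
        have hzero : ∀ c : ℝ, r ≤ c → ∀ n : ℕ, S (((n : ℝ) + 1) * (r - c)) = 0 := fun c hc n =>
          Real.smoothTransition.zero_of_nonpos
            (mul_nonpos_of_nonneg_of_nonpos (by positivity) (by linarith))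
        refine tendsto_const_nhds.congr' ?_
        rcases le_or_gt r s with hrs | hrs
        · refine Eventually.of_forall fun n => ?_
          simp only [hη]
          rw [hzero s hrs, hzero t (hrs.trans hst.le), sub_zero, zero_mul, Set.indicator_of_notMem]
          exact fun h => absurd h.1 (not_lt.2 hrs)
        · rcases le_or_gt r t with hrt | hrt
          · filter_upwards [hone s hrs] with n hn
            simp only [hη]
            rw [hn, hzero t hrt, sub_zero, one_mul, Set.indicator_of_mem (show r ∈ Set.Ioc s t from ⟨hrs, hrt⟩)]
          · filter_upwards [hone s hrs, hone t hrt] with n hn hn'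
            simp only [hη]
            rw [hn, hn', sub_self, zero_mul, Set.indicator_of_notMem]
            exact fun h => absurd h.2 (not_le.2 hrt)
    have hint : ∀ g : ℝ → ℝ, Continuous g → IntegrableOn g (Set.Ioo 0 1) := fun g hg =>
      (hg.continuousOn.integrableOn_Icc (a := (0 : ℝ)) (b := 1)).mono_set Set.Ioo_subset_Icc_self
    have hcs : ∀ (n : ℕ) (c : ℝ), Continuous fun r =>
        ((n : ℝ) + 1) * deriv S (((n : ℝ) + 1) * (r - c)) * F r := fun n c =>
      (continuous_const.mul (continuous_deriv_smoothTransition.comp (by fun_prop))).mul hF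
    have hzero : ∀ᶠ n : ℕ in atTop, (∫ r in Set.Ioo (0 : ℝ) 1,
        ((n : ℝ) + 1) * deriv S (((n : ℝ) + 1) * (r - s)) * F r) -
        (∫ r in Set.Ioo (0 : ℝ) 1, ((n : ℝ) + 1) * deriv S (((n : ℝ) + 1) * (r - t)) * F r) +
        ∫ r in Set.Ioo (0 : ℝ) 1, η n r * H r = 0 := by
      filter_upwards [hsupp'] with n hn
      have hηb : IntegrableOn (fun r => η n r * H r) (Set.Ioo 0 1) := by
        refine Integrable.bdd_mul (c := 2) hH (hηc n).continuous.aestronglyMeasurable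
          (ae_of_all _ fun r => ?_)
        refine (abs_sub _ _).trans ?_
        linarith [hSn (((n : ℝ) + 1) * (r - s)), hSn (((n : ℝ) + 1) * (r - t))]
      rw [← integral_sub (hint _ (hcs n s)) (hint _ (hcs n t)),
        ← integral_add (hint (fun r => ((n : ℝ) + 1) * deriv S (((n : ℝ) + 1) * (r - s)) * F r -
          ((n : ℝ) + 1) * deriv S (((n : ℝ) + 1) * (r - t)) * F r)
          ((hcs n s).sub (hcs n t))) hηb]
      refine Eq.trans ?_ (h (η n) (hηc n) hn.2 hn.1)
      refine congrArg (fun g : ℝ → ℝ => ∫ r in Set.Ioo (0 : ℝ) 1, g r) (funext fun r => ?_)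
      simp only [hder]
      ring
    have hfin := tendsto_nhds_unique (hlim1.add hlim2)
      (tendsto_const_nhds.congr' (hzero.mono fun n hn => hn.symm))
    rw [setIntegral_indicator measurableSet_Ioc, Set.inter_eq_self_of_subset_right
      (show Set.Ioc s t ⊆ Set.Ioo 0 1 from
        fun r hr => ⟨hs.1.trans hr.1, hr.2.trans_lt ht.2⟩),
      ← intervalIntegral.integral_of_le hst.le] at hfin
    linarith
  have hprim : ContinuousOn (fun t => ∫ r in (0 : ℝ)..t, H r) (Set.Icc 0 1) := by
    have := intervalIntegral.continuousOn_primitive_interval (a := (0 : ℝ)) (b := 1) (f := H)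
      (μ := volume) (by rw [Set.uIcc_of_le zero_le_one, integrableOn_Icc_iff_integrableOn_Ioc]
                        exact hIoc)
    rwa [Set.uIcc_of_le zero_le_one] at this
  -- The difference is constant in the open interval by `main`, and on the closed one by continuity.
  set P : ℝ → ℝ := fun t => F t - ∫ r in (0 : ℝ)..t, H r with hP
  have hPc : ContinuousOn P (Set.Icc 0 1) := hF.continuousOn.sub hprim
  have hIIt : ∀ t ∈ Set.Icc (0 : ℝ) 1, IntervalIntegrable H volume 0 t := fun t ht =>
    hII.mono_set (by
      rw [Set.uIcc_of_le zero_le_one, Set.uIcc_of_le ht.1]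
      exact Set.Icc_subset_Icc_right ht.2)
  have hlt : ∀ s ∈ Set.Ioo (0 : ℝ) 1, ∀ t ∈ Set.Ioo (0 : ℝ) 1, s < t → P s = P t := by
    intro s hs t ht hst
    have h1 := main s hs t ht hst
    rw [← intervalIntegral.integral_interval_sub_left (hIIt t ⟨ht.1.le, ht.2.le⟩)
      (hIIt s ⟨hs.1.le, hs.2.le⟩)] at h1
    simp only [hP]
    linarith
  have hhalf : (1 / 2 : ℝ) ∈ Set.Ioo (0 : ℝ) 1 := ⟨by norm_num, by norm_num⟩
  have hconst : Set.EqOn P (fun _ => P (1 / 2)) (Set.Ioo 0 1) := by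
    intro t ht
    rcases lt_trichotomy t (1 / 2) with h1 | h1 | h1
    · exact hlt t ht _ hhalf h1
    · rw [h1]
    · exact (hlt _ hhalf t ht h1).symm
  have hall : Set.EqOn P (fun _ => P (1 / 2)) (Set.Icc 0 1) := by
    refine hconst.of_subset_closure hPc continuousOn_const Set.Ioo_subset_Icc_self ?_
    rw [closure_Ioo zero_ne_one]
  intro t ht
  have h1 := (hall ht).trans (hall (Set.left_mem_Icc.2 zero_le_one)).symm
  simp only [hP, intervalIntegral.integral_same] at h1
  linarith

end OneDim

/-! ### Space-time test functions and their derivatives -/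

section TestFunctions

variable {d : ℕ}

/-- The time derivative of a function on space-time. -/
noncomputable def timeDeriv (ζ : Eucl d × ℝ → ℝ) (z : Eucl d × ℝ) : ℝ :=
  fderiv ℝ ζ z (0, 1)

/-- The partial space derivatives of a function on space-time. -/
noncomputable def spaceDeriv (ζ : Eucl d × ℝ → ℝ) (i : Fin d) (z : Eucl d × ℝ) : ℝ :=
  fderiv ℝ ζ z (EuclideanSpace.single i 1, 0)

/-- `C¹` functions on space-time whose support is bounded in space. -/
structure IsTest (ζ : Eucl d × ℝ → ℝ) (R : ℝ) : Prop where
  contDiff : ContDiff ℝ 1 ζ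
  zero : ∀ x t, R ≤ ‖x‖ → ζ (x, t) = 0

/-- The integrand of the continuity equation. -/
noncomputable def ceRate (μ : SignedRadon d) (ν : VectorRadon d) (ζ : Eucl d × ℝ → ℝ) (t : ℝ) : ℝ :=
  μ.integral (fun x => timeDeriv ζ (x, t)) + ∑ i, (ν i).integral (fun x => spaceDeriv ζ i (x, t))

variable {ζ : Eucl d × ℝ → ℝ} {R : ℝ}

theorem deriv_eq_timeDeriv (hζ : ContDiff ℝ 1 ζ) (x : Eucl d) (t : ℝ) :
    deriv (fun s => ζ (x, s)) t = timeDeriv ζ (x, t) := by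
  have h1 := (hζ.differentiable one_ne_zero (x, t)).hasFDerivAt
  have h2 : HasDerivAt (fun s : ℝ => (x, s)) ((0 : Eucl d), (1 : ℝ)) t :=
    (hasDerivAt_const t x).prodMk (hasDerivAt_id t)
  exact (h1.comp_hasDerivAt t h2).deriv

theorem fderiv_eq_spaceDeriv (hζ : ContDiff ℝ 1 ζ) (i : Fin d) (x : Eucl d) (t : ℝ) :
    fderiv ℝ (fun y => ζ (y, t)) x (EuclideanSpace.single i 1) = spaceDeriv ζ i (x, t) := by
  have h1 := (hζ.differentiable one_ne_zero (x, t)).hasFDerivAt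
  have h2 : HasFDerivAt (fun y : Eucl d => (y, t)) (ContinuousLinearMap.inl ℝ (Eucl d) ℝ) x :=
    hasFDerivAt_prodMk_left x t
  have h3 := (h1.comp x h2).fderiv
  have h4 : (fun y => ζ (y, t)) = ζ ∘ fun y : Eucl d => (y, t) := rfl
  rw [h4, h3]
  simp [spaceDeriv]

theorem continuous_timeDeriv (hζ : ContDiff ℝ 1 ζ) : Continuous (timeDeriv ζ) :=
  (hζ.continuous_fderiv one_ne_zero).clm_apply continuous_const

theorem continuous_spaceDeriv (hζ : ContDiff ℝ 1 ζ) (i : Fin d) : Continuous (spaceDeriv ζ i) :=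
  (hζ.continuous_fderiv one_ne_zero).clm_apply continuous_const

theorem IsTest.fderiv_eq_zero (h : IsTest ζ R) {x : Eucl d} (t : ℝ) (hx : R + 1 ≤ ‖x‖) :
    fderiv ℝ ζ (x, t) = 0 := by
  have : ζ =ᶠ[𝓝 (x, t)] fun _ => 0 := by
    have hc : Continuous fun z : Eucl d × ℝ => ‖z.1‖ := by fun_prop
    filter_upwards [hc.continuousAt.eventually (Ioi_mem_nhds (show R < ‖(x, t).1‖ by
      simp only; linarith))] with z hz
    exact h.zero z.1 z.2 (le_of_lt hz)
  rw [this.fderiv_eq]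
  simp

theorem IsTest.timeDeriv_zero (h : IsTest ζ R) (x : Eucl d) (t : ℝ) (hx : R + 1 ≤ ‖x‖) :
    timeDeriv ζ (x, t) = 0 := by
  rw [timeDeriv, h.fderiv_eq_zero t hx]; rfl

theorem IsTest.spaceDeriv_zero (h : IsTest ζ R) (i : Fin d) (x : Eucl d) (t : ℝ)
    (hx : R + 1 ≤ ‖x‖) : spaceDeriv ζ i (x, t) = 0 := by
  rw [spaceDeriv, h.fderiv_eq_zero t hx]; rfl

theorem exists_bound_of_radius {g : Eucl d × ℝ → ℝ} (hg : Continuous g)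
    (hR : ∀ x t, R ≤ ‖x‖ → g (x, t) = 0) :
    ∃ M, 0 ≤ M ∧ ∀ x, ∀ t ∈ Set.Icc (0 : ℝ) 1, |g (x, t)| ≤ M := by
  obtain ⟨M, hM⟩ := ((isCompact_closedBall (0 : Eucl d) R).prod
    (isCompact_Icc (a := (0 : ℝ)) (b := 1))).exists_bound_of_continuousOn hg.continuousOn
  refine ⟨max M 0, le_max_right _ _, fun x t ht => ?_⟩
  by_cases hx : x ∈ Metric.closedBall (0 : Eucl d) R
  · exact (hM (x, t) ⟨hx, ht⟩).trans (le_max_left _ _)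
  · rw [hR x t (not_le.1 (by simpa using hx)).le, abs_zero]
    exact le_max_right _ _

theorem isTest_of_contDiff {f : Eucl d → ℝ} (hf : ContDiff ℝ 1 f)
    (hR : ∀ x, R ≤ ‖x‖ → f x = 0) : IsTest (fun z : Eucl d × ℝ => f z.1) R :=
  ⟨hf.comp contDiff_fst, fun x _ hx => hR x hx⟩

theorem timeDeriv_const {f : Eucl d → ℝ} (hf : ContDiff ℝ 1 f) (x : Eucl d) (t : ℝ) :
    timeDeriv (fun z : Eucl d × ℝ => f z.1) (x, t) = 0 := by
  rw [← deriv_eq_timeDeriv (ζ := fun z : Eucl d × ℝ => f z.1) (hf.comp contDiff_fst)]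
  exact deriv_const t (f x)

theorem spaceDeriv_const {f : Eucl d → ℝ} (hf : ContDiff ℝ 1 f) (i : Fin d) (x : Eucl d) (t : ℝ) :
    spaceDeriv (fun z : Eucl d × ℝ => f z.1) i (x, t) =
      fderiv ℝ f x (EuclideanSpace.single i 1) :=
  (fderiv_eq_spaceDeriv (hf.comp contDiff_fst) i x t).symm

end TestFunctions

namespace SignedRadon

variable {d : ℕ} {a b : ℝ} {γ : Measure (Eucl d)} [IsLocallyFiniteMeasure γ]

/-- The measures and the time in the test function may move together: the masses on a ball are
uniformly bounded through `γ`, and the test function is uniformly continuous in time. -/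
theorem tendsto_integral_param {ι : Type*} {l : Filter ι} {κ : ι → SignedRadon d} {s : ι → ℝ}
    {t L : ℝ} (hκ : ∀ᶠ n in l, Between a b γ (κ n)) (hs : Tendsto s l (𝓝 t))
    {g : Eucl d × ℝ → ℝ} (hg : Continuous g) {R : ℝ} (hR : ∀ x t, R ≤ ‖x‖ → g (x, t) = 0)
    (hL : Tendsto (fun n => (κ n).integral fun x => g (x, t)) l (𝓝 L)) :
    Tendsto (fun n => (κ n).integral fun x => g (x, s n)) l (𝓝 L) := by
  have hc : ∀ t, Continuous fun x => g (x, t) := fun t => by fun_prop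
  have hcs : ∀ t, HasCompactSupport fun x => g (x, t) := fun t =>
    hasCompactSupport_of_norm fun x => hR x t
  set M := (|a| + |b|) * (γ (Metric.ball 0 R)).toReal with hM
  have hM0 : 0 ≤ M := by positivity
  have hdiff : Tendsto (fun n => (κ n).integral (fun x => g (x, s n)) -
      (κ n).integral fun x => g (x, t)) l (𝓝 0) := by
    refine Metric.tendsto_nhds.2 fun ε hε => ?_
    filter_upwards [hκ, hs.eventually (uniformly_near hg hR t (ε := ε / (M + 1)) (by positivity))]
      with n hn hn'
    have h1 := hn.abs_integral_le (R := R)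
      (fun x hx => by rw [hR x (s n) hx, hR x t hx, sub_zero]) hn'
    rw [integral_sub _ (hc _) (hcs _) (hc t) (hcs t)] at h1
    rw [Real.dist_eq, sub_zero]
    refine h1.trans_lt ?_
    rw [← hM, div_mul_eq_mul_div, div_lt_iff₀ (by positivity)]
    nlinarith
  simpa using hdiff.add hL

end SignedRadon

/-! ### Flows of finite energy and integrability of the continuity rate -/

section Curves

variable {d : ℕ} {p q a b : ℝ} {φ : ℝ → Eucl d → ℝ≥0∞} {γ : Measure (Eucl d)}

/-- Curves of measures between `a γ` and `b γ` and of fluxes on the unit time interval that are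
measurable in time and have finite energy. -/
structure IsFlow (a b : ℝ) (φ : ℝ → Eucl d → ℝ≥0∞) (γ : Measure (Eucl d))
    (μ : ℝ → SignedRadon d) (ν : ℝ → VectorRadon d) : Prop where
  between : ∀ t ∈ Set.Icc (0 : ℝ) 1, SignedRadon.Between a b γ (μ t)
  measurable_mu : ∀ f : Eucl d → ℝ, Continuous f → HasCompactSupport f →
    Measurable fun t => (μ t).integral f
  measurable_nu : ∀ (i : Fin d) (B : Set (Eucl d)), MeasurableSet B → Bornology.IsBounded B →
    Measurable fun t => (ν t i).eval B
  energy : ∫⁻ t in Set.Ioo (0 : ℝ) 1, action φ γ (μ t) (ν t) < ∞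

/-- Flows that satisfy the integrated continuity equation. -/
structure IsCEFlow (a b : ℝ) (φ : ℝ → Eucl d → ℝ≥0∞) (γ : Measure (Eucl d))
    (μ : ℝ → SignedRadon d) (ν : ℝ → VectorRadon d) : Prop extends IsFlow a b φ γ μ ν where
  eqn : ∀ (ζ : Eucl d × ℝ → ℝ) (R : ℝ), IsTest ζ R → ∀ t ∈ Set.Icc (0 : ℝ) 1,
    (μ t).integral (fun x => ζ (x, t)) - (μ 0).integral (fun x => ζ (x, 0)) =
      ∫ s in (0 : ℝ)..t, ceRate (μ s) (ν s) ζ s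

variable {μ : ℝ → SignedRadon d} {ν : ℝ → VectorRadon d}

/-- A crude replacement for Hölder's inequality in time, sufficient wherever only finiteness is at
stake. -/
theorem rpow_inv_le_one_add (hp : 1 < p) (x : ℝ≥0∞) : x ^ (1 / p) ≤ 1 + x := by
  have h1 : 1 / p ≤ 1 := by rw [div_le_one (by linarith)]; exact hp.le
  rcases le_total x 1 with h | h
  · exact (ENNReal.rpow_le_one h (by positivity)).trans le_self_add
  · calc x ^ (1 / p) ≤ x ^ (1 : ℝ) := ENNReal.rpow_le_rpow_of_exponent_le h h1
      _ = x := ENNReal.rpow_one x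
      _ ≤ _ := le_add_self

namespace IsFlow

theorem measurable_nu_integral (h : IsFlow a b φ γ μ ν) (i : Fin d) {f : Eucl d → ℝ}
    (hf : Continuous f) (hf' : HasCompactSupport f) : Measurable fun t => (ν t i).integral f :=
  SignedRadon.measurable_integral_of_eval (fun B hB hB' => h.measurable_nu i B hB hB') hf hf'

theorem lintegral_flux_lt_top (h : IsFlow a b φ γ μ ν) {A B : ℝ≥0∞} (hA : A ≠ ∞) (hB : B ≠ ∞)
    {g : ℝ → ℝ≥0∞}
    (hg : ∀ t ∈ Set.Ioo (0 : ℝ) 1, g t ≤ A * (1 + B * action φ γ (μ t) (ν t))) :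
    ∫⁻ t in Set.Ioo (0 : ℝ) 1, g t < ∞ := by
  refine (setLIntegral_mono' measurableSet_Ioo hg).trans_lt ?_
  -- Measurability of the action in time is not established; these forms need only finite constants,
  -- or measurability of the constant summand.
  rw [lintegral_const_mul' _ _ hA, lintegral_add_left measurable_const, lintegral_const_mul' _ _ hB]
  refine ENNReal.mul_lt_top hA.lt_top (ENNReal.add_lt_top.2 ⟨by simp, ?_⟩)
  exact ENNReal.mul_lt_top hB.lt_top h.energy

variable [IsLocallyFiniteMeasure γ]

theorem integrableOn_mu (h : IsFlow a b φ γ μ ν) {g : Eucl d × ℝ → ℝ} (hg : Continuous g) {R : ℝ}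
    (hR : ∀ x t, R ≤ ‖x‖ → g (x, t) = 0) :
    IntegrableOn (fun t => (μ t).integral fun x => g (x, t)) (Set.Ioo 0 1) := by
  obtain ⟨M, hM0, hM⟩ := exists_bound_of_radius hg hR
  have hm := SignedRadon.measurable_integral_param h.measurable_mu hg hR
  refine Measure.integrableOn_of_bounded (s_finite := by simp) hm.aestronglyMeasurable
    (M := M * ((|a| + |b|) * (γ (Metric.ball 0 R)).toReal)) ?_
  refine (ae_restrict_iff' measurableSet_Ioo).2 (ae_of_all _ fun t ht => ?_)
  exact (h.between t ⟨ht.1.le, ht.2.le⟩).abs_integral_le (fun x hx => hR x t hx)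
    (fun x => hM x t ⟨ht.1.le, ht.2.le⟩)

theorem integrableOn_nu (hφ : IsActionDensityOn p a b φ) (hab : a < b)
    (hpq : p.HolderConjugate q) (h : IsFlow a b φ γ μ ν) (i : Fin d) {g : Eucl d × ℝ → ℝ}
    (hg : Continuous g) {R : ℝ} (hR : ∀ x t, R ≤ ‖x‖ → g (x, t) = 0) :
    IntegrableOn (fun t => (ν t i).integral fun x => g (x, t)) (Set.Ioo 0 1) := by
  obtain ⟨M, hM0, hM⟩ := exists_bound_of_radius hg hR
  obtain ⟨C, hC, hflux⟩ := hφ.exists_flux_bound (γ := γ) hab hpq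
  have hm := SignedRadon.measurable_integral_param
    (fun f hf hf' => h.measurable_nu_integral i hf hf') hg hR
  have hq : 0 < q := hpq.symm.pos
  -- The added `1` keeps `K` nonzero, as the flux bound requires.
  set K : ℝ≥0∞ := (ENNReal.ofReal M ^ q * γ (Metric.ball 0 R)) ^ (1 / q) + 1
  have hball : γ (Metric.ball 0 R) ≠ ∞ := (measure_lt_top_of_isBounded _ Metric.isBounded_ball).ne
  have hK : K ≠ ∞ := by
    refine ENNReal.add_ne_top.2 ⟨ENNReal.rpow_ne_top_of_nonneg (by positivity)
      (ENNReal.mul_ne_top (ENNReal.rpow_ne_top_of_nonneg hq.le ENNReal.ofReal_ne_top) hball), ?_⟩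
    simp
  refine ⟨hm.aestronglyMeasurable, ?_⟩
  refine h.lintegral_flux_lt_top (A := K) (B := ENNReal.ofReal C) hK ENNReal.ofReal_ne_top
    fun t ht => ?_
  have ht' : t ∈ Set.Icc (0 : ℝ) 1 := ⟨ht.1.le, ht.2.le⟩
  refine ((ν t i).enorm_integral_le _).trans ((hflux (μ t) (ν t) i (fun x => ‖g (x, t)‖ₑ) K
    ((by fun_prop : Continuous fun x => g (x, t)).measurable.enorm) (by simp [K]) ?_).trans
    (mul_le_mul' le_rfl (rpow_inv_le_one_add hpq.lt _)))
  refine le_trans (ENNReal.rpow_le_rpow ?_ (by positivity)) le_self_add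
  rw [← lintegral_indicator_const Metric.isOpen_ball.measurableSet]
  refine lintegral_mono fun x => ?_
  by_cases hx : x ∈ Metric.ball (0 : Eucl d) R
  · rw [Set.indicator_of_mem hx, ← ofReal_norm]
    exact ENNReal.rpow_le_rpow (ENNReal.ofReal_le_ofReal (hM x t ht')) hq.le
  · simp only
    rw [hR x t (by simpa using hx), enorm_zero, ENNReal.zero_rpow_of_pos hq]
    simp

theorem integrableOn_rate (hφ : IsActionDensityOn p a b φ) (hab : a < b)
    (hpq : p.HolderConjugate q) (h : IsFlow a b φ γ μ ν) {ζ : Eucl d × ℝ → ℝ} {R : ℝ}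
    (hζ : IsTest ζ R) : IntegrableOn (fun t => ceRate (μ t) (ν t) ζ t) (Set.Ioo 0 1) :=
  (h.integrableOn_mu (continuous_timeDeriv hζ.contDiff) hζ.timeDeriv_zero).add
    (integrable_finsetSum _ fun i _ => h.integrableOn_nu hφ hab hpq i
      (continuous_spaceDeriv hζ.contDiff i) (hζ.spaceDeriv_zero i))

end IsFlow

end Curves

/-! ### Distributional versus integrated continuity equation; the energy estimate -/

section Conversion

variable {d : ℕ} {p q a b : ℝ} {φ : ℝ → Eucl d → ℝ≥0∞} {γ : Measure (Eucl d)}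

/-- Extension of a curve on `[0, 1]` that is constant outside. -/
noncomputable def clampCurve (μ : ℝ → SignedRadon d) (t : ℝ) : SignedRadon d :=
  μ (Set.projIcc (0 : ℝ) 1 zero_le_one t)

open Classical in
/-- Extension of a family of fluxes on `(0, 1)` by zero. -/
noncomputable def zeroExtend (ν : ℝ → VectorRadon d) (t : ℝ) : VectorRadon d :=
  if t ∈ Set.Ioo (0 : ℝ) 1 then ν t else fun _ => SignedRadon.null d

theorem clampCurve_of_mem (μ : ℝ → SignedRadon d) {t : ℝ} (ht : t ∈ Set.Icc (0 : ℝ) 1) :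
    clampCurve μ t = μ t := by
  rw [clampCurve, Set.projIcc_of_mem zero_le_one ht]

theorem zeroExtend_of_mem (ν : ℝ → VectorRadon d) {t : ℝ} (ht : t ∈ Set.Ioo (0 : ℝ) 1) :
    zeroExtend ν t = ν t := if_pos ht

theorem continuous_clampCurve {μ : ℝ → SignedRadon d} {f : Eucl d → ℝ}
    (h : ContinuousOn (fun t => (μ t).integral f) (Set.Icc 0 1)) :
    Continuous fun t => (clampCurve μ t).integral f :=
  h.comp_continuous (continuous_subtype_val.comp continuous_projIcc) fun t =>
    (Set.projIcc (0 : ℝ) 1 zero_le_one t).2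

theorem measurable_zeroExtend {ν : ℝ → VectorRadon d} {i : Fin d} {B : Set (Eucl d)}
    (h : Measurable fun t : Set.Ioo (0 : ℝ) 1 => (ν t i).eval B) :
    Measurable fun t => (zeroExtend ν t i).eval B := by
  refine measurable_of_restrict_of_restrict_compl measurableSet_Ioo
    (s := Set.Ioo (0 : ℝ) 1) ?_ ?_
  · convert h using 1
    funext t
    simp only [Set.domRestrict_apply]
    rw [zeroExtend_of_mem ν t.2]
  · have : (Set.Ioo (0 : ℝ) 1)ᶜ.domRestrict (fun t => (zeroExtend ν t i).eval B) = fun _ => 0 := by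
      funext t
      simp only [Set.domRestrict_apply]
      rw [zeroExtend, if_neg t.2, SignedRadon.null_eval]
    rw [this]
    exact measurable_const

theorem setLIntegral_action_extend {μ : ℝ → SignedRadon d} {ν : ℝ → VectorRadon d} :
    ∫⁻ t in Set.Ioo (0 : ℝ) 1, action φ γ (clampCurve μ t) (zeroExtend ν t) =
      ∫⁻ t in Set.Ioo (0 : ℝ) 1, action φ γ (μ t) (ν t) := by
  refine setLIntegral_congr_fun measurableSet_Ioo fun t ht => ?_
  rw [clampCurve_of_mem μ ⟨ht.1.le, ht.2.le⟩, zeroExtend_of_mem ν ht]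

variable [IsLocallyFiniteMeasure γ]

/-- By weak* continuity, the times at which one tested inequality fails form an open set. The action
is infinite there, so a nonempty such set in `(0, 1)` would have positive length and infinite
energy. Closedness of the tested inequalities covers the endpoints. -/
theorem IsActionDensityOn.between_of_energy (hφ : IsActionDensityOn p a b φ) (hab : a < b)
    (hp : 1 < p) {μ : ℝ → SignedRadon d} {ν : ℝ → VectorRadon d}
    (hμ : ∀ f : Eucl d → ℝ, Continuous f → HasCompactSupport f →
      Continuous fun t => (μ t).integral f)
    (he : ∫⁻ t in Set.Ioo (0 : ℝ) 1, action φ γ (μ t) (ν t) < ∞) :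
    ∀ t ∈ Set.Icc (0 : ℝ) 1, SignedRadon.Between a b γ (μ t) := by
  have key : ∀ P : ℝ → Prop, IsOpen {t | P t} →
      (∀ t, P t → ¬ SignedRadon.Between a b γ (μ t)) → ∀ t ∈ Set.Ioo (0 : ℝ) 1, ¬ P t := by
    intro P hP hPb t ht hPt
    set U := {t | P t} ∩ Set.Ioo 0 1
    have hU : IsOpen U := hP.inter isOpen_Ioo
    have hpos : 0 < volume U := hU.measure_pos _ ⟨t, hPt, ht⟩
    refine absurd he (not_lt.2 ?_)
    calc (∞ : ℝ≥0∞) = ∞ * volume U := (ENNReal.top_mul hpos.ne').symm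
      _ = ∫⁻ _ in U, ∞ := by rw [setLIntegral_const]
      _ ≤ ∫⁻ t in U, action φ γ (μ t) (ν t) := by
          refine setLIntegral_mono' hU.measurableSet fun t ht => ?_
          by_contra hne
          exact hPb t ht.1 (hφ.between_of_action_ne_top hab hp fun h => hne (h ▸ le_rfl))
      _ ≤ _ := lintegral_mono_set Set.inter_subset_right
  intro t ht
  refine SignedRadon.between_iff.2 fun f hf hf' h0 => ?_
  have hc := hμ f hf hf'
  have h1 := key (fun t => (μ t).integral f < a * ∫ x, f x ∂γ) (isOpen_lt hc continuous_const)
    (fun t ht hb => absurd (SignedRadon.between_iff.1 hb f hf hf' h0).1 (not_le.2 ht))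
  have h2 := key (fun t => b * ∫ x, f x ∂γ < (μ t).integral f) (isOpen_lt continuous_const hc)
    (fun t ht hb => absurd (SignedRadon.between_iff.1 hb f hf hf' h0).2 (not_le.2 ht))
  rw [← closure_Ioo zero_ne_one] at ht
  exact ⟨closure_minimal (s := Set.Ioo (0 : ℝ) 1)
      (t := {t | a * ∫ x, f x ∂γ ≤ (μ t).integral f})
      (fun s hs => not_lt.1 (h1 s hs)) (isClosed_le continuous_const hc) ht,
    closure_minimal (s := Set.Ioo (0 : ℝ) 1) (t := {t | (μ t).integral f ≤ b * ∫ x, f x ∂γ})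
      (fun s hs => not_lt.1 (h2 s hs)) (isClosed_le hc continuous_const) ht⟩

theorem IsCE.isFlow (hφ : IsActionDensityOn p a b φ) (hab : a < b) (hp : 1 < p)
    {μ : ℝ → SignedRadon d} {ν : ℝ → VectorRadon d} (h : IsCE 1 μ ν)
    (he : ∫⁻ t in Set.Ioo (0 : ℝ) 1, action φ γ (μ t) (ν t) < ∞) :
    IsFlow a b φ γ (clampCurve μ) (zeroExtend ν) := by
  have hc : ∀ f : Eucl d → ℝ, Continuous f → HasCompactSupport f →
      Continuous fun t => (clampCurve μ t).integral f := fun f hf hf' =>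
    continuous_clampCurve (h.weakStar_continuous f hf hf')
  have he' := he
  rw [← setLIntegral_action_extend] at he'
  exact
    { between := hφ.between_of_energy hab hp hc he'
      measurable_mu := fun f hf hf' => (hc f hf hf').measurable
      measurable_nu := fun i B hB hB' => measurable_zeroExtend (h.borel i B hB hB')
      energy := he' }

theorem hasFDerivAt_time_mul {η : ℝ → ℝ} (hη : ContDiff ℝ 1 η) {ζ : Eucl d × ℝ → ℝ}
    (hζ : ContDiff ℝ 1 ζ) (z : Eucl d × ℝ) :
    fderiv ℝ (fun z : Eucl d × ℝ => η z.2 * ζ z) z =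
      η z.2 • fderiv ℝ ζ z + ζ z • (deriv η z.2 • ContinuousLinearMap.snd ℝ (Eucl d) ℝ) := by
  have h1 : HasFDerivAt (fun z : Eucl d × ℝ => η z.2)
      (deriv η z.2 • ContinuousLinearMap.snd ℝ (Eucl d) ℝ) z :=
    (hη.differentiable one_ne_zero z.2).hasDerivAt.comp_hasFDerivAt z hasFDerivAt_snd
  exact (h1.mul (hζ.differentiable one_ne_zero z).hasFDerivAt).fderiv

/-- Testing with `η(t) ζ(x, t)` says that `t ↦ ∫ ζ(·, t) dμ_t` has the rate as its weak derivative.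
This function is continuous, hence equal to the primitive at every time. The factor `η` supplies
compact support in time, so `ζ` need not vanish at the ends. -/
theorem IsCE.isCEFlow (hφ : IsActionDensityOn p a b φ) (hab : a < b) (hpq : p.HolderConjugate q)
    {μ : ℝ → SignedRadon d} {ν : ℝ → VectorRadon d} (h : IsCE 1 μ ν)
    (he : ∫⁻ t in Set.Ioo (0 : ℝ) 1, action φ γ (μ t) (ν t) < ∞) :
    IsCEFlow a b φ γ (clampCurve μ) (zeroExtend ν) := by
  have hflow := h.isFlow hφ hab hpq.lt he
  refine ⟨hflow, fun ζ R hζ => ?_⟩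
  have hbtw : ∀ t, SignedRadon.Between a b γ (clampCurve μ t) := fun t => by
    have := hflow.between _ (Set.projIcc (0 : ℝ) 1 zero_le_one t).2
    rwa [clampCurve_of_mem μ (Set.projIcc (0 : ℝ) 1 zero_le_one t).2] at this
  have hF : Continuous fun t => (clampCurve μ t).integral fun x => ζ (x, t) := by
    refine continuous_iff_continuousAt.2 fun t => ?_
    refine SignedRadon.tendsto_integral_param (Eventually.of_forall hbtw) tendsto_id
      hζ.contDiff.continuous hζ.zero ?_
    have hc : Continuous fun x => ζ (x, t) := by
      have := hζ.contDiff.continuous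
      fun_prop
    exact (continuous_clampCurve (h.weakStar_continuous _ hc
      (SignedRadon.hasCompactSupport_of_norm fun x hx => hζ.zero x t hx))).tendsto t
  refine eq_integral_of_weak_deriv hF (hflow.integrableOn_rate hφ hab hpq hζ)
    fun η hη hηc hηs => ?_
  set θ : Eucl d × ℝ → ℝ := fun z => η z.2 * ζ z with hθ
  have hθt : IsTest θ R :=
    ⟨(hη.comp contDiff_snd).mul hζ.contDiff, fun x t hx => by simp [hθ, hζ.zero x t hx]⟩
  have hsub : tsupport θ ⊆ Set.univ ×ˢ tsupport η := by
    refine closure_minimal (fun z hz => ⟨Set.mem_univ _, subset_tsupport _ fun h0 => hz ?_⟩)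
      (isClosed_univ.prod (isClosed_tsupport _))
    simp [hθ, h0]
  have hsub' : tsupport θ ⊆ Metric.closedBall (0 : Eucl d) R ×ˢ tsupport η := by
    refine closure_minimal (fun z hz => ⟨?_, subset_tsupport _ fun h0 => hz ?_⟩)
      (Metric.isClosed_closedBall.prod (isClosed_tsupport _))
    · by_contra hne
      refine hz ?_
      simp [hθ, hζ.zero z.1 z.2 (not_le.1 (by simpa using hne)).le]
    · simp [hθ, h0]
  have hθc : HasCompactSupport θ :=
    ((isCompact_closedBall _ _).prod hηc).of_isClosed_subset (isClosed_tsupport _) hsub'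
  have hce := h.continuity_eq θ hθt.contDiff hθc
    (hsub.trans (Set.prod_mono_right hηs))
  simp only [deriv_eq_timeDeriv hθt.contDiff, fderiv_eq_spaceDeriv hθt.contDiff] at hce
  have e1 : ∫ t in Set.Ioo (0 : ℝ) 1, (μ t).integral (fun x => timeDeriv θ (x, t)) =
      ∫ t in Set.Ioo (0 : ℝ) 1, (clampCurve μ t).integral (fun x => timeDeriv θ (x, t)) :=
    setIntegral_congr_fun measurableSet_Ioo fun t ht => by
      rw [clampCurve_of_mem μ ⟨ht.1.le, ht.2.le⟩]
  have e2 : ∫ t in Set.Ioo (0 : ℝ) 1, ∑ i, (ν t i).integral (fun x => spaceDeriv θ i (x, t)) =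
      ∫ t in Set.Ioo (0 : ℝ) 1, ∑ i, (zeroExtend ν t i).integral
        (fun x => spaceDeriv θ i (x, t)) :=
    setIntegral_congr_fun measurableSet_Ioo fun t ht => by
      rw [zeroExtend_of_mem ν ht]
  rw [e1, e2, ← integral_add
    (hflow.integrableOn_mu (continuous_timeDeriv hθt.contDiff) hθt.timeDeriv_zero)
    (integrable_finsetSum _ fun i _ => hflow.integrableOn_nu hφ hab hpq i
      (continuous_spaceDeriv hθt.contDiff i) (hθt.spaceDeriv_zero i))] at hce
  refine Eq.trans ?_ hce
  refine setIntegral_congr_fun measurableSet_Ioo fun t _ => ?_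
  have hd1 : ∀ x, timeDeriv θ (x, t) = η t * timeDeriv ζ (x, t) + deriv η t * ζ (x, t) := by
    intro x
    rw [timeDeriv, hθ, hasFDerivAt_time_mul hη hζ.contDiff]
    simp [timeDeriv, mul_comm]
  have hd2 : ∀ i x, spaceDeriv θ i (x, t) = η t * spaceDeriv ζ i (x, t) := by
    intro i x
    rw [spaceDeriv, hθ, hasFDerivAt_time_mul hη hζ.contDiff]
    simp [spaceDeriv]
  have hcz : Continuous fun x => ζ (x, t) := by
    have := hζ.contDiff.continuous
    fun_prop
  have hct : Continuous fun x => timeDeriv ζ (x, t) := by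
    have := continuous_timeDeriv hζ.contDiff
    fun_prop
  have hsz : HasCompactSupport fun x => ζ (x, t) :=
    SignedRadon.hasCompactSupport_of_norm fun x => hζ.zero x t
  have hst : HasCompactSupport fun x => timeDeriv ζ (x, t) :=
    SignedRadon.hasCompactSupport_of_norm fun x => hζ.timeDeriv_zero x t
  simp only [hd1, hd2, ceRate, SignedRadon.integral_const_mul]
  rw [SignedRadon.integral_add (f := fun x => η t * timeDeriv ζ (x, t))
    (g := fun x => deriv η t * ζ (x, t)) _ (continuous_const.mul hct) hst.mul_left (continuous_const.mul hcz) hsz.mul_left, SignedRadon.integral_const_mul,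
    SignedRadon.integral_const_mul, ← Finset.mul_sum]
  ring

/-- Quantitative weak* continuity of a flow in terms of its energy. -/
theorem IsActionDensityOn.exists_energy_estimate (hφ : IsActionDensityOn p a b φ) (hab : a < b)
    (hpq : p.HolderConjugate q) : ∃ C : ℝ, 0 < C ∧
      ∀ (μ : ℝ → SignedRadon d) (ν : ℝ → VectorRadon d), IsCEFlow a b φ γ μ ν →
      ∀ f : Eucl d → ℝ, ContDiff ℝ 1 f → HasCompactSupport f → ∀ K : Fin d → ℝ≥0∞,
      (∀ i, K i ≠ 0) → (∀ i, K i ≠ ∞) →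
      (∀ i, (∫⁻ x, ‖fderiv ℝ f x (EuclideanSpace.single i 1)‖ₑ ^ q ∂γ) ^ (1 / q) ≤ K i) → ∀ t ∈ Set.Icc (0 : ℝ) 1, ‖(μ t).integral f - (μ 0).integral f‖ₑ ≤
          (∑ i, K i) * (ENNReal.ofReal C *
            ∫⁻ t in Set.Ioo (0 : ℝ) 1, action φ γ (μ t) (ν t)) ^ (1 / p) := by
  obtain ⟨C, hC, hflux⟩ := hφ.exists_flux_bound (γ := γ) hab hpq
  have hp0 : 0 < p := hpq.pos
  refine ⟨C, hC, fun μ ν h f hf hf' K hK hK' hfK t ht => ?_⟩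
  obtain ⟨R, hR0, hR⟩ := SignedRadon.exists_radius hf'
  have htest := isTest_of_contDiff hf hR
  have hg : ∀ i, Continuous fun x => fderiv ℝ f x (EuclideanSpace.single i 1) := fun i =>
    (hf.continuous_fderiv one_ne_zero).clm_apply continuous_const
  have hgs : ∀ i, HasCompactSupport fun x => fderiv ℝ f x (EuclideanSpace.single i 1) := fun i =>
    hf'.fderiv_apply ℝ _
  set H : ℝ → ℝ := fun s => ∑ i, (ν s i).integral
    fun x => fderiv ℝ f x (EuclideanSpace.single i 1) with hH
  -- For a test function independent of time only the flux term remains.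
  have hrate : ∀ s, ceRate (μ s) (ν s) (fun z : Eucl d × ℝ => f z.1) s = H s := by
    intro s
    simp only [ceRate, timeDeriv_const hf, spaceDeriv_const hf, SignedRadon.integral_zero_fun,
      zero_add, hH]
  have hHm : Measurable H := Finset.measurable_sum _ fun i _ =>
    h.toIsFlow.measurable_nu_integral i (hg i) (hgs i)
  have hHle : ∀ s, ‖H s‖ₑ ≤ (∑ i, K i) * (ENNReal.ofReal C * action φ γ (μ s) (ν s)) ^ (1 / p) := by
    intro s
    refine (enorm_sum_le _ _).trans ?_
    rw [Finset.sum_mul]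
    refine Finset.sum_le_sum fun i _ => ((ν s i).enorm_integral_le _).trans ?_
    exact hflux (μ s) (ν s) i _ (K i) (hg i).measurable.enorm (hK i) (hfK i)
  have heqn := h.eqn _ R htest t ht
  simp only at heqn
  rw [heqn, intervalIntegral.integral_of_le ht.1]
  simp only [hrate]
  have hsub : ∫⁻ s in Set.Ioc 0 t, ‖H s‖ₑ ≤ ∫⁻ s in Set.Ioo (0 : ℝ) 1, ‖H s‖ₑ := by
    rw [setLIntegral_congr Ioo_ae_eq_Ioc]
    exact lintegral_mono_set (Set.Ioc_subset_Ioc_right ht.2)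
  refine (enorm_integral_le_lintegral_enorm _).trans (hsub.trans ?_)
  -- Hölder in time against the constant `1` on an interval of length one. It is applied to `H`,
  -- which is measurable, and not to the action.
  have hHol := ENNReal.lintegral_mul_le_Lp_mul_Lq (volume.restrict (Set.Ioo (0 : ℝ) 1)) hpq
    (f := fun s => ‖H s‖ₑ) (g := fun _ => 1) hHm.enorm.aemeasurable aemeasurable_const
  simp only [Pi.mul_apply, mul_one, ENNReal.one_rpow, lintegral_const, Measure.restrict_apply,
    MeasurableSet.univ, Set.univ_inter, Real.volume_Ioo, sub_zero, ENNReal.ofReal_one] at hHol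
  refine hHol.trans ?_
  have hKtop : (∑ i, K i) ≠ ∞ := ENNReal.sum_ne_top.2 fun i _ => hK' i
  have hpow : ∫⁻ s in Set.Ioo (0 : ℝ) 1, ‖H s‖ₑ ^ p ≤ (∑ i, K i) ^ p *
      (ENNReal.ofReal C * ∫⁻ t in Set.Ioo (0 : ℝ) 1, action φ γ (μ t) (ν t)) := by
    rw [← lintegral_const_mul' _ _ ENNReal.ofReal_ne_top,
      ← lintegral_const_mul' _ _ (ENNReal.rpow_ne_top_of_nonneg hp0.le hKtop)]
    refine lintegral_mono fun s => ?_
    refine (ENNReal.rpow_le_rpow (hHle s) hp0.le).trans ?_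
    rw [ENNReal.mul_rpow_of_nonneg _ _ hp0.le, ← ENNReal.rpow_mul, one_div_mul_cancel hp0.ne',
      ENNReal.rpow_one]
  refine (ENNReal.rpow_le_rpow hpow (by positivity)).trans ?_
  rw [ENNReal.mul_rpow_of_nonneg _ _ (by positivity), ← ENNReal.rpow_mul,
    mul_one_div_cancel hp0.ne', ENNReal.rpow_one]

/-- For `C¹` functions the integral is a primitive of an integrable rate; the uniform bound by `γ`
extends continuity to uniform limits. -/
theorem IsCEFlow.continuousOn_integral (hφ : IsActionDensityOn p a b φ) (hab : a < b)
    (hpq : p.HolderConjugate q) {μ : ℝ → SignedRadon d} {ν : ℝ → VectorRadon d}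
    (h : IsCEFlow a b φ γ μ ν) {f : Eucl d → ℝ} (hf : Continuous f) (hf' : HasCompactSupport f) :
    ContinuousOn (fun t => (μ t).integral f) (Set.Icc 0 1) := by
  have smooth : ∀ g : Eucl d → ℝ, ContDiff ℝ 1 g → HasCompactSupport g →
      ContinuousOn (fun t => (μ t).integral g) (Set.Icc 0 1) := by
    intro g hg hg'
    obtain ⟨R, hR0, hR⟩ := SignedRadon.exists_radius hg'
    have htest := isTest_of_contDiff hg hR
    have hint := h.toIsFlow.integrableOn_rate hφ hab hpq htest
    have hprim := intervalIntegral.continuousOn_primitive_interval (a := (0 : ℝ)) (b := 1)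
      (f := fun s => ceRate (μ s) (ν s) (fun z : Eucl d × ℝ => g z.1) s) (μ := volume)
      (by rwa [Set.uIcc_of_le zero_le_one, integrableOn_Icc_iff_integrableOn_Ioo])
    rw [Set.uIcc_of_le zero_le_one] at hprim
    refine (hprim.add (continuousOn_const (c := (μ 0).integral g))).congr fun t ht => ?_
    exact sub_eq_iff_eq_add.1 (h.eqn _ R htest t ht)
  obtain ⟨R, -, hR⟩ := SignedRadon.exists_radius hf'
  set M := (|a| + |b|) * (γ (Metric.ball 0 R)).toReal
  have hM0 : 0 ≤ M := by positivity
  refine continuousOn_of_uniform_approx_of_continuousOn fun u hu => ?_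
  obtain ⟨ε, hε, hεu⟩ := Metric.mem_uniformity_dist.1 hu
  obtain ⟨g, hg, hgR, hgf⟩ := SignedRadon.exists_contDiff_near hf hR (ε := ε / (M + 1))
    (by positivity)
  have hgs := SignedRadon.hasCompactSupport_of_norm hgR
  refine ⟨_, smooth g hg hgs, fun t ht => hεu ?_⟩
  have h1 := (h.between t ht).abs_integral_le (R := R)
    (fun x hx => by rw [hgR x hx, hR x hx, sub_zero]) hgf
  rw [SignedRadon.integral_sub _ hg.continuous hgs hf hf'] at h1
  rw [dist_comm, Real.dist_eq]
  refine h1.trans_lt ?_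
  rw [div_mul_eq_mul_div, div_lt_iff₀ (by positivity)]
  change ε * M < ε * (M + 1)
  nlinarith

theorem IsCEFlow.isCE (hφ : IsActionDensityOn p a b φ) (hab : a < b)
    (hpq : p.HolderConjugate q) {μ : ℝ → SignedRadon d} {ν : ℝ → VectorRadon d}
    (h : IsCEFlow a b φ γ μ ν) : IsCE 1 μ ν where
  weakStar_continuous f hf hf' := h.continuousOn_integral hφ hab hpq hf hf'
  borel i B hB hB' := (h.measurable_nu i B hB hB').comp measurable_subtype_coe
  finite_mu R _ := by
    have hball : γ (Metric.ball 0 R) ≠ ∞ := (measure_lt_top_of_isBounded _ Metric.isBounded_ball).ne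
    have hle : ∀ t ∈ Set.Ioo (0 : ℝ) 1, (μ t).tv (Metric.ball 0 R) ≤
        ENNReal.ofReal (|a| + |b|) * γ (Metric.ball 0 R) := fun t ht =>
      (h.between t ⟨ht.1.le, ht.2.le⟩).tv_le _
    refine (setLIntegral_mono' measurableSet_Ioo hle).trans_lt ?_
    rw [setLIntegral_const]
    exact ENNReal.mul_lt_top (ENNReal.mul_lt_top ENNReal.ofReal_lt_top hball.lt_top) (by simp)
  finite_nu R _ := by
    obtain ⟨C, hC, hflux⟩ := hφ.exists_flux_bound (γ := γ) hab hpq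
    have hq : 0 < q := hpq.symm.pos
    have hball : γ (Metric.ball 0 R) ≠ ∞ := (measure_lt_top_of_isBounded _ Metric.isBounded_ball).ne
    set K : ℝ≥0∞ := γ (Metric.ball 0 R) ^ (1 / q) + 1
    have hK : K ≠ ∞ := ENNReal.add_ne_top.2
      ⟨ENNReal.rpow_ne_top_of_nonneg (by positivity) hball, by simp⟩
    refine h.toIsFlow.lintegral_flux_lt_top (A := ∑ _ : Fin d, K) (B := ENNReal.ofReal C)
      (ENNReal.sum_ne_top.2 fun _ _ => hK) ENNReal.ofReal_ne_top fun t ht => ?_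
    rw [VectorRadon.tv, Measure.finsetSum_apply, Finset.sum_mul]
    refine Finset.sum_le_sum fun i _ => ?_
    rw [← lintegral_indicator_one Metric.isOpen_ball.measurableSet]
    refine (hflux (μ t) (ν t) i _ K (measurable_one.indicator Metric.isOpen_ball.measurableSet)
      (by simp [K]) ?_).trans (mul_le_mul' le_rfl (rpow_inv_le_one_add hpq.lt _))
    refine le_trans (ENNReal.rpow_le_rpow ?_ (by positivity)) le_self_add
    rw [← lintegral_indicator_one Metric.isOpen_ball.measurableSet]
    refine lintegral_mono fun x => ?_
    by_cases hx : x ∈ Metric.ball (0 : Eucl d) R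
    · simp [hx]
    · simp [hx, hq]
  continuity_eq ζ hζ hζc hζs := by
    obtain ⟨R, hR⟩ : ∃ R, ∀ x t, R ≤ ‖x‖ → ζ (x, t) = 0 := by
      obtain ⟨R, hR⟩ := hζc.isCompact.isBounded.subset_ball 0
      refine ⟨R, fun x t hx => image_eq_zero_of_notMem_tsupport fun hx' => ?_⟩
      have := hR hx'
      rw [mem_ball_zero_iff, Prod.norm_def] at this
      linarith [(le_max_left ‖x‖ ‖t‖).trans_lt this]
    have htest : IsTest ζ R := ⟨hζ, hR⟩
    have heqn := h.eqn ζ R htest 1 (Set.right_mem_Icc.2 zero_le_one)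
    have h0 : ∀ x, ζ (x, 0) = 0 := fun x =>
      image_eq_zero_of_notMem_tsupport fun hx => absurd (hζs hx).2.1 (lt_irrefl _)
    have h1 : ∀ x, ζ (x, 1) = 0 := fun x =>
      image_eq_zero_of_notMem_tsupport fun hx => absurd (hζs hx).2.2 (lt_irrefl _)
    simp only [h0, h1, SignedRadon.integral_zero_fun, sub_zero] at heqn
    rw [intervalIntegral.integral_of_le zero_le_one, integral_Ioc_eq_integral_Ioo] at heqn
    simp only [deriv_eq_timeDeriv hζ, fderiv_eq_spaceDeriv hζ]
    rw [← integral_add (h.toIsFlow.integrableOn_mu (continuous_timeDeriv hζ) htest.timeDeriv_zero)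
      (integrable_finsetSum _ fun i _ => h.toIsFlow.integrableOn_nu hφ hab hpq i
        (continuous_spaceDeriv hζ i) (htest.spaceDeriv_zero i))]
    exact heqn.symm

theorem IsCEFlow.modifiedW_le (hφ : IsActionDensityOn p a b φ) (hab : a < b)
    (hpq : p.HolderConjugate q) {μ : ℝ → SignedRadon d} {ν : ℝ → VectorRadon d}
    (h : IsCEFlow a b φ γ μ ν) : modifiedW p φ γ (μ 0) (μ 1) ≤
      (∫⁻ t in Set.Ioo (0 : ℝ) 1, action φ γ (μ t) (ν t)) ^ (1 / p) :=
  iInf₂_le_of_le (μ, ν) ⟨h.isCE hφ hab hpq, rfl, rfl, h.energy⟩ le_rfl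

/-- Almost optimal curves, already in integrated form and extended to all times, stand in for
minimisers throughout. -/
theorem exists_isCEFlow_of_modifiedW_lt (hφ : IsActionDensityOn p a b φ) (hab : a < b)
    (hpq : p.HolderConjugate q) {μ₀ μ₁ : SignedRadon d} {A : ℝ≥0∞}
    (h : modifiedW p φ γ μ₀ μ₁ < A) :
    ∃ (μ : ℝ → SignedRadon d) (ν : ℝ → VectorRadon d), IsCEFlow a b φ γ μ ν ∧ μ 0 = μ₀ ∧ μ 1 = μ₁ ∧
      (∫⁻ t in Set.Ioo (0 : ℝ) 1, action φ γ (μ t) (ν t)) ^ (1 / p) < A := by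
  simp only [modifiedW, iInf_lt_iff] at h
  obtain ⟨⟨μ, ν⟩, ⟨hce, h0, h1, he⟩, hlt⟩ := h
  refine ⟨clampCurve μ, zeroExtend ν, hce.isCEFlow hφ hab hpq he, ?_, ?_, ?_⟩
  · rw [clampCurve_of_mem μ (Set.left_mem_Icc.2 zero_le_one)]; exact h0
  · rw [clampCurve_of_mem μ (Set.right_mem_Icc.2 zero_le_one)]; exact h1
  · rw [setLIntegral_action_extend]; exact hlt

end Conversion

/-! ### Affine changes of time and time reversal -/

section Affine

variable {d : ℕ} {p q a b : ℝ} {φ : ℝ → Eucl d → ℝ≥0∞} {γ : Measure (Eucl d)}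

/-- Multiplication by a nonzero constant is a measurable embedding, so `F` may be arbitrary; it will
be the action as a function of time. -/
theorem lintegral_comp_affine (F : ℝ → ℝ≥0∞) (s₀ : ℝ) {c : ℝ} (hc : c ≠ 0) :
    ∫⁻ t, F ((t - s₀) / c) = ENNReal.ofReal |c| * ∫⁻ t, F t := by
  have h1 : ∫⁻ t, F ((t - s₀) / c) = ∫⁻ t, F (c⁻¹ * t) := by
    rw [← lintegral_sub_right_eq_self (fun t => F (c⁻¹ * t)) s₀]
    refine lintegral_congr fun t => ?_
    rw [div_eq_inv_mul]
  have h2 : Measure.map (c⁻¹ * ·) volume = ENNReal.ofReal |c| • (volume : Measure ℝ) := by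
    rw [Real.map_volume_mul_left (inv_ne_zero hc), inv_inv]
  rw [h1, ← (measurableEmbedding_mulLeft₀ (inv_ne_zero hc)).lintegral_map F, h2,
    lintegral_smul_measure, smul_eq_mul]

theorem timeDeriv_affine {ζ : Eucl d × ℝ → ℝ} (hζ : ContDiff ℝ 1 ζ) (s₀ c : ℝ) (x : Eucl d)
    (r : ℝ) : timeDeriv (fun z : Eucl d × ℝ => ζ (z.1, s₀ + c * z.2)) (x, r) =
      c * timeDeriv ζ (x, s₀ + c * r) := by
  have hz : ContDiff ℝ 1 fun z : Eucl d × ℝ => ζ (z.1, s₀ + c * z.2) :=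
    hζ.comp (contDiff_fst.prodMk (contDiff_const.add (contDiff_const.mul contDiff_snd)))
  rw [← deriv_eq_timeDeriv hz]
  have h1 := (hζ.differentiable one_ne_zero (x, s₀ + c * r)).hasFDerivAt
  have h2 : HasDerivAt (fun s : ℝ => (x, s₀ + c * s)) ((0 : Eucl d), c) r := by
    refine (hasDerivAt_const r x).prodMk ?_
    simpa using ((hasDerivAt_id r).const_mul c).const_add s₀
  have h3 := (h1.comp_hasDerivAt r h2).deriv
  have h4 : ((0 : Eucl d), c) = c • ((0 : Eucl d), (1 : ℝ)) := by simp
  rw [h4, map_smul, smul_eq_mul] at h3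
  exact h3

theorem spaceDeriv_affine {ζ : Eucl d × ℝ → ℝ} (hζ : ContDiff ℝ 1 ζ) (s₀ c : ℝ) (i : Fin d)
    (x : Eucl d) (r : ℝ) : spaceDeriv (fun z : Eucl d × ℝ => ζ (z.1, s₀ + c * z.2)) i (x, r) =
      spaceDeriv ζ i (x, s₀ + c * r) := by
  have hz : ContDiff ℝ 1 fun z : Eucl d × ℝ => ζ (z.1, s₀ + c * z.2) :=
    hζ.comp (contDiff_fst.prodMk (contDiff_const.add (contDiff_const.mul contDiff_snd)))
  rw [← fderiv_eq_spaceDeriv hz, ← fderiv_eq_spaceDeriv hζ]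

/-- The continuity equation after an affine change of the time variable. -/
theorem IsCEFlow.eqn_affine {μ : ℝ → SignedRadon d} {ν : ℝ → VectorRadon d}
    (h : IsCEFlow a b φ γ μ ν) (s₀ : ℝ) {c : ℝ} (hc : c ≠ 0) {ζ : Eucl d × ℝ → ℝ} {R : ℝ}
    (hζ : IsTest ζ R) {s : ℝ} (hs : s ∈ Set.Icc (0 : ℝ) 1) :
    (μ s).integral (fun x => ζ (x, s₀ + c * s)) - (μ 0).integral (fun x => ζ (x, s₀)) =
      ∫ t in s₀..s₀ + c * s, ceRate (μ ((t - s₀) / c))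
        (VectorRadon.scale c⁻¹ (ν ((t - s₀) / c))) ζ t := by
  have hz : IsTest (fun z : Eucl d × ℝ => ζ (z.1, s₀ + c * z.2)) R :=
    ⟨hζ.contDiff.comp (contDiff_fst.prodMk (contDiff_const.add (contDiff_const.mul contDiff_snd))),
      fun x t hx => hζ.zero x _ hx⟩
  have h1 := h.eqn _ R hz s hs
  simp only [mul_zero, add_zero] at h1
  rw [h1]
  have h2 := intervalIntegral.mul_integral_comp_add_mul (a := 0) (b := s)
    (f := fun t => ceRate (μ ((t - s₀) / c)) (VectorRadon.scale c⁻¹ (ν ((t - s₀) / c))) ζ t) c s₀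
  rw [mul_zero, add_zero] at h2
  rw [← h2, ← intervalIntegral.integral_const_mul]
  refine intervalIntegral.integral_congr fun r _ => ?_
  simp only [add_sub_cancel_left, mul_div_cancel_left₀ _ hc, ceRate, VectorRadon.scale,
    SignedRadon.integral_scale, timeDeriv_affine hζ.contDiff, spaceDeriv_affine hζ.contDiff,
    SignedRadon.integral_const_mul, ← Finset.mul_sum]
  rw [mul_add, ← mul_assoc c c⁻¹, mul_inv_cancel₀ hc, one_mul]

/-- Scaling the flux by `c⁻¹` costs `|c| ^ (-p)` by homogeneity, and the change of variable
contributes `|c|`. -/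
theorem IsActionDensityOn.lintegral_action_affine [IsLocallyFiniteMeasure γ]
    (hφ : IsActionDensityOn p a b φ) (hab : a < b) (hp : 1 < p) (μ : ℝ → SignedRadon d)
    (ν : ℝ → VectorRadon d) (s₀ : ℝ) {c : ℝ} (hc : c ≠ 0) {I : Set ℝ}
    (hI : ∀ t ∈ I, (t - s₀) / c ∈ Set.Ioo (0 : ℝ) 1) (hIm : MeasurableSet I) :
    ∫⁻ t in I, action φ γ (μ ((t - s₀) / c)) (VectorRadon.scale c⁻¹ (ν ((t - s₀) / c))) ≤
      ENNReal.ofReal (|c| ^ (1 - p)) * ∫⁻ t in Set.Ioo (0 : ℝ) 1, action φ γ (μ t) (ν t) := by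
  have hc0 : 0 < |c| := abs_pos.2 hc
  calc ∫⁻ t in I, action φ γ (μ ((t - s₀) / c)) (VectorRadon.scale c⁻¹ (ν ((t - s₀) / c)))
      ≤ ∫⁻ t in I, ENNReal.ofReal (|c⁻¹| ^ p) * ((Set.Ioo (0 : ℝ) 1).indicator
          (fun t => action φ γ (μ t) (ν t)) ((t - s₀) / c)) := by
        refine setLIntegral_mono' hIm fun t ht => ?_
        rw [Set.indicator_of_mem (hI t ht)]
        exact hφ.action_scale_le hab hp _ _ (inv_ne_zero hc)
    _ ≤ ∫⁻ t, ENNReal.ofReal (|c⁻¹| ^ p) * ((Set.Ioo (0 : ℝ) 1).indicator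
          (fun t => action φ γ (μ t) (ν t)) ((t - s₀) / c)) := setLIntegral_le_lintegral _ _
    _ = ENNReal.ofReal (|c⁻¹| ^ p) * (ENNReal.ofReal |c| *
          ∫⁻ t in Set.Ioo (0 : ℝ) 1, action φ γ (μ t) (ν t)) := by
        rw [lintegral_const_mul' _ _ ENNReal.ofReal_ne_top, lintegral_comp_affine _ s₀ hc,
          lintegral_indicator measurableSet_Ioo]
    _ = _ := by
        rw [← mul_assoc, ← ENNReal.ofReal_mul (by positivity), abs_inv, Real.inv_rpow hc0.le,
          ← Real.rpow_neg hc0.le, ← Real.rpow_add_one hc0.ne']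
        congr 3
        ring

/-- Time reversal of a flow. -/
theorem IsCEFlow.reverse [IsLocallyFiniteMeasure γ] (hφ : IsActionDensityOn p a b φ)
    (hab : a < b) (hpq : p.HolderConjugate q) {μ : ℝ → SignedRadon d} {ν : ℝ → VectorRadon d}
    (h : IsCEFlow a b φ γ μ ν) : ∃ (μ' : ℝ → SignedRadon d) (ν' : ℝ → VectorRadon d),
      IsCEFlow a b φ γ μ' ν' ∧ μ' 0 = μ 1 ∧ μ' 1 = μ 0 ∧
      ∫⁻ t in Set.Ioo (0 : ℝ) 1, action φ γ (μ' t) (ν' t) ≤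
        ∫⁻ t in Set.Ioo (0 : ℝ) 1, action φ γ (μ t) (ν t) := by
  have hc : (-1 : ℝ) ≠ 0 := by norm_num
  set μ' : ℝ → SignedRadon d := fun t => μ ((t - 1) / -1) with hμ'
  set ν' : ℝ → VectorRadon d := fun t => VectorRadon.scale (-1)⁻¹ (ν ((t - 1) / -1)) with hν'
  have hmem : ∀ t : ℝ, (t - 1) / -1 = 1 - t := fun t => by ring
  have hm : Measurable fun t : ℝ => (t - 1) / -1 := by fun_prop
  have henergy : ∫⁻ t in Set.Ioo (0 : ℝ) 1, action φ γ (μ' t) (ν' t) ≤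
      ∫⁻ t in Set.Ioo (0 : ℝ) 1, action φ γ (μ t) (ν t) := by
    have := hφ.lintegral_action_affine (γ := γ) hab hpq.lt μ ν 1 hc (I := Set.Ioo 0 1)
      (fun t ht => by rw [hmem]; exact ⟨by linarith [ht.2], by linarith [ht.1]⟩) measurableSet_Ioo
    rw [abs_neg, abs_one, Real.one_rpow, ENNReal.ofReal_one, one_mul] at this
    exact this
  have hflow : IsFlow a b φ γ μ' ν' :=
    { between := fun t ht => by
        simp only [hμ', hmem]
        exact h.between _ ⟨by linarith [ht.2], by linarith [ht.1]⟩
      measurable_mu := fun f hf hf' => (h.measurable_mu f hf hf').comp hm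
      measurable_nu := fun i B hB hB' => by
        simp only [hν', VectorRadon.scale, SignedRadon.eval_scale _ _ hB']
        exact ((h.measurable_nu i B hB hB').comp hm).const_mul _
      energy := henergy.trans_lt h.energy }
  refine ⟨μ', ν', ⟨hflow, fun ζ R hζ t ht => ?_⟩, ?_, ?_, henergy⟩
  · have hint : IntervalIntegrable (fun s => ceRate (μ' s) (ν' s) ζ s) volume 0 1 := by
      rw [intervalIntegrable_iff_integrableOn_Ioo_of_le zero_le_one]
      exact hflow.integrableOn_rate hφ hab hpq hζ
    -- With `s₀ = 1` and `c = -1` the affine identity always starts at time `1`; the identity on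
    -- `[0, t]` is the difference of those from `1` to `t` and from `1` to `0`.
    have e1 := h.eqn_affine 1 hc hζ (s := 1 - t) ⟨by linarith [ht.2], by linarith [ht.1]⟩
    have e2 := h.eqn_affine 1 hc hζ (s := 1) ⟨zero_le_one, le_rfl⟩
    rw [show (1 : ℝ) + -1 * (1 - t) = t by ring] at e1
    rw [show (1 : ℝ) + -1 * 1 = 0 by ring] at e2
    have e3 := intervalIntegral.integral_add_adjacent_intervals hint.symm
      (hint.mono_set (c := 0) (d := t) (by
        rw [Set.uIcc_of_le zero_le_one, Set.uIcc_of_le ht.1]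
        exact Set.Icc_subset_Icc_right ht.2))
    have e4 : (μ' t).integral (fun x => ζ (x, t)) = (μ (1 - t)).integral fun x => ζ (x, t) := by
      simp only [hμ', hmem]
    have e5 : (μ' 0).integral (fun x => ζ (x, 0)) = (μ 1).integral fun x => ζ (x, 0) := by
      simp only [hμ', hmem, sub_zero]
    rw [e4, e5]
    simp only [hμ', hν'] at e3 ⊢
    linarith
  · simp [hμ']
  · simp [hμ']

end Affine

/-! ### Concatenation of countably many flows -/

section Gluing

/-- The partition of `[0, 1)` into consecutive intervals of lengths proportional to `A k`. -/
noncomputable def partTime (A : ℕ → ℝ) (k : ℕ) : ℝ := (∑ j ∈ Finset.range k, A j) / ∑' j, A j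

variable {A : ℕ → ℝ}

theorem partTime_zero : partTime A 0 = 0 := by simp [partTime]

theorem partTime_succ (A : ℕ → ℝ) (k : ℕ) :
    partTime A (k + 1) = partTime A k + A k / ∑' j, A j := by
  rw [partTime, partTime, Finset.sum_range_succ, add_div]

theorem tsum_pos_of_pos (hA : ∀ k, 0 < A k) (hs : Summable A) : 0 < ∑' j, A j :=
  hs.tsum_pos (fun k => (hA k).le) 0 (hA 0)

theorem partTime_strictMono (hA : ∀ k, 0 < A k) (hs : Summable A) : StrictMono (partTime A) := by
  refine strictMono_nat_of_lt_succ fun k => ?_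
  rw [partTime_succ]
  linarith [div_pos (hA k) (tsum_pos_of_pos hA hs)]

theorem tendsto_partTime (hA : ∀ k, 0 < A k) (hs : Summable A) :
    Tendsto (partTime A) atTop (𝓝 1) := by
  have := hs.hasSum.tendsto_sum_nat.div_const (∑' j, A j)
  rwa [div_self (tsum_pos_of_pos hA hs).ne'] at this

theorem partTime_lt_one (hA : ∀ k, 0 < A k) (hs : Summable A) (k : ℕ) : partTime A k < 1 :=
  (partTime_strictMono hA hs (Nat.lt_succ_self k)).trans_le
    ((partTime_strictMono hA hs).monotone.ge_of_tendsto (tendsto_partTime hA hs) _)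

/-- The alternative `1 ≤ t` makes the search for an index succeed at every real time; negative times
and times past `1` get index `0`. -/
theorem exists_partIndex (hA : ∀ k, 0 < A k) (hs : Summable A) (t : ℝ) :
    ∃ k, t < partTime A (k + 1) ∨ 1 ≤ t := by
  rcases lt_or_ge t 1 with h | h
  · obtain ⟨N, hN⟩ := ((tendsto_partTime hA hs).eventually (Ioi_mem_nhds h)).exists
    exact ⟨N, Or.inl ((show t < partTime A N from hN).trans
      (partTime_strictMono hA hs (Nat.lt_succ_self N)))⟩
  · exact ⟨0, Or.inr h⟩

open Classical in
/-- The index of the interval of the partition that contains a given time. -/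
noncomputable def partIndex (hA : ∀ k, 0 < A k) (hs : Summable A) (t : ℝ) : ℕ :=
  Nat.find (exists_partIndex hA hs t)

theorem measurable_partIndex (hA : ∀ k, 0 < A k) (hs : Summable A) :
    Measurable (partIndex hA hs) := by
  classical
  refine measurable_find (exists_partIndex hA hs) fun k => ?_
  exact (measurableSet_lt measurable_id measurable_const).union
    (measurableSet_le measurable_const measurable_id)

theorem partIndex_eq (hA : ∀ k, 0 < A k) (hs : Summable A) {k : ℕ} {t : ℝ}
    (h1 : partTime A k ≤ t) (h2 : t < partTime A (k + 1)) : partIndex hA hs t = k := by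
  classical
  refine (Nat.find_eq_iff _).2 ⟨Or.inl h2, fun n hn => ?_⟩
  rw [not_or, not_lt, not_le]
  exact ⟨((partTime_strictMono hA hs).monotone hn).trans h1, h2.trans (partTime_lt_one hA hs _)⟩

theorem partIndex_mem (hA : ∀ k, 0 < A k) (hs : Summable A) {t : ℝ} (h0 : 0 ≤ t) (h1 : t < 1) :
    partTime A (partIndex hA hs t) ≤ t ∧ t < partTime A (partIndex hA hs t + 1) := by
  classical
  refine ⟨?_, (Nat.find_spec (exists_partIndex hA hs t)).resolve_right (not_le.2 h1)⟩
  rcases hk : partIndex hA hs t with _ | n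
  · rwa [partTime_zero]
  · have := Nat.find_min (exists_partIndex hA hs t) (m := n)
      (by change n < partIndex hA hs t; rw [hk]; exact Nat.lt_succ_self n)
    rw [not_or, not_lt] at this
    exact this.1

theorem measurable_select {f : ℕ → ℝ → ℝ} (hf : ∀ k, Measurable (f k)) {I : ℝ → ℕ}
    (hI : Measurable I) : Measurable fun t => f (I t) t :=
  (measurable_from_prod_countable_right (f := fun z : ℕ × ℝ => f z.1 z.2) hf).comp
    (hI.prodMk measurable_id)

variable {d : ℕ} {p q a b : ℝ} {φ : ℝ → Eucl d → ℝ≥0∞} {γ : Measure (Eucl d)}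
  [IsLocallyFiniteMeasure γ]

/-- Concatenation of countably many flows with summable lengths. -/
theorem modifiedW_le_of_chain (hφ : IsActionDensityOn p a b φ) (hab : a < b)
    (hpq : p.HolderConjugate q) {M : ℕ → ℝ → SignedRadon d} {N : ℕ → ℝ → VectorRadon d}
    (hM : ∀ k, IsCEFlow a b φ γ (M k) (N k)) (hjoin : ∀ k, M k 1 = M (k + 1) 0)
    (hA : ∀ k, 0 < A k) (hs : Summable A)
    (hE : ∀ k, ∫⁻ t in Set.Ioo (0 : ℝ) 1, action φ γ (M k t) (N k t) ≤ ENNReal.ofReal (A k ^ p))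
    {v : SignedRadon d} (hv : SignedRadon.Between a b γ v)
    (hlim : ∀ f : Eucl d → ℝ, Continuous f → HasCompactSupport f →
      Tendsto (fun k => (M k 0).integral f) atTop (𝓝 (v.integral f))) :
    modifiedW p φ γ (M 0 0) v ≤ ENNReal.ofReal (∑' k, A k) := by
  have hp0 : 0 < p := hpq.pos
  set S := ∑' k, A k with hS
  have hS0 : 0 < S := tsum_pos_of_pos hA hs
  set T := partTime A with hT
  have hTm := partTime_strictMono hA hs
  have hT1 := partTime_lt_one hA hs
  have hT0 : ∀ k, 0 ≤ T k := fun k => by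
    rw [← partTime_zero (A := A)]; exact hTm.monotone (Nat.zero_le k)
  -- With these lengths the energy of piece `k` is at most `c k ^ (1 - p) * A k ^ p = S ^ (p - 1) *
  -- A k`, and these bounds add up to `S ^ p`.
  set c : ℕ → ℝ := fun k => A k / S with hc
  have hc0 : ∀ k, 0 < c k := fun k => div_pos (hA k) hS0
  have hTs : ∀ k, T (k + 1) = T k + c k := partTime_succ A
  set I := partIndex hA hs with hI
  have hIm : Measurable I := measurable_partIndex hA hs
  set X : ℕ → ℝ → SignedRadon d := fun k t => M k ((t - T k) / c k) with hX
  set Y : ℕ → ℝ → VectorRadon d := fun k t =>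
    VectorRadon.scale (c k)⁻¹ (N k ((t - T k) / c k)) with hY
  -- No piece reaches time `1`; the weak* limit is inserted there.
  set μ : ℝ → SignedRadon d := fun t => if t < 1 then X (I t) t else v with hμ
  set ν : ℝ → VectorRadon d := fun t => Y (I t) t with hν
  have hpt : ∀ k t, T k ≤ t → t < T (k + 1) → μ t = X k t ∧ ν t = Y k t := by
    intro k t h1 h2
    have h3 : I t = k := partIndex_eq hA hs h1 h2
    simp only [hμ, hν, h3, if_pos (h2.trans (hT1 _)), and_self]
  have hθm : ∀ k, Measurable fun t : ℝ => (t - T k) / c k := fun k => by fun_prop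
  have hunit : ∀ k t, T k ≤ t → t ≤ T (k + 1) → (t - T k) / c k ∈ Set.Icc (0 : ℝ) 1 := by
    intro k t h1 h2
    rw [hTs] at h2
    exact ⟨div_nonneg (by linarith) (hc0 k).le, by rw [div_le_one (hc0 k)]; linarith⟩
  have hbtw : ∀ t ∈ Set.Icc (0 : ℝ) 1, SignedRadon.Between a b γ (μ t) := by
    intro t ht
    rcases lt_or_ge t 1 with h | h
    · obtain ⟨h1, h2⟩ := partIndex_mem hA hs ht.1 h
      simp only [hμ, if_pos h]
      exact (hM _).between _ (hunit _ t h1 h2.le)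
    · simp only [hμ, if_neg (not_lt.2 h)]
      exact hv
  have henergy : ∫⁻ t in Set.Ioo (0 : ℝ) 1, action φ γ (μ t) (ν t) ≤ ENNReal.ofReal (S ^ p) := by
    have hcover : Set.Ioo (0 : ℝ) 1 ⊆ ⋃ k, Set.Ico (T k) (T (k + 1)) := fun t ht =>
      Set.mem_iUnion.2 ⟨I t, partIndex_mem hA hs ht.1.le ht.2⟩
    have hpiece : ∀ k, ∫⁻ t in Set.Ico (T k) (T (k + 1)), action φ γ (μ t) (ν t) ≤
        ENNReal.ofReal (S ^ (p - 1) * A k) := by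
      intro k
      rw [setLIntegral_congr Ioo_ae_eq_Ico.symm]
      have h1 : ∫⁻ t in Set.Ioo (T k) (T (k + 1)), action φ γ (μ t) (ν t) =
          ∫⁻ t in Set.Ioo (T k) (T (k + 1)), action φ γ (X k t) (Y k t) :=
        setLIntegral_congr_fun measurableSet_Ioo fun t ht => by
          rw [(hpt k t ht.1.le ht.2).1, (hpt k t ht.1.le ht.2).2]
      rw [h1]
      refine (hφ.lintegral_action_affine hab hpq.lt (M k) (N k) (T k) (hc0 k).ne'
        (fun t ht => ?_) measurableSet_Ioo).trans ?_
      · have h2 := ht.2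
        rw [hTs] at h2
        exact ⟨div_pos (by linarith [ht.1]) (hc0 k), by rw [div_lt_one (hc0 k)]; linarith⟩
      · refine (mul_le_mul' le_rfl (hE k)).trans ?_
        rw [← ENNReal.ofReal_mul (by positivity), abs_of_pos (hc0 k)]
        refine ENNReal.ofReal_le_ofReal (le_of_eq ?_)
        have hA0 := (hA k).le
        simp only [hc]
        rw [Real.div_rpow hA0 hS0.le, div_mul_eq_mul_div, ← Real.rpow_add (hA k),
          sub_add_cancel, Real.rpow_one, div_eq_mul_inv, ← Real.rpow_neg hS0.le, neg_sub, mul_comm]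
    calc ∫⁻ t in Set.Ioo (0 : ℝ) 1, action φ γ (μ t) (ν t)
        ≤ ∫⁻ t in ⋃ k, Set.Ico (T k) (T (k + 1)), action φ γ (μ t) (ν t) :=
          lintegral_mono_set hcover
      _ ≤ ∑' k, ∫⁻ t in Set.Ico (T k) (T (k + 1)), action φ γ (μ t) (ν t) :=
          lintegral_iUnion_le _ _
      _ ≤ ∑' k, ENNReal.ofReal (S ^ (p - 1) * A k) := ENNReal.tsum_le_tsum hpiece
      _ = ENNReal.ofReal (S ^ p) := by
          rw [← ENNReal.ofReal_tsum_of_nonneg (fun k => mul_nonneg (by positivity) (hA k).le)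
            (hs.mul_left _), tsum_mul_left, ← hS, ← Real.rpow_add_one hS0.ne', sub_add_cancel]
  have hmμ : ∀ f : Eucl d → ℝ, Continuous f → HasCompactSupport f →
      Measurable fun t => (μ t).integral f := by
    intro f hf hf'
    have h2 : Measurable fun t => if t < 1 then (X (I t) t).integral f else v.integral f :=
      Measurable.ite (measurableSet_lt measurable_id measurable_const)
        (measurable_select (f := fun k t => (X k t).integral f)
          (fun k => ((hM k).measurable_mu f hf hf').comp (hθm k)) hIm) measurable_const
    have h3 : (fun t => (μ t).integral f) =
        fun t => if t < 1 then (X (I t) t).integral f else v.integral f := by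
      funext t
      simp only [hμ]
      split_ifs <;> rfl
    rw [h3]
    exact h2
  have hmν : ∀ (i : Fin d) (B : Set (Eucl d)), MeasurableSet B → Bornology.IsBounded B →
      Measurable fun t => (ν t i).eval B := by
    intro i B hB hB'
    refine measurable_select (f := fun k t => (Y k t i).eval B) (fun k => ?_) hIm
    simp only [hY, VectorRadon.scale, SignedRadon.eval_scale _ _ hB']
    exact (((hM k).measurable_nu i B hB hB').comp (hθm k)).const_mul _
  have hflow : IsFlow a b φ γ μ ν :=
    { between := hbtw
      measurable_mu := hmμ
      measurable_nu := hmν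
      energy := henergy.trans_lt ENNReal.ofReal_lt_top }
  have hμ0 : μ 0 = M 0 0 := by
    rw [(hpt 0 0 (hT0 0 |>.antisymm (by rw [hT, partTime_zero]) |>.ge)
      ((hT0 0).trans_lt (hTm (Nat.lt_succ_self 0)))).1]
    simp [hX, hT, partTime_zero]
  have hμ1 : μ 1 = v := by simp [hμ]
  have hce : IsCEFlow a b φ γ μ ν := by
    refine ⟨hflow, fun ζ R hζ => ?_⟩
    set H : ℝ → ℝ := fun s => ceRate (μ s) (ν s) ζ s with hH
    have hint : IntegrableOn H (Set.Icc 0 1) := by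
      rw [integrableOn_Icc_iff_integrableOn_Ioo]
      exact hflow.integrableOn_rate hφ hab hpq hζ
    have hII : ∀ s t, s ∈ Set.Icc (0 : ℝ) 1 → t ∈ Set.Icc (0 : ℝ) 1 →
        IntervalIntegrable H volume s t := fun s t hs ht =>
      (hint.mono_set (Set.uIcc_subset_Icc hs ht)).intervalIntegrable
    have hTI : ∀ k, T k ∈ Set.Icc (0 : ℝ) 1 := fun k => ⟨hT0 k, (hT1 k).le⟩
    have hstep : ∀ k t, T k ≤ t → t ≤ T (k + 1) →
        (M k ((t - T k) / c k)).integral (fun x => ζ (x, t)) -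
          (M k 0).integral (fun x => ζ (x, T k)) = ∫ s in T k..t, H s := by
      intro k t h1 h2
      have h3 := (hM k).eqn_affine (T k) (hc0 k).ne' hζ (hunit k t h1 h2)
      rw [show T k + c k * ((t - T k) / c k) = t by
        rw [mul_div_cancel₀ _ (hc0 k).ne']; ring] at h3
      rw [h3]
      -- At the right endpoint the glued curve already follows the next piece, so the integrands are
      -- compared off that single point.
      refine intervalIntegral.integral_congr_ae ?_
      filter_upwards [compl_mem_ae_iff.2 (measure_singleton (T (k + 1)))] with s hs hs'
      rw [Set.uIoc_of_le h1] at hs'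
      have h4 : s < T (k + 1) := lt_of_le_of_ne (hs'.2.trans h2) hs
      simp only [hH]
      rw [(hpt k s hs'.1.le h4).1, (hpt k s hs'.1.le h4).2]
    have hnode : ∀ k, (M k 0).integral (fun x => ζ (x, T k)) -
        (μ 0).integral (fun x => ζ (x, 0)) = ∫ s in (0 : ℝ)..T k, H s := by
      intro k
      induction k with
      | zero => simp [hT, partTime_zero, hμ0]
      | succ k ih =>
        have h1 := hstep k (T (k + 1)) (hTm (Nat.lt_succ_self k)).le le_rfl
        have h2 : (T (k + 1) - T k) / c k = 1 := by
          rw [hTs, add_sub_cancel_left, div_self (hc0 k).ne']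
        rw [h2, hjoin] at h1
        rw [← intervalIntegral.integral_add_adjacent_intervals (hII 0 (T k) ⟨le_rfl, zero_le_one⟩
          (hTI k)) (hII _ _ (hTI k) (hTI (k + 1))), ← ih, ← h1]
        ring
    intro t ht
    rcases lt_or_ge t 1 with h | h
    · obtain ⟨h1, h2⟩ := partIndex_mem hA hs ht.1 h
      have h3 := hstep (I t) t h1 h2.le
      have h4 := hnode (I t)
      rw [← intervalIntegral.integral_add_adjacent_intervals (hII 0 (T (I t)) ⟨le_rfl, zero_le_one⟩
          (hTI _)) (hII _ _ (hTI _) ht), ← h3, ← h4]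
      simp only [hμ, if_pos h, hX]
      ring
    · obtain rfl : t = 1 := le_antisymm ht.2 h
      rw [hμ1]
      -- At time `1` the identity is the limit of `hnode`: the left side converges by weak*
      -- convergence to `v`, the right side by integrability of the rate.
      have hTl : Tendsto T atTop (𝓝 1) := tendsto_partTime hA hs
      have hcz : Continuous fun x => ζ (x, 1) := by
        have := hζ.contDiff.continuous
        fun_prop
      have l1 := (SignedRadon.tendsto_integral_param (κ := fun k => M k 0) (γ := γ)
        (Eventually.of_forall fun k => (hM k).between 0 ⟨le_rfl, zero_le_one⟩) hTl
        hζ.contDiff.continuous hζ.zero (hlim _ hcz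
          (SignedRadon.hasCompactSupport_of_norm fun x => hζ.zero x 1))).sub_const
          ((μ 0).integral fun x => ζ (x, 0))
      have hprim := intervalIntegral.continuousOn_primitive_interval (a := (0 : ℝ)) (b := 1)
        (f := H) (μ := volume) (by rwa [Set.uIcc_of_le zero_le_one])
      rw [Set.uIcc_of_le zero_le_one] at hprim
      have l2 := (hprim 1 ⟨zero_le_one, le_rfl⟩).tendsto.comp
        (tendsto_nhdsWithin_iff.2 ⟨hTl, Eventually.of_forall hTI⟩)
      exact tendsto_nhds_unique l1 (l2.congr fun k => (hnode k).symm)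
  have hfin := hce.modifiedW_le hφ hab hpq
  rw [hμ0, hμ1] at hfin
  refine hfin.trans ((ENNReal.rpow_le_rpow henergy (by positivity)).trans (le_of_eq ?_))
  rw [ENNReal.ofReal_rpow_of_nonneg (by positivity) (by positivity), ← Real.rpow_mul hS0.le,
    mul_one_div_cancel hp0.ne', Real.rpow_one]

end Gluing

/-! ### Metric properties and completeness -/

section Distance

variable {d : ℕ} {p q a b : ℝ} {φ : ℝ → Eucl d → ℝ≥0∞} {γ : Measure (Eucl d)}
  [IsLocallyFiniteMeasure γ]

theorem hasDerivAt_integral_test {ζ : Eucl d × ℝ → ℝ} {R : ℝ} (hζ : IsTest ζ R)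
    (m : Measure (Eucl d)) [IsLocallyFiniteMeasure m] (t : ℝ) :
    HasDerivAt (fun s => ∫ x, ζ (x, s) ∂m) (∫ x, timeDeriv ζ (x, t) ∂m) t := by
  have hct : ∀ s, Continuous fun x => timeDeriv ζ (x, s) := fun s => by
    have := continuous_timeDeriv hζ.contDiff
    fun_prop
  have hcz : ∀ s, Continuous fun x => ζ (x, s) := fun s => by
    have := hζ.contDiff.continuous
    fun_prop
  -- The time interval `[t - 1, t + 1]` is rescaled to `[0, 1]`, where `exists_bound_of_radius`
  -- applies.
  have hg : Continuous fun z : Eucl d × ℝ => timeDeriv ζ (z.1, t - 1 + 2 * z.2) := by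
    have := continuous_timeDeriv hζ.contDiff
    fun_prop
  obtain ⟨M, hM0, hM⟩ := exists_bound_of_radius hg
    (fun x s hx => hζ.timeDeriv_zero x (t - 1 + 2 * s) hx)
  refine (hasDerivAt_integral_of_dominated_loc_of_deriv_le (F := fun s x => ζ (x, s))
    (F' := fun s x => timeDeriv ζ (x, s)) (Ioo_mem_nhds (sub_one_lt t) (lt_add_one t))
    (Eventually.of_forall fun s => (hcz s).aestronglyMeasurable)
    ((hcz t).integrable_of_hasCompactSupport
      (SignedRadon.hasCompactSupport_of_norm fun x => hζ.zero x t))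
    (hct t).aestronglyMeasurable
    (bound := (Metric.ball (0 : Eucl d) (R + 1)).indicator fun _ => M)
    (ae_of_all _ fun x s hs => ?_) ?_ (ae_of_all _ fun x s _ => ?_)).2
  · by_cases hx : x ∈ Metric.ball (0 : Eucl d) (R + 1)
    · rw [Set.indicator_of_mem hx]
      have := hM x ((s - (t - 1)) / 2) ⟨by linarith [hs.1], by linarith [hs.2]⟩
      rwa [mul_div_cancel₀ _ two_ne_zero, add_sub_cancel] at this
    · rw [Set.indicator_of_notMem hx, hζ.timeDeriv_zero x s (by simpa using hx), norm_zero]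
  · refine (integrable_indicator_iff Metric.isOpen_ball.measurableSet).2
      (integrableOn_const (measure_lt_top_of_isBounded _ Metric.isBounded_ball).ne)
  · rw [← deriv_eq_timeDeriv hζ.contDiff]
    have : Differentiable ℝ fun s : ℝ => ζ (x, s) :=
      (hζ.contDiff.differentiable one_ne_zero).comp
        ((differentiable_const x).prodMk differentiable_id)
    exact (this s).hasDerivAt

theorem SignedRadon.Between.isCEFlow_const (hφ : IsActionDensityOn p a b φ) (hab : a < b)
    {μ : SignedRadon d} (h : SignedRadon.Between a b γ μ) :
    IsCEFlow a b φ γ (fun _ => μ) (fun _ _ => SignedRadon.null d) where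
  between _ _ := h
  measurable_mu _ _ _ := measurable_const
  measurable_nu _ _ _ _ := measurable_const
  energy := by simp [hφ.action_null hab h]
  eqn ζ R hζ t _ := by
    have hnull : ∀ f : Eucl d → ℝ, (SignedRadon.null d).integral f = 0 := fun f => by
      simp [SignedRadon.integral, SignedRadon.null]
    simp only [ceRate, hnull, Finset.sum_const_zero, add_zero]
    have hder : ∀ s, HasDerivAt (fun s => μ.integral fun x => ζ (x, s))
        (μ.integral fun x => timeDeriv ζ (x, s)) s := fun s =>
      (hasDerivAt_integral_test hζ μ.pos s).sub (hasDerivAt_integral_test hζ μ.neg s)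
    have hcont := SignedRadon.continuous_integral_param (continuous_timeDeriv hζ.contDiff)
      hζ.timeDeriv_zero μ
    exact (intervalIntegral.integral_eq_sub_of_hasDerivAt (fun s _ => hder s)
      (hcont.intervalIntegrable _ _)).symm

theorem SignedRadon.Between.modifiedW_self (hφ : IsActionDensityOn p a b φ) (hab : a < b)
    (hpq : p.HolderConjugate q) {μ : SignedRadon d} (h : SignedRadon.Between a b γ μ) :
    modifiedW p φ γ μ μ = 0 := by
  have h1 := (h.isCEFlow_const hφ hab).modifiedW_le hφ hab hpq
  have hp : 0 < p := hpq.pos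
  simp only [hφ.action_null hab h, lintegral_zero] at h1
  rw [ENNReal.zero_rpow_of_pos (by positivity)] at h1
  exact le_antisymm h1 zero_le

namespace IsActionDensityOn

theorem between_of_modifiedW_lt_top (hφ : IsActionDensityOn p a b φ) (hab : a < b)
    (hpq : p.HolderConjugate q) {μ₀ μ₁ : SignedRadon d} (h : modifiedW p φ γ μ₀ μ₁ < ∞) :
    SignedRadon.Between a b γ μ₀ ∧ SignedRadon.Between a b γ μ₁ := by
  obtain ⟨μ, ν, hf, h0, h1, -⟩ := exists_isCEFlow_of_modifiedW_lt hφ hab hpq h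
  exact ⟨h0 ▸ hf.between 0 ⟨le_rfl, zero_le_one⟩, h1 ▸ hf.between 1 ⟨zero_le_one, le_rfl⟩⟩

theorem modifiedW_comm_le (hφ : IsActionDensityOn p a b φ) (hab : a < b)
    (hpq : p.HolderConjugate q) (μ₀ μ₁ : SignedRadon d) :
    modifiedW p φ γ μ₁ μ₀ ≤ modifiedW p φ γ μ₀ μ₁ := by
  refine le_of_forall_gt_imp_ge_of_dense fun A hA => ?_
  obtain ⟨μ, ν, hf, h0, h1, hlt⟩ := exists_isCEFlow_of_modifiedW_lt hφ hab hpq hA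
  obtain ⟨μ', ν', hf', h0', h1', hle⟩ := hf.reverse hφ hab hpq
  have h2 := hf'.modifiedW_le hφ hab hpq
  have hp : 0 < p := hpq.pos
  rw [h0', h1', h0, h1] at h2
  exact h2.trans ((ENNReal.rpow_le_rpow hle (by positivity)).trans hlt.le)

theorem modifiedW_comm (hφ : IsActionDensityOn p a b φ) (hab : a < b)
    (hpq : p.HolderConjugate q) (μ₀ μ₁ : SignedRadon d) :
    modifiedW p φ γ μ₀ μ₁ = modifiedW p φ γ μ₁ μ₀ :=
  le_antisymm (hφ.modifiedW_comm_le hab hpq μ₁ μ₀) (hφ.modifiedW_comm_le hab hpq μ₀ μ₁)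

/-- Essential here is that `C` is chosen before `f`: the mass argument uses functions `f` whose
supports grow while the bounds `K i` shrink. -/
theorem exists_modifiedW_estimate (hφ : IsActionDensityOn p a b φ) (hab : a < b)
    (hpq : p.HolderConjugate q) : ∃ C : ℝ, 0 < C ∧ ∀ f : Eucl d → ℝ, ContDiff ℝ 1 f →
      HasCompactSupport f → ∀ K : Fin d → ℝ≥0∞, (∀ i, K i ≠ 0) → (∀ i, K i ≠ ∞) →
      (∀ i, (∫⁻ x, ‖fderiv ℝ f x (EuclideanSpace.single i 1)‖ₑ ^ q ∂γ) ^ (1 / q) ≤ K i) →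
      ∀ (μ₀ μ₁ : SignedRadon d) (A : ℝ≥0∞), modifiedW p φ γ μ₀ μ₁ < A →
        ‖μ₁.integral f - μ₀.integral f‖ₑ ≤ (∑ i, K i) * (ENNReal.ofReal C ^ (1 / p) * A) := by
  obtain ⟨C, hC, hest⟩ := hφ.exists_energy_estimate (γ := γ) hab hpq
  have hp : 0 < p := hpq.pos
  refine ⟨C, hC, fun f hf hf' K hK hK' hfK μ₀ μ₁ A hA => ?_⟩
  obtain ⟨μ, ν, hflow, h0, h1, hlt⟩ := exists_isCEFlow_of_modifiedW_lt hφ hab hpq hA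
  have := hest μ ν hflow f hf hf' K hK hK' hfK 1 ⟨zero_le_one, le_rfl⟩
  rw [h0, h1, ENNReal.mul_rpow_of_nonneg _ _ (by positivity)] at this
  exact this.trans (mul_le_mul' le_rfl (mul_le_mul' le_rfl hlt.le))

theorem lintegral_rpow_lt_top {g : Eucl d → ℝ} (hg : Continuous g) (hg' : HasCompactSupport g)
    (hq : 0 < q) : ∫⁻ x, ‖g x‖ₑ ^ q ∂γ < ∞ := by
  obtain ⟨R, -, hR⟩ := SignedRadon.exists_radius hg'
  obtain ⟨c, hc⟩ := hg'.exists_bound_of_continuous hg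
  have hle : ∫⁻ x, ‖g x‖ₑ ^ q ∂γ ≤ ENNReal.ofReal c ^ q * γ (Metric.ball 0 R) := by
    rw [← lintegral_indicator_const Metric.isOpen_ball.measurableSet]
    refine lintegral_mono fun x => ?_
    by_cases hx : x ∈ Metric.ball (0 : Eucl d) R
    · rw [Set.indicator_of_mem hx, ← ofReal_norm]
      exact ENNReal.rpow_le_rpow (ENNReal.ofReal_le_ofReal (hc x)) hq.le
    · beta_reduce
      rw [hR x (by simpa using hx), enorm_zero, ENNReal.zero_rpow_of_pos hq]
      simp
  exact hle.trans_lt (ENNReal.mul_lt_top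
    (ENNReal.rpow_lt_top_of_nonneg hq.le ENNReal.ofReal_ne_top)
    (measure_lt_top_of_isBounded _ Metric.isBounded_ball))

/-- The version for one fixed test function, which serves for uniqueness and for weak* Cauchy
sequences. -/
theorem exists_lipschitz_estimate (hφ : IsActionDensityOn p a b φ) (hab : a < b)
    (hpq : p.HolderConjugate q) {f : Eucl d → ℝ} (hf : ContDiff ℝ 1 f)
    (hf' : HasCompactSupport f) : ∃ L : ℝ, 0 ≤ L ∧ ∀ (μ₀ μ₁ : SignedRadon d) (A : ℝ), 0 ≤ A →
      modifiedW p φ γ μ₀ μ₁ < ENNReal.ofReal A → |μ₁.integral f - μ₀.integral f| ≤ L * A := by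
  obtain ⟨C, hC, hest⟩ := hφ.exists_modifiedW_estimate (γ := γ) hab hpq
  have hq : 0 < q := hpq.symm.pos
  set K : Fin d → ℝ≥0∞ := fun i =>
    (∫⁻ x, ‖fderiv ℝ f x (EuclideanSpace.single i 1)‖ₑ ^ q ∂γ) ^ (1 / q) + 1
  have hK : ∀ i, K i ≠ ∞ := fun i => ENNReal.add_ne_top.2
    ⟨ENNReal.rpow_ne_top_of_nonneg (by positivity) (lintegral_rpow_lt_top
      ((hf.continuous_fderiv one_ne_zero).clm_apply continuous_const)
      (hf'.fderiv_apply ℝ _) hq).ne, by simp⟩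
  have hp : 0 < p := hpq.pos
  have hL : (∑ i, K i) * ENNReal.ofReal C ^ (1 / p) ≠ ∞ :=
    ENNReal.mul_ne_top (ENNReal.sum_ne_top.2 fun i _ => hK i)
      (ENNReal.rpow_ne_top_of_nonneg (by positivity) ENNReal.ofReal_ne_top)
  refine ⟨((∑ i, K i) * ENNReal.ofReal C ^ (1 / p)).toReal, ENNReal.toReal_nonneg,
    fun μ₀ μ₁ A hA0 hA => ?_⟩
  have := hest f hf hf' K (fun i => by simp [K]) hK (fun i => le_self_add) μ₀ μ₁ _ hA
  rw [← mul_assoc, ← ofReal_norm] at this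
  have h2 := ENNReal.toReal_mono (ENNReal.mul_ne_top hL ENNReal.ofReal_ne_top) this
  rwa [ENNReal.toReal_ofReal (norm_nonneg _), ENNReal.toReal_mul, ENNReal.toReal_ofReal hA0] at h2

theorem eq_of_modifiedW_eq_zero (hφ : IsActionDensityOn p a b φ) (hab : a < b)
    (hpq : p.HolderConjugate q) {μ₀ μ₁ : SignedRadon d} (h : modifiedW p φ γ μ₀ μ₁ = 0) :
    μ₀ = μ₁ := by
  refine SignedRadon.eq_of_integral_eq_contDiff fun f hf hf' => ?_
  obtain ⟨L, hL0, hL⟩ := hφ.exists_lipschitz_estimate (γ := γ) hab hpq hf hf'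
  refine eq_of_forall_dist_le fun ε hε => ?_
  have := hL μ₀ μ₁ (ε / (L + 1)) (by positivity) (by rw [h]; exact ENNReal.ofReal_pos.2 (by positivity))
  rw [dist_comm, Real.dist_eq]
  refine this.trans ?_
  rw [mul_div_assoc', div_le_iff₀ (by positivity)]
  nlinarith

/-- A chain of measures with summable consecutive distances converges. -/
theorem exists_chain_limit (hφ : IsActionDensityOn p a b φ) (hab : a < b)
    (hpq : p.HolderConjugate q) {v : ℕ → SignedRadon d} {A : ℕ → ℝ} (hA : ∀ k, 0 < A k)
    (hs : Summable A) (hv : ∀ k, modifiedW p φ γ (v k) (v (k + 1)) < ENNReal.ofReal (A k)) :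
    ∃ μ : SignedRadon d,
      (∀ f : Eucl d → ℝ, Continuous f → HasCompactSupport f →
        Tendsto (fun k => (v k).integral f) atTop (𝓝 (μ.integral f))) ∧
      ∀ n, modifiedW p φ γ (v n) μ ≤ ENNReal.ofReal (∑' k, A (k + n)) := by
  have hp : 0 < p := hpq.pos
  choose M N hM h0 h1 hE using fun k => exists_isCEFlow_of_modifiedW_lt hφ hab hpq (hv k)
  have hb : ∀ k, SignedRadon.Between a b γ (v k) := fun k =>
    h0 k ▸ (hM k).between 0 ⟨le_rfl, zero_le_one⟩
  obtain ⟨μ, hμ, hlim⟩ := SignedRadon.Between.exists_limit hb fun f hf hf' => by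
    obtain ⟨L, -, hL⟩ := hφ.exists_lipschitz_estimate (γ := γ) hab hpq hf hf'
    refine cauchySeq_of_dist_le_of_summable (fun k => L * A k) (fun k => ?_) (hs.mul_left L)
    rw [dist_comm, Real.dist_eq]
    exact hL _ _ _ (hA k).le (hv k)
  refine ⟨μ, hlim, fun n => ?_⟩
  have hE' : ∀ k, ∫⁻ t in Set.Ioo (0 : ℝ) 1, action φ γ (M k t) (N k t) ≤
      ENNReal.ofReal (A k ^ p) := by
    intro k
    have := ENNReal.rpow_le_rpow (hE k).le hp.le
    rwa [← ENNReal.rpow_mul, one_div_mul_cancel hp.ne', ENNReal.rpow_one,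
      ENNReal.ofReal_rpow_of_nonneg (hA k).le hp.le] at this
  -- The tail of the chain from index `n` has the same weak* limit, and its length is the tail of
  -- the series.
  have := modifiedW_le_of_chain hφ hab hpq (M := fun k => M (k + n)) (N := fun k => N (k + n))
    (A := fun k => A (k + n)) (fun k => hM _) (fun k => by rw [h1, h0]; congr 1; ring)
    (fun k => hA _) ((summable_nat_add_iff n).2 hs) (fun k => hE' _) hμ fun f hf hf' => by
      simp only [h0]
      exact (hlim f hf hf').comp (tendsto_add_atTop_nat n)
  simp only [zero_add, h0] at this
  exact this

/-- A special case of infinite gluing: the chain `μ₀, μ₁, μ₂, μ₂, …` converges to `μ₂`, and its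
constant steps cost nothing because finite distance forces `μ₂` to lie between `a γ` and `b γ`. -/
theorem modifiedW_triangle (hφ : IsActionDensityOn p a b φ) (hab : a < b)
    (hpq : p.HolderConjugate q) (μ₀ μ₁ μ₂ : SignedRadon d) :
    modifiedW p φ γ μ₀ μ₂ ≤ modifiedW p φ γ μ₀ μ₁ + modifiedW p φ γ μ₁ μ₂ := by
  refine ENNReal.le_of_forall_pos_le_add fun ε hε hlt => ?_
  obtain ⟨hlt₁, hlt₂⟩ := ENNReal.add_lt_top.1 hlt
  have hb₂ := (hφ.between_of_modifiedW_lt_top hab hpq hlt₂).2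
  set A₁ := (modifiedW p φ γ μ₀ μ₁).toReal
  set A₂ := (modifiedW p φ γ μ₁ μ₂).toReal
  have hA₁ : 0 ≤ A₁ := ENNReal.toReal_nonneg
  have hA₂ : 0 ≤ A₂ := ENNReal.toReal_nonneg
  have hε' : (0 : ℝ) < ε := hε
  let v : ℕ → SignedRadon d := fun k => match k with
    | 0 => μ₀
    | 1 => μ₁
    | _ => μ₂
  -- The budget `ε` is spent as `ε / 4` on each of the first two steps and `ε / 2` on the geometric
  -- tail, whose terms must be positive.
  let A : ℕ → ℝ := fun k => match k with
    | 0 => A₁ + ε / 4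
    | 1 => A₂ + ε / 4
    | k + 2 => ε / 4 * (1 / 2) ^ k
  have hA : ∀ k, 0 < A k := fun k => match k with
    | 0 => by change 0 < A₁ + ε / 4; positivity
    | 1 => by change 0 < A₂ + ε / 4; positivity
    | k + 2 => by change (0 : ℝ) < ε / 4 * (1 / 2) ^ k; positivity
  have hs : Summable A := (summable_nat_add_iff 2).1 (summable_geometric_two.mul_left ((ε : ℝ) / 4))
  have hlt' : ∀ {x : ℝ≥0∞}, x < ∞ → x < ENNReal.ofReal (x.toReal + ε / 4) := fun {x} hx =>
    (ENNReal.lt_ofReal_iff_toReal_lt hx.ne).2 (by linarith)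
  have hv : ∀ k, modifiedW p φ γ (v k) (v (k + 1)) < ENNReal.ofReal (A k) := fun k => match k with
    | 0 => hlt' hlt₁
    | 1 => hlt' hlt₂
    | k + 2 => by
      change modifiedW p φ γ μ₂ μ₂ < _
      rw [hb₂.modifiedW_self hφ hab hpq]
      exact ENNReal.ofReal_pos.2 (hA (k + 2))
  obtain ⟨μ, hlim, hle⟩ := hφ.exists_chain_limit hab hpq hA hs hv
  have hμ : μ = μ₂ := by
    refine SignedRadon.eq_of_integral_eq fun f hf hf' => ?_
    exact tendsto_nhds_unique (hlim f hf hf')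
      ((tendsto_add_atTop_iff_nat 2).1 (tendsto_const_nhds (x := μ₂.integral f)))
  have h0 := hle 0
  rw [hμ] at h0
  have hsum : ∑' k, A (k + 0) = A₁ + A₂ + ε := by
    simp only [add_zero]
    rw [← hs.sum_add_tsum_nat_add 2, Finset.sum_range_succ, Finset.sum_range_one]
    change A₁ + ε / 4 + (A₂ + ε / 4) + ∑' k : ℕ, (ε : ℝ) / 4 * (1 / 2) ^ k = _
    rw [tsum_mul_left, tsum_geometric_two]
    ring
  rw [hsum, ENNReal.ofReal_add (by positivity) hε'.le, ENNReal.ofReal_add hA₁ hA₂,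
    ENNReal.ofReal_toReal hlt₁.ne, ENNReal.ofReal_toReal hlt₂.ne, ENNReal.ofReal_coe_nnreal] at h0
  exact h0

theorem exists_limit_of_cauchy (hφ : IsActionDensityOn p a b φ) (hab : a < b)
    (hpq : p.HolderConjugate q) (u : ℕ → SignedRadon d)
    (hu : ∀ ε : ℝ≥0∞, 0 < ε → ∃ N : ℕ, ∀ m n : ℕ, N ≤ m → N ≤ n →
      modifiedW p φ γ (u m) (u n) < ε) :
    ∃ μ : SignedRadon d, Tendsto (fun n => modifiedW p φ γ (u n) μ) atTop (𝓝 0) := by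
  set A : ℕ → ℝ := fun k => (1 / 2) ^ k with hAdef
  have hA : ∀ k, 0 < A k := fun k => by positivity
  choose N hN using fun k => hu (ENNReal.ofReal (A k)) (ENNReal.ofReal_pos.2 (hA k))
  -- Partial sums dominate every earlier threshold, so consecutive terms of the subsequence are
  -- within `A k`.
  set n : ℕ → ℕ := fun k => ∑ j ∈ Finset.range (k + 1), N j with hn
  have hnN : ∀ j k, j ≤ k → N j ≤ n k := fun j k hjk =>
    Finset.single_le_sum (fun _ _ => Nat.zero_le _) (Finset.mem_range.2 (Nat.lt_succ_of_le hjk))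
  obtain ⟨μ, -, hle⟩ := hφ.exists_chain_limit (v := fun k => u (n k)) hab hpq hA
    summable_geometric_two fun k => hN k _ _ (hnN k k le_rfl) (hnN k (k + 1) (Nat.le_succ k))
  refine ⟨μ, ENNReal.tendsto_atTop_zero.2 fun ε hε => ?_⟩
  have ht : Tendsto (fun k => ENNReal.ofReal (3 * A k)) atTop (𝓝 0) := by
    have h1 : Tendsto A atTop (𝓝 0) :=
      tendsto_pow_atTop_nhds_zero_of_lt_one (by norm_num) (by norm_num)
    have h2 := ENNReal.tendsto_ofReal (h1.const_mul 3)
    simpa using h2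
  obtain ⟨k, hk⟩ := (ht.eventually (Iic_mem_nhds hε)).exists
  refine ⟨n k, fun m hm => ?_⟩
  have hsum : ∑' j, A (j + k) = 2 * A k := by
    simp only [hAdef, pow_add]
    rw [tsum_mul_right, tsum_geometric_two]
  calc modifiedW p φ γ (u m) μ
      ≤ modifiedW p φ γ (u m) (u (n k)) + modifiedW p φ γ (u (n k)) μ :=
        hφ.modifiedW_triangle hab hpq _ _ _
    _ ≤ ENNReal.ofReal (A k) + ENNReal.ofReal (2 * A k) :=
        add_le_add (hN k _ _ ((hnN k k le_rfl).trans hm) (hnN k k le_rfl)).le (hsum ▸ hle k)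
    _ = ENNReal.ofReal (3 * A k) := by
        rw [← ENNReal.ofReal_add (hA k).le (by linarith [hA k])]
        congr 1
        ring
    _ ≤ ε := hk

theorem exists_metricSpace (hφ : IsActionDensityOn p a b φ) (hab : a < b)
    (hpq : p.HolderConjugate q) (σ : SignedRadon d) :
    ∃ _inst : MetricSpace (finiteComponent p φ γ σ),
      (∀ μ₀ μ₁ : finiteComponent p φ γ σ, edist μ₀ μ₁ = modifiedW p φ γ μ₀ μ₁) ∧
      CompleteSpace (finiteComponent p φ γ σ) := by
  let E : EMetricSpace (finiteComponent p φ γ σ) :=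
    { edist := fun μ₀ μ₁ => modifiedW p φ γ μ₀ μ₁
      -- Membership in the component puts `μ` between `a γ` and `b γ`; otherwise its distance to
      -- itself would be infinite.
      edist_self := fun μ => (hφ.between_of_modifiedW_lt_top hab hpq μ.2).1.modifiedW_self hφ hab hpq
      edist_comm := fun μ₀ μ₁ => hφ.modifiedW_comm hab hpq _ _
      edist_triangle := fun μ₀ μ₁ μ₂ => hφ.modifiedW_triangle hab hpq _ _ _
      eq_of_edist_eq_zero := fun h => Subtype.ext (hφ.eq_of_modifiedW_eq_zero hab hpq h) }
  have hfin : ∀ μ₀ μ₁ : finiteComponent p φ γ σ, edist μ₀ μ₁ ≠ ∞ := by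
    intro μ₀ μ₁
    refine ne_top_of_le_ne_top ?_ (hφ.modifiedW_triangle hab hpq (μ₀ : SignedRadon d) σ μ₁)
    rw [hφ.modifiedW_comm hab hpq σ]
    exact (ENNReal.add_lt_top.2 ⟨μ₀.2, μ₁.2⟩).ne
  refine ⟨E.toMetricSpace hfin, fun _ _ => rfl, ?_⟩
  refine EMetric.complete_of_cauchySeq_tendsto fun u hu => ?_
  obtain ⟨μ, hμ⟩ := hφ.exists_limit_of_cauchy (γ := γ) hab hpq (fun n => (u n : SignedRadon d))
    fun ε hε => by
      obtain ⟨N, hN⟩ := EMetric.cauchySeq_iff.1 hu ε hε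
      exact ⟨N, fun m n hm hn => hN m hm n hn⟩
  obtain ⟨n, hn⟩ := (hμ.eventually (Iio_mem_nhds ENNReal.zero_lt_top)).exists
  have hmem : μ ∈ finiteComponent p φ γ σ := by
    refine (hφ.modifiedW_triangle hab hpq μ (u n) σ).trans_lt (ENNReal.add_lt_top.2 ⟨?_, (u n).2⟩)
    rw [hφ.modifiedW_comm hab hpq]
    exact hn
  exact ⟨⟨μ, hmem⟩, tendsto_iff_edist_tendsto_0.2 hμ⟩

end IsActionDensityOn

end Distance

/-! ### Cutoffs and equality of the total mass -/

section TotalMass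

variable {d : ℕ}

namespace IsCutoff

variable {ζ : Eucl d → ℝ}

theorem exists_ball (hζ : IsCutoff ζ) : ∃ ε, 0 < ε ∧ ∀ x, ‖x‖ < ε → ζ x = 1 := by
  obtain ⟨ε, hε, h⟩ := Metric.eventually_nhds_iff_ball.1 hζ.eq_one
  exact ⟨ε, hε, fun x hx => h x (mem_ball_zero_iff.2 hx)⟩

theorem contDiff_smul (hζ : IsCutoff ζ) (R : ℝ) : ContDiff ℝ 1 fun x => ζ (R⁻¹ • x) :=
  hζ.contDiff.comp (contDiff_id.const_smul R⁻¹)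

theorem hasCompactSupport_smul (hζ : IsCutoff ζ) {R : ℝ} (hR : 0 < R) :
    HasCompactSupport fun x => ζ (R⁻¹ • x) :=
  hζ.hasCompactSupport.comp_smul (inv_ne_zero hR.ne')

/-- The gradient is `R⁻¹ ∇ζ(x / R)`, nonzero only where `ε R ≤ ‖x‖ < r R`; there `R⁻¹` is at most `r
/ ‖x‖`, whence a bound free of `R`. -/
theorem exists_fderiv_bound (hζ : IsCutoff ζ) : ∃ ε C : ℝ, 0 < ε ∧ 0 ≤ C ∧ ∀ R : ℝ, 0 < R →
    ∀ x : Eucl d, (‖x‖ < ε * R → fderiv ℝ (fun y => ζ (R⁻¹ • y)) x = 0) ∧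
      ‖fderiv ℝ (fun y => ζ (R⁻¹ • y)) x‖ * ‖x‖ ≤ C := by
  obtain ⟨ε, hε, h1⟩ := hζ.exists_ball
  have hc := hζ.hasCompactSupport.fderiv (𝕜 := ℝ)
  obtain ⟨M, hM⟩ := (hζ.contDiff.continuous_fderiv one_ne_zero).bounded_above_of_compact_support hc
  obtain ⟨r, hr, hr'⟩ := SignedRadon.exists_radius hc.norm
  have hM0 : 0 ≤ M := (norm_nonneg _).trans (hM 0)
  refine ⟨ε, M * r, hε, by positivity, fun R hR x => ?_⟩
  have hnorm : ‖R⁻¹ • x‖ = ‖x‖ / R := by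
    rw [norm_smul, norm_inv, Real.norm_of_nonneg hR.le, inv_mul_eq_div]
  rw [fderiv_comp_smul]
  refine ⟨fun hx => ?_, ?_⟩
  · have hx' : ‖R⁻¹ • x‖ < ε := by rwa [hnorm, div_lt_iff₀ hR]
    have : ζ =ᶠ[𝓝 (R⁻¹ • x)] fun _ => 1 := by
      filter_upwards [Metric.isOpen_ball.mem_nhds (mem_ball_zero_iff.2 hx')] with y hy
      exact h1 y (mem_ball_zero_iff.1 hy)
    rw [this.fderiv_eq]
    simp
  · rcases le_or_gt r ‖R⁻¹ • x‖ with h | h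
    · rw [norm_eq_zero.1 (hr' _ h), smul_zero, norm_zero, zero_mul]
      positivity
    · rw [norm_smul, norm_inv, Real.norm_of_nonneg hR.le]
      rw [hnorm] at h
      calc R⁻¹ * ‖fderiv ℝ ζ (R⁻¹ • x)‖ * ‖x‖ = ‖fderiv ℝ ζ (R⁻¹ • x)‖ * (‖x‖ / R) := by ring
        _ ≤ M * r := mul_le_mul (hM _) h.le (by positivity) hM0

/-- At a fixed point the gradient vanishes once `R` is large. As soon as `R ≥ ε⁻¹` it vanishes in
the unit ball and is dominated outside by a multiple of `‖x‖⁻¹`, whose `q`-th power is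
`γ`-integrable there. -/
theorem tendsto_lintegral_fderiv (hζ : IsCutoff ζ) {q : ℝ} (hq : 0 < q) {γ : Measure (Eucl d)}
    (hγ : genMomentum (-q) γ < ∞) (v : Eucl d) :
    Tendsto (fun R : ℝ => ∫⁻ x, ‖fderiv ℝ (fun y => ζ (R⁻¹ • y)) x v‖ₑ ^ q ∂γ) atTop (𝓝 0) := by
  obtain ⟨ε, C, hε, hC, h⟩ := hζ.exists_fderiv_bound
  have hlim : Tendsto (fun R : ℝ => ∫⁻ x, ‖fderiv ℝ (fun y => ζ (R⁻¹ • y)) x v‖ₑ ^ q ∂γ) atTop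
      (𝓝 (∫⁻ _ : Eucl d, 0 ∂γ)) := by
    refine tendsto_lintegral_filter_of_dominated_convergence
      (fun x => ENNReal.ofReal ((C * ‖v‖) ^ q) *
        (Metric.ball (0 : Eucl d) 1)ᶜ.indicator (fun x => ENNReal.ofReal (‖x‖ ^ (-q))) x) ?_ ?_ ?_ ?_
    · refine Eventually.of_forall fun R => ?_
      exact ((((hζ.contDiff_smul R).continuous_fderiv one_ne_zero).clm_apply
        continuous_const).enorm.measurable).pow_const q
    · filter_upwards [eventually_ge_atTop ε⁻¹, eventually_gt_atTop 0] with R hR hR0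
      refine Eventually.of_forall fun x => ?_
      have hεR : 1 ≤ ε * R := by
        have := mul_le_mul_of_nonneg_left hR hε.le
        rwa [mul_inv_cancel₀ hε.ne'] at this
      obtain ⟨h0, hb⟩ := h R hR0 x
      rcases lt_or_ge ‖x‖ (ε * R) with hx | hx
      · simp [h0 hx, ENNReal.zero_rpow_of_pos hq]
      have hx1 : 1 ≤ ‖x‖ := hεR.trans hx
      have hx0 : 0 < ‖x‖ := one_pos.trans_le hx1
      rw [Set.indicator_of_mem (by simpa using hx1), ← ENNReal.ofReal_mul (by positivity),
        ← ofReal_norm, ENNReal.ofReal_rpow_of_nonneg (norm_nonneg _) hq.le,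
        Real.rpow_neg hx0.le, ← Real.inv_rpow hx0.le,
        ← Real.mul_rpow (by positivity) (by positivity)]
      refine ENNReal.ofReal_le_ofReal (Real.rpow_le_rpow (norm_nonneg _) ?_ hq.le)
      refine (ContinuousLinearMap.le_opNorm _ _).trans ?_
      rw [← div_eq_mul_inv, le_div_iff₀ hx0]
      nlinarith [norm_nonneg v]
    · rw [lintegral_const_mul' _ _ ENNReal.ofReal_ne_top,
        lintegral_indicator Metric.isOpen_ball.measurableSet.compl]
      exact ENNReal.mul_ne_top ENNReal.ofReal_ne_top
        (lt_of_le_of_lt (le_add_self) hγ).ne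
    · refine Eventually.of_forall fun x => tendsto_const_nhds.congr' ?_
      filter_upwards [eventually_gt_atTop (‖x‖ / ε), eventually_gt_atTop 0] with R hR hR0
      rw [div_lt_iff₀' hε] at hR
      simp [(h R hR0 x).1 hR, ENNReal.zero_rpow_of_pos hq]
  simpa using hlim

theorem tendsto_smul (hζ : IsCutoff ζ) (x : Eucl d) :
    ∀ᶠ R : ℝ in atTop, ζ (R⁻¹ • x) = 1 := by
  have : Tendsto (fun R : ℝ => R⁻¹ • x) atTop (𝓝 0) := by
    simpa using (tendsto_inv_atTop_zero (𝕜 := ℝ)).smul_const x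
  exact this.eventually hζ.eq_one

/-- The cutoff need be neither radially monotone nor at most `1`, so monotone convergence is
unavailable. Infinite mass is detected on the balls of radius `ε R` where the cutoff equals `1`;
finite mass allows dominated convergence. -/
theorem tendsto_lintegral (hζ : IsCutoff ζ) (m : Measure (Eucl d)) :
    Tendsto (fun R : ℝ => ∫⁻ x, ENNReal.ofReal (ζ (R⁻¹ • x)) ∂m) atTop (𝓝 (m Set.univ)) := by
  rcases eq_or_ne (m Set.univ) ∞ with hm | hm
  · rw [hm]
    obtain ⟨ε, hε, h1⟩ := hζ.exists_ball
    have hmono : Monotone fun R : ℝ => Metric.ball (0 : Eucl d) (ε * R) := fun R S hRS =>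
      Metric.ball_subset_ball (mul_le_mul_of_nonneg_left hRS hε.le)
    have hU : ⋃ R : ℝ, Metric.ball (0 : Eucl d) (ε * R) = Set.univ := by
      refine Set.eq_univ_of_forall fun x => Set.mem_iUnion.2 ⟨(‖x‖ + 1) / ε, ?_⟩
      rw [mul_div_cancel₀ _ hε.ne']
      simp
    have hball := tendsto_measure_iUnion_atTop (μ := m) hmono
    rw [hU, hm] at hball
    refine tendsto_nhds_top_mono hball ?_
    filter_upwards [eventually_gt_atTop 0] with R hR
    rw [Function.comp_apply, ← lintegral_indicator_one Metric.isOpen_ball.measurableSet]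
    refine lintegral_mono fun x => ?_
    refine Set.indicator_apply_le' (fun hx => ?_) fun _ => zero_le
    rw [h1 (R⁻¹ • x), ENNReal.ofReal_one, Pi.one_apply]
    rw [norm_smul, norm_inv, Real.norm_of_nonneg hR.le, inv_mul_lt_iff₀ hR, mul_comm]
    exact mem_ball_zero_iff.1 hx
  · obtain ⟨M, hM⟩ := hζ.contDiff.continuous.bounded_above_of_compact_support hζ.hasCompactSupport
    have : Tendsto (fun R : ℝ => ∫⁻ x, ENNReal.ofReal (ζ (R⁻¹ • x)) ∂m) atTop
        (𝓝 (∫⁻ _, 1 ∂m)) := by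
      refine tendsto_lintegral_filter_of_dominated_convergence (fun _ => ENNReal.ofReal M) ?_ ?_ ?_ ?_
      · exact Eventually.of_forall fun R => (hζ.contDiff_smul R).continuous.measurable.ennreal_ofReal
      · exact Eventually.of_forall fun R => Eventually.of_forall fun x =>
          ENNReal.ofReal_le_ofReal ((le_abs_self _).trans (hM _))
      · rw [lintegral_const]
        exact ENNReal.mul_ne_top ENNReal.ofReal_ne_top hm
      · refine Eventually.of_forall fun x => tendsto_const_nhds.congr' ?_
        filter_upwards [hζ.tendsto_smul x] with R hR
        rw [hR, ENNReal.ofReal_one]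
    simpa using this

theorem tendsto_integral (hζ : IsCutoff ζ) (m : Measure (Eucl d)) [IsLocallyFiniteMeasure m] :
    Tendsto (fun R : ℝ => ((∫ x, ζ (R⁻¹ • x) ∂m : ℝ) : EReal)) atTop (𝓝 (m Set.univ : EReal)) := by
  refine ((continuous_coe_ennreal_ereal.tendsto _).comp (hζ.tendsto_lintegral m)).congr' ?_
  filter_upwards [eventually_gt_atTop 0] with R hR
  have hc := (hζ.contDiff_smul R).continuous
  have hi := hc.integrable_of_hasCompactSupport (μ := m) (hζ.hasCompactSupport_smul hR)
  rw [integral_eq_lintegral_of_nonneg_ae (Eventually.of_forall fun x => hζ.nonneg _)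
    hc.aestronglyMeasurable, Function.comp_apply, EReal.coe_ennreal_toReal]
  have := hi.hasFiniteIntegral
  rw [hasFiniteIntegral_iff_ofReal (Eventually.of_forall fun x => hζ.nonneg _)] at this
  exact this.ne

/-- Addition in `EReal` is continuous away from `∞ - ∞`, which `MassDefined` excludes. -/
theorem tendsto_cutoffMass (hζ : IsCutoff ζ) {σ : SignedRadon d} (hσ : σ.MassDefined) :
    Tendsto (fun R => (σ.cutoffMass ζ R : EReal)) atTop (𝓝 σ.totalMass) := by
  have hpos := σ.pos_locallyFinite
  have hneg := σ.neg_locallyFinite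
  have h := (hζ.tendsto_integral σ.pos).prodMk_nhds
    ((continuous_neg.tendsto _).comp (hζ.tendsto_integral σ.neg))
  have hadd := EReal.continuousAt_add (p := ((σ.pos Set.univ : EReal), -(σ.neg Set.univ : EReal)))
    (by
      rcases hσ with h | h
      · exact Or.inl (by simpa using h.ne)
      · exact Or.inr (by simpa using h.ne)) (Or.inl (EReal.coe_ennreal_ne_bot _))
  refine (hadd.tendsto.comp h).congr fun R => ?_
  simp only [SignedRadon.cutoffMass, SignedRadon.integral, Function.comp_apply, EReal.coe_sub]
  rw [sub_eq_add_neg]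

end IsCutoff

theorem exists_isCutoff (d : ℕ) : ∃ ζ : Eucl d → ℝ, IsCutoff ζ := by
  let f : ContDiffBump (0 : Eucl d) := ⟨1, 2, one_pos, one_lt_two⟩
  exact ⟨f, f.contDiff, fun x => f.nonneg, f.hasCompactSupport, f.eventuallyEq_one⟩

namespace IsActionDensityOn

variable {p q a b : ℝ} {φ : ℝ → Eucl d → ℝ≥0∞} {γ : Measure (Eucl d)} [IsLocallyFiniteMeasure γ]

theorem tendsto_cutoffMass_sub (hφ : IsActionDensityOn p a b φ) (hab : a < b)
    (hpq : p.HolderConjugate q) (hγ : genMomentum (-q) γ < ∞) {σ μ : SignedRadon d}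
    (hμ : μ ∈ finiteComponent p φ γ σ) {ζ : Eucl d → ℝ} (hζ : IsCutoff ζ) :
    Tendsto (fun R => μ.cutoffMass ζ R - σ.cutoffMass ζ R) atTop (𝓝 0) := by
  obtain ⟨C, hC, hest⟩ := hφ.exists_modifiedW_estimate (γ := γ) hab hpq
  have hq : 0 < q := hpq.symm.pos
  obtain ⟨A, hA, hA'⟩ := ENNReal.lt_iff_exists_nnreal_btwn.1 (show modifiedW p φ γ μ σ < ∞ from hμ)
  set D : ℝ≥0∞ := d * (ENNReal.ofReal C ^ (1 / p) * A) with hD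
  have hD' : D ≠ ∞ := by
    refine ENNReal.mul_ne_top (ENNReal.natCast_ne_top d) (ENNReal.mul_ne_top ?_ hA'.ne)
    exact ENNReal.rpow_ne_top_of_nonneg (one_div_nonneg.2 hpq.pos.le) ENNReal.ofReal_ne_top
  rw [← neg_zero, ← funext fun R => neg_sub (σ.cutoffMass ζ R) (μ.cutoffMass ζ R)]
  refine Tendsto.neg (tendsto_zero_iff_enorm_tendsto_zero.2 (ENNReal.tendsto_nhds_zero.2 ?_))
  intro η hη
  obtain ⟨δ, hδ, hδD⟩ := ENNReal.exists_nnreal_pos_mul_lt hD' hη.ne'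
  have hsmall : ∀ i : Fin d, ∀ᶠ R : ℝ in atTop,
      (∫⁻ x, ‖fderiv ℝ (fun y => ζ (R⁻¹ • y)) x (EuclideanSpace.single i 1)‖ₑ ^ q ∂γ) ^ (1 / q)
        ≤ δ := fun i => by
    -- The bound passed to the estimate is the positive constant `δ` rather than the norm itself,
    -- which may be zero.
    have := (hζ.tendsto_lintegral_fderiv hq hγ (EuclideanSpace.single i 1)).ennrpow_const (1 / q)
    rw [ENNReal.zero_rpow_of_pos (one_div_pos.2 hq)] at this
    exact this.eventually_le_const (by exact_mod_cast hδ)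
  filter_upwards [eventually_all.2 hsmall, eventually_gt_atTop 0] with R hR hR0
  refine (hest _ (hζ.contDiff_smul R) (hζ.hasCompactSupport_smul hR0) (fun _ => δ)
    (fun _ => by exact_mod_cast hδ.ne') (fun _ => ENNReal.coe_ne_top) hR μ σ A hA).trans ?_
  refine le_trans (le_of_eq ?_) hδD.le
  rw [Finset.sum_const, Finset.card_univ, Fintype.card_fin, nsmul_eq_mul, hD]
  ring

theorem tendsto_cutoffMass (hφ : IsActionDensityOn p a b φ) (hab : a < b)
    (hpq : p.HolderConjugate q) (hγ : genMomentum (-q) γ < ∞) {σ μ : SignedRadon d}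
    (hμ : μ ∈ finiteComponent p φ γ σ) (hσ : σ.MassDefined) {ζ : Eucl d → ℝ} (hζ : IsCutoff ζ) :
    Tendsto (fun R => (μ.cutoffMass ζ R : EReal)) atTop (𝓝 σ.totalMass) := by
  have hdiff := (continuous_coe_real_ereal.tendsto 0).comp
    (hφ.tendsto_cutoffMass_sub hab hpq hγ hμ hζ)
  have hadd := EReal.continuousAt_add (p := (((0 : ℝ) : EReal), σ.totalMass))
    (Or.inl (EReal.coe_ne_top 0)) (Or.inl (EReal.coe_ne_bot 0))
  have := hadd.tendsto.comp (hdiff.prodMk_nhds (hζ.tendsto_cutoffMass hσ))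
  simp only [EReal.coe_zero, zero_add] at this
  refine this.congr fun R => ?_
  simp only [Function.comp_apply]
  rw [← EReal.coe_add, sub_add_cancel]

end IsActionDensityOn

end TotalMass

theorem proposition3p4 {d : ℕ} {p q a b : ℝ} (hpq : p.HolderConjugate q) (hab : a < b)
    (φ : ℝ → Eucl d → ℝ≥0∞) (hφ : IsActionDensityOn p a b φ)
    (γ : Measure (Eucl d)) [IsLocallyFiniteMeasure γ] :
    -- every Cauchy sequence in the whole space converges
    (∀ u : ℕ → SignedRadon d,
      (∀ ε : ℝ≥0∞, 0 < ε → ∃ N : ℕ, ∀ m n : ℕ, N ≤ m → N ≤ n → modifiedW p φ γ (u m) (u n) < ε) →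
      ∃ μ : SignedRadon d, Tendsto (fun n => modifiedW p φ γ (u n) μ) atTop (𝓝 0)) ∧
    -- every finite-distance component is a complete metric space
    (∀ σ : SignedRadon d, ∃ _inst : MetricSpace (finiteComponent p φ γ σ),
      (∀ μ₀ μ₁ : finiteComponent p φ γ σ, edist μ₀ μ₁ = modifiedW p φ γ μ₀ μ₁) ∧
      CompleteSpace (finiteComponent p φ γ σ)) ∧
    -- equality of the total masses
    (genMomentum (-q) γ < ∞ → ∀ σ : SignedRadon d, ∀ μ ∈ finiteComponent p φ γ σ,
      (∀ ζ : Eucl d → ℝ, IsCutoff ζ →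
        Tendsto (fun R => μ.cutoffMass ζ R - σ.cutoffMass ζ R) atTop (𝓝 0)) ∧
      (σ.MassDefined → ∀ ζ : Eucl d → ℝ, IsCutoff ζ →
        Tendsto (fun R => (μ.cutoffMass ζ R : EReal)) atTop (𝓝 σ.totalMass)) ∧
      (σ.MassDefined → μ.MassDefined → μ.totalMass = σ.totalMass)) := by
  refine ⟨fun u hu => hφ.exists_limit_of_cauchy hab hpq u hu,
    fun σ => hφ.exists_metricSpace hab hpq σ, fun hγ σ μ hμ => ⟨fun ζ hζ =>
      hφ.tendsto_cutoffMass_sub hab hpq hγ hμ hζ, fun hσ ζ hζ =>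
      hφ.tendsto_cutoffMass hab hpq hγ hμ hσ hζ, fun hσ hμ' => ?_⟩⟩
  -- A single cutoff suffices: the cutoff masses of `μ` tend both to its own total mass and to that
  -- of `σ`.
  obtain ⟨ζ, hζ⟩ := exists_isCutoff d
  exact tendsto_nhds_unique (hζ.tendsto_cutoffMass hμ') (hφ.tendsto_cutoffMass hab hpq hγ hμ hσ hζ)
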